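/- Notation: $(b;q)_n=\prod_{i=0}^{n-1}(1-bq^i)$, $(b_1,\dots,b_m;q)_n=\prod_i (b_i;q)_n$, $${}_r\phi_s\!\left[{a_1,\dots,a_r\atop b_1,\dots,b_s};q,z\right]=\sum_{j\ge0}\frac{(a_1,\dots,a_r;q)_j}{(q,b_1,\dots,b_s;q)_j}\Big((-1)^jq^{j(j-1)/2}\Big)^{1+s-r}z^j,$$ and ${}_{r+1}W_r(a;b_1,\dots,b_{r-2};q,z)$ is the ${}_{r+1}\phi_r$ with upper parameters $a,q\sqrt a,-q\sqrt a,b_1,\dots,b_{r-2}$ and lower parameters $\sqrt a,-\sqrt a,aq/b_1,\dots,aq/b_{r-2}$. Let $a,k,q$ be nonzero complex numbers, $n\ge 0$ an integer, and fix any square roots $\sqrt a,\sqrt k,\sqrt q$; all other roots are formed from them ($\sqrt{kq}=\sqrt k\sqrt q$, $\sqrt{q/k}=\sqrt q/\sqrt k$, $\sqrt{aq}=\sqrt a\sqrt q$, $\sqrt{a/q}=\sqrt a/\sqrt q$, $a^{3/2}=(\sqrt a)^3$). Put $$P_n(a,k,q)=\frac{1-k}{1-kq^{2n}}\,\frac{(aq,k^2q/a^2;q)_n}{(k,k/a;q)_n},\qquad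 s=\frac{a}{\sqrt{kq}}.$$ Each of the following identities holds whenever none of the denominators in it vanishes. These are the denominators of the prefactor and the $q$-shifted factorials of the lower parameters and of the base in the terms with $j\le n$, or with $j\le\lfloor n/2\rfloor$ for the left side of (M4) and the right side of (M8). (M2) $${}_{10}\phi_9\!\left[{a,q\sqrt a,-q\sqrt a,a\sqrt{q/k},-a\sqrt{q/k},q\sqrt{kq},-q\sqrt{kq},\frac{a}{kq^2},kq^n,q^{-n}\atop \sqrt a,-\sqrt a,\sqrt{kq},-\sqrt{kq},s,-s,kq^3,\frac{aq^{1-n}}{k},aq^{n+1}};q,q\right]=P_n(a,k,q)\;{}_4\phi_3\!\left[{qs,-qs,\frac{a^2}{k^2q^3},q^{-n}\atop s,-s,\frac{a^2q^{-n}}{k^2}};q,q\right].$$ (M3) $${}_8\phi_7\!\left[{a,q\sqrt a,-q\sqrt a,-a\sqrt{q/k},-q\sqrt{kq},\frac a{kq},kq^n,q^{-n}\atop \sqrt a,-\sqrt a,-\sqrt{kq},-s,kq^2,\frac{aq^{1-n}}k,aq^{n+1}};q,q\right]=P_n(a,k,q)\;{}_5\phi_4\!\left[{qs,-qs,s,\frac{a^2}{k^2q^2},q^{-n}\atop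 s,-s,a\sqrt{q/k},\frac{a^2q^{-n}}{k^2}};q,q\right].$$ (M4) $${}_{16}W_{15}\Big(a;\tfrac a{\sqrt k},\tfrac{-a}{\sqrt k},a\sqrt{\tfrac qk},-a\sqrt{\tfrac qk},\tfrac{aq}{\sqrt k},\tfrac{-aq}{\sqrt k},aq\sqrt{\tfrac qk},-aq\sqrt{\tfrac qk},\tfrac{k^2q^2}{a^2},kq^n,kq^{n+1},q^{-n},q^{1-n};q^2,q^2\Big)$$ $$=P_n(a,k,q)\;{}_7\phi_6\!\left[{qs,-qs,\frac{a^2}{kq},\frac ak\sqrt{\frac aq},-\frac ak\sqrt{\frac aq},\frac{kq}a,q^{-n}\atop s,-s,\sqrt{aq},-\sqrt{aq},\frac{a^3}{k^2q},\frac{a^2q^{-n}}{k^2}};q,-\frac ak\right].$$ (M5) $$\sum_{j=0}^n\frac{(q\sqrt a,-q\sqrt a,a,\frac{k^2q^3}{a^2};q)_j}{(\sqrt a,-\sqrt a,\frac{a^3}{q^2k^2},q;q)_j}\,\frac{(\frac{a^2}k,-\frac{a^2}k,\frac{a^2q}k,-\frac{a^2q}k,k^2q^{2n},q^{-2n};q^2)_j\,q^j}{(kq,-kq,kq^2,-kq^2,\frac{a^2q^{2-2n}}{k^2},a^2q^{2+2n};q^2)_j}$$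 $$=P_n(a^2,k^2,q^2)\;{}_7\phi_6\!\left[{\frac{a^2q^2}{kq},-\frac{a^2q^2}{kq},\frac{a^4}{k^2q^2},\frac{-a^3}{k^2q^2},\frac{-a^3}{k^2q},\frac{k^2q^4}{a^2},q^{-2n}\atop \frac{a^2}{kq},-\frac{a^2}{kq},-aq,-aq^2,\frac{a^6}{k^4q^4},\frac{a^4q^{-2n}}{k^4}};q^2,\frac{a^2}{k^2q}\right].$$ (M6) $$\sum_{j=0}^n\frac{(a,\frac{k^2q^2}{a^2};q)_j}{(\frac{a^3}{qk^2},q;q)_j}\,\frac{(aq^2,-aq^2,\frac{a^2}k,-\frac{a^2}k,\frac{a^2q}k,-\frac{a^2q}k,k^2q^{2n},q^{-2n};q^2)_j\,q^j}{(a,-a,kq,-kq,kq^2,-kq^2,\frac{a^2q^{2-2n}}{k^2},a^2q^{2+2n};q^2)_j}$$ $$=P_n(a^2,k^2,q^2)\;{}_7\phi_6\!\left[{\frac{a^2q}{k},-\frac{a^2q}{k},\frac{a^4}{k^2q^2},\frac{-a^3}{k^2q},\frac{-a^3}{k^2},\frac{k^2q^2}{a^2},q^{-2n}\atop \frac{a^2}{kq},-\frac{a^2}{kq},-a,-aq,\frac{a^6}{k^4q^2},\frac{a^4q^{-2n}}{k^4}};q^2,\frac{a^2}{k^2q}\right].$$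 (M7) $${}_7\phi_6\!\left[{\frac a{\sqrt k},\frac{-a}{\sqrt k},a\sqrt{q/k},-a\sqrt{q/k},\frac{k^2q^3}{a^2},kq^n,q^{-n}\atop\sqrt{kq},-\sqrt{kq},q\sqrt k,-q\sqrt k,\frac{aq^{1-n}}k,aq^{n+1}};q,q\right]$$ $$=P_n(a,k,q)\;{}_9\phi_8\!\left[{qs,-qs,\frac{a^2}{kq},\frac{a^{3/2}}{kq},\frac{-a^{3/2}}{kq},\frac{a^{3/2}}{k\sqrt q},\frac{-a^{3/2}}{k\sqrt q},\frac{kq^2}a,q^{-n}\atop s,-s,\sqrt{aq},-\sqrt{aq},q\sqrt a,-q\sqrt a,\frac{a^3}{k^2q^2},\frac{a^2q^{-n}}{k^2}};q,q\right].$$ (M8) $${}_8\phi_7\!\left[{a,q\sqrt a,-q\sqrt a,a\sqrt{q/k},-a\sqrt{q/k},\frac a{kq},kq^n,q^{-n}\atop\sqrt a,-\sqrt a,\sqrt{kq},-\sqrt{kq},q^2k,\frac{aq^{1-n}}k,aq^{n+1}};q,-\frac{kq^2}a\right]$$ $$=P_n(a,k,q)\;{}_6\phi_5\!\left[{q^2s,-q^2s,\frac{a^2}{kq},\frac{a^2}{k^2q^2},q^{-n},q^{1-n}\atop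 s,-s,q^3k,\frac{a^2q^{-n}}{k^2},\frac{a^2q^{1-n}}{k^2}};q^2,q^2\right].$$ -/

import Mathlib

noncomputable section

/-- The `q`-shifted factorial `(b; q)_n = ∏_{i < n} (1 - b q^i)`. -/
def qPoch (b q : ℂ) (n : ℕ) : ℂ :=
  ∏ i ∈ Finset.range n, (1 - b * q ^ i)

/-- The multi-parameter symbol `(b₁, …, b_m; q)_n = (b₁; q)_n ⋯ (b_m; q)_n`. -/
def qPochs (bs : List ℂ) (q : ℂ) (n : ℕ) : ℂ :=
  (bs.map fun b => qPoch b q n).prod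

/-- The basic hypergeometric series `_rφ_s` with upper parameters `as` (so `r = as.length`),
lower parameters `bs` (so `s = bs.length`), base `q` and argument `z`:
`∑_{j ≥ 0} (as; q)_j / (q, bs; q)_j * ((-1)^j q^{j(j-1)/2})^{1+s-r} * z^j`.
When an upper parameter is `q^{-n}` all terms with `j > n` vanish. -/
def basicHyp (as bs : List ℂ) (q z : ℂ) : ℂ :=
  ∑' j : ℕ, qPochs as q j / qPochs (q :: bs) q j *
    ((-1) ^ j * q ^ (j * (j - 1) / 2)) ^ (1 + (bs.length : ℤ) - (as.length : ℤ)) * z ^ j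

/-- The very-well-poised series `_{r+1}W_r (a; b₁, …, b_m; q, z)`, `m = r - 2`:
the `_{r+1}φ_r` with upper parameters `a, q√a, -q√a, b₁, …, b_m`
and lower parameters `√a, -√a, aq/b₁, …, aq/b_m`; here `sa` is a square root of `a`. -/
def veryWellPoised (a sa : ℂ) (bs : List ℂ) (q z : ℂ) : ℂ :=
  basicHyp (a :: q * sa :: -(q * sa) :: bs) (sa :: -sa :: bs.map fun b => a * q / b) q z

/-- `(q; q)_n ≠ 0` and `(b; q)_n ≠ 0` for each listed denominator parameter `b`: none of the
denominators `(q; q)_j`, `(b; q)_j` with `0 ≤ j ≤ n` vanishes. -/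
def DenomsNonzero (bs : List ℂ) (q : ℂ) (n : ℕ) : Prop :=
  ∀ b ∈ q :: bs, qPoch b q n ≠ 0

/-- The factor `(1-k)/(1-kq^{2n}) * (aq, k²q/a²; q)_n / (k, k/a; q)_n`. -/
def chainPrefactor (a k q : ℂ) (n : ℕ) : ℂ :=
  (1 - k) / (1 - k * q ^ (2 * n)) *
    (qPochs [a * q, k ^ 2 * q / a ^ 2] q n / qPochs [k, k / a] q n)

/-- A transformation of a `_10φ_9` into a multiple of a `_4φ_3`. -/
def Transformation_10phi9_4phi3 (a k q sa sk sq : ℂ) (n : ℕ) : Prop :=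
  1 - k * q ^ (2 * n) ≠ 0 →
    DenomsNonzero
      [sa, -sa, sk * sq, -(sk * sq), a / (sk * sq), -(a / (sk * sq)), k * q ^ 3,
        a * q ^ (1 - (n : ℤ)) / k, a * q ^ (n + 1),
        a ^ 2 * q ^ (-(n : ℤ)) / k ^ 2, k, k / a] q n →
    basicHyp
      [a, q * sa, -(q * sa), a * (sq / sk), -(a * (sq / sk)), q * (sk * sq), -(q * (sk * sq)),
        a / (k * q ^ 2), k * q ^ n, q ^ (-(n : ℤ))]
      [sa, -sa, sk * sq, -(sk * sq), a / (sk * sq), -(a / (sk * sq)), k * q ^ 3,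
        a * q ^ (1 - (n : ℤ)) / k, a * q ^ (n + 1)] q q
    = chainPrefactor a k q n *
      basicHyp
        [q * (a / (sk * sq)), -(q * (a / (sk * sq))), a ^ 2 / (k ^ 2 * q ^ 3), q ^ (-(n : ℤ))]
        [a / (sk * sq), -(a / (sk * sq)), a ^ 2 * q ^ (-(n : ℤ)) / k ^ 2] q q

/-- A transformation of an `_8φ_7` into a multiple of a `_5φ_4`. -/
def Transformation_8phi7_5phi4 (a k q sa sk sq : ℂ) (n : ℕ) : Prop :=
  1 - k * q ^ (2 * n) ≠ 0 →
    DenomsNonzero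
      [sa, -sa, -(sk * sq), -(a / (sk * sq)), k * q ^ 2,
        a * q ^ (1 - (n : ℤ)) / k, a * q ^ (n + 1),
        a / (sk * sq), a * (sq / sk), a ^ 2 * q ^ (-(n : ℤ)) / k ^ 2, k, k / a] q n →
    basicHyp
      [a, q * sa, -(q * sa), -(a * (sq / sk)), -(q * (sk * sq)), a / (k * q),
        k * q ^ n, q ^ (-(n : ℤ))]
      [sa, -sa, -(sk * sq), -(a / (sk * sq)), k * q ^ 2,
        a * q ^ (1 - (n : ℤ)) / k, a * q ^ (n + 1)] q q
    = chainPrefactor a k q n *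
      basicHyp
        [q * (a / (sk * sq)), -(q * (a / (sk * sq))), a / (sk * sq), a ^ 2 / (k ^ 2 * q ^ 2),
          q ^ (-(n : ℤ))]
        [a / (sk * sq), -(a / (sk * sq)), a * (sq / sk),
          a ^ 2 * q ^ (-(n : ℤ)) / k ^ 2] q q

/-- A transformation of a `_16W_15` with base `q^2` into a multiple of a `_7φ_6` with base `q`. -/
def Transformation_16W15_7phi6 (a k q sa sk sq : ℂ) (n : ℕ) : Prop :=
  1 - k * q ^ (2 * n) ≠ 0 →
    DenomsNonzero
      ([sa, -sa] ++
        [a / sk, -(a / sk), a * (sq / sk), -(a * (sq / sk)), a * q / sk, -(a * q / sk),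
          a * q * (sq / sk), -(a * q * (sq / sk)), k ^ 2 * q ^ 2 / a ^ 2,
          k * q ^ n, k * q ^ (n + 1), q ^ (-(n : ℤ)), q ^ (1 - (n : ℤ))].map
            (fun b => a * q ^ 2 / b)) (q ^ 2) (n / 2) →
    DenomsNonzero
      [a / (sk * sq), -(a / (sk * sq)), sa * sq, -(sa * sq), a ^ 3 / (k ^ 2 * q),
        a ^ 2 * q ^ (-(n : ℤ)) / k ^ 2, k, k / a] q n →
    veryWellPoised a sa
      [a / sk, -(a / sk), a * (sq / sk), -(a * (sq / sk)), a * q / sk, -(a * q / sk),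
        a * q * (sq / sk), -(a * q * (sq / sk)), k ^ 2 * q ^ 2 / a ^ 2,
        k * q ^ n, k * q ^ (n + 1), q ^ (-(n : ℤ)), q ^ (1 - (n : ℤ))] (q ^ 2) (q ^ 2)
    = chainPrefactor a k q n *
      basicHyp
        [a * q / (sk * sq), -(a * q / (sk * sq)), a ^ 2 / (k * q),
          a / k * (sa / sq), -(a / k * (sa / sq)), k * q / a, q ^ (-(n : ℤ))]
        [a / (sk * sq), -(a / (sk * sq)), sa * sq, -(sa * sq), a ^ 3 / (k ^ 2 * q),
          a ^ 2 * q ^ (-(n : ℤ)) / k ^ 2] q (-(a / k))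

/-- A transformation of a finite sum mixing the bases `q` and `q^2` into a multiple of a `_7φ_6`
with base `q^2` (from Bressoud's first pair). -/
def Transformation_BressoudI_7phi6 (a k q sa : ℂ) (n : ℕ) : Prop :=
  1 - k ^ 2 * q ^ (4 * n) ≠ 0 →
    DenomsNonzero [sa, -sa, a ^ 3 / (q ^ 2 * k ^ 2)] q n →
    DenomsNonzero
      [k * q, -(k * q), k * q ^ 2, -(k * q ^ 2), a ^ 2 * q ^ (2 - 2 * (n : ℤ)) / k ^ 2,
        a ^ 2 * q ^ (2 + 2 * n),
        a ^ 2 / (k * q), -(a ^ 2 / (k * q)), -(a * q), -(a * q ^ 2), a ^ 6 / (k ^ 4 * q ^ 4),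
        a ^ 4 * q ^ (-(2 * (n : ℤ))) / k ^ 4, k ^ 2, k ^ 2 / a ^ 2] (q ^ 2) n →
    ∑ j ∈ Finset.range (n + 1),
      qPochs [q * sa, -(q * sa), a, k ^ 2 * q ^ 3 / a ^ 2] q j /
        qPochs [sa, -sa, a ^ 3 / (q ^ 2 * k ^ 2), q] q j *
      (qPochs [a ^ 2 / k, -(a ^ 2 / k), a ^ 2 * q / k, -(a ^ 2 * q / k),
          k ^ 2 * q ^ (2 * n), q ^ (-(2 * (n : ℤ)))] (q ^ 2) j * q ^ j /
        qPochs [k * q, -(k * q), k * q ^ 2, -(k * q ^ 2),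
          a ^ 2 * q ^ (2 - 2 * (n : ℤ)) / k ^ 2, a ^ 2 * q ^ (2 + 2 * n)] (q ^ 2) j)
    = chainPrefactor (a ^ 2) (k ^ 2) (q ^ 2) n *
      basicHyp
        [a ^ 2 * q ^ 2 / (k * q), -(a ^ 2 * q ^ 2 / (k * q)), a ^ 4 / (k ^ 2 * q ^ 2),
          -(a ^ 3 / (k ^ 2 * q ^ 2)), -(a ^ 3 / (k ^ 2 * q)), k ^ 2 * q ^ 4 / a ^ 2,
          q ^ (-(2 * (n : ℤ)))]
        [a ^ 2 / (k * q), -(a ^ 2 / (k * q)), -(a * q), -(a * q ^ 2), a ^ 6 / (k ^ 4 * q ^ 4),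
          a ^ 4 * q ^ (-(2 * (n : ℤ))) / k ^ 4] (q ^ 2) (a ^ 2 / (k ^ 2 * q))

/-- A transformation of a finite sum mixing the bases `q` and `q^2` into a multiple of a `_7φ_6`
with base `q^2` (from Bressoud's second pair). -/
def Transformation_BressoudII_7phi6 (a k q : ℂ) (n : ℕ) : Prop :=
  1 - k ^ 2 * q ^ (4 * n) ≠ 0 →
    DenomsNonzero [a ^ 3 / (q * k ^ 2)] q n →
    DenomsNonzero
      [a, -a, k * q, -(k * q), k * q ^ 2, -(k * q ^ 2),
        a ^ 2 * q ^ (2 - 2 * (n : ℤ)) / k ^ 2, a ^ 2 * q ^ (2 + 2 * n),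
        a ^ 2 / (k * q), -(a ^ 2 / (k * q)), -(a * q), a ^ 6 / (k ^ 4 * q ^ 2),
        a ^ 4 * q ^ (-(2 * (n : ℤ))) / k ^ 4, k ^ 2, k ^ 2 / a ^ 2] (q ^ 2) n →
    ∑ j ∈ Finset.range (n + 1),
      qPochs [a, k ^ 2 * q ^ 2 / a ^ 2] q j / qPochs [a ^ 3 / (q * k ^ 2), q] q j *
      (qPochs [a * q ^ 2, -(a * q ^ 2), a ^ 2 / k, -(a ^ 2 / k), a ^ 2 * q / k,
          -(a ^ 2 * q / k), k ^ 2 * q ^ (2 * n), q ^ (-(2 * (n : ℤ)))] (q ^ 2) j * q ^ j /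
        qPochs [a, -a, k * q, -(k * q), k * q ^ 2, -(k * q ^ 2),
          a ^ 2 * q ^ (2 - 2 * (n : ℤ)) / k ^ 2, a ^ 2 * q ^ (2 + 2 * n)] (q ^ 2) j)
    = chainPrefactor (a ^ 2) (k ^ 2) (q ^ 2) n *
      basicHyp
        [a ^ 2 * q / k, -(a ^ 2 * q / k), a ^ 4 / (k ^ 2 * q ^ 2),
          -(a ^ 3 / (k ^ 2 * q)), -(a ^ 3 / k ^ 2), k ^ 2 * q ^ 2 / a ^ 2,
          q ^ (-(2 * (n : ℤ)))]
        [a ^ 2 / (k * q), -(a ^ 2 / (k * q)), -a, -(a * q), a ^ 6 / (k ^ 4 * q ^ 2),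
          a ^ 4 * q ^ (-(2 * (n : ℤ))) / k ^ 4] (q ^ 2) (a ^ 2 / (k ^ 2 * q))

/-- A transformation of a `_7φ_6` into a multiple of a `_9φ_8`. -/
def Transformation_7phi6_9phi8 (a k q sa sk sq : ℂ) (n : ℕ) : Prop :=
  1 - k * q ^ (2 * n) ≠ 0 →
    DenomsNonzero
      [sk * sq, -(sk * sq), q * sk, -(q * sk),
        a * q ^ (1 - (n : ℤ)) / k, a * q ^ (n + 1),
        a / (sk * sq), -(a / (sk * sq)), sa * sq, -(sa * sq), q * sa, -(q * sa),
        a ^ 3 / (k ^ 2 * q ^ 2), a ^ 2 * q ^ (-(n : ℤ)) / k ^ 2, k, k / a] q n →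
    basicHyp
      [a / sk, -(a / sk), a * (sq / sk), -(a * (sq / sk)), k ^ 2 * q ^ 3 / a ^ 2,
        k * q ^ n, q ^ (-(n : ℤ))]
      [sk * sq, -(sk * sq), q * sk, -(q * sk),
        a * q ^ (1 - (n : ℤ)) / k, a * q ^ (n + 1)] q q
    = chainPrefactor a k q n *
      basicHyp
        [a * q / (sk * sq), -(a * q / (sk * sq)), a ^ 2 / (k * q),
          sa ^ 3 / (k * q), -(sa ^ 3 / (k * q)), sa ^ 3 / (k * sq), -(sa ^ 3 / (k * sq)),
          k * q ^ 2 / a, q ^ (-(n : ℤ))]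
        [a / (sk * sq), -(a / (sk * sq)), sa * sq, -(sa * sq), q * sa, -(q * sa),
          a ^ 3 / (k ^ 2 * q ^ 2), a ^ 2 * q ^ (-(n : ℤ)) / k ^ 2] q q

/-- A transformation of an `_8φ_7` with base `q` into a multiple of a `_6φ_5` with base `q^2`. -/
def Transformation_8phi7_6phi5 (a k q sa sk sq : ℂ) (n : ℕ) : Prop :=
  1 - k * q ^ (2 * n) ≠ 0 →
    DenomsNonzero
      [sa, -sa, sk * sq, -(sk * sq), q ^ 2 * k,
        a * q ^ (1 - (n : ℤ)) / k, a * q ^ (n + 1), k, k / a] q n →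
    DenomsNonzero
      [a / (sk * sq), -(a / (sk * sq)), q ^ 3 * k, a ^ 2 * q ^ (-(n : ℤ)) / k ^ 2,
        a ^ 2 * q ^ (1 - (n : ℤ)) / k ^ 2] (q ^ 2) (n / 2) →
    basicHyp
      [a, q * sa, -(q * sa), a * (sq / sk), -(a * (sq / sk)), a / (k * q),
        k * q ^ n, q ^ (-(n : ℤ))]
      [sa, -sa, sk * sq, -(sk * sq), q ^ 2 * k,
        a * q ^ (1 - (n : ℤ)) / k, a * q ^ (n + 1)] q (-(k * q ^ 2 / a))
    = chainPrefactor a k q n *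
      basicHyp
        [a * q ^ 2 / (sk * sq), -(a * q ^ 2 / (sk * sq)), a ^ 2 / (k * q),
          a ^ 2 / (k ^ 2 * q ^ 2), q ^ (-(n : ℤ)), q ^ (1 - (n : ℤ))]
        [a / (sk * sq), -(a / (sk * sq)), q ^ 3 * k, a ^ 2 * q ^ (-(n : ℤ)) / k ^ 2,
          a ^ 2 * q ^ (1 - (n : ℤ)) / k ^ 2] (q ^ 2) (q ^ 2)

end

open Finset

noncomputable section

/-! All seven identities are one transformation applied to different well-poised Bailey pairs. A
pair relative to `(a, a * b)` consists of sequences with `β n = ∑ j ≤ n, wpKer a b q n j * α j`. The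
chain step `wp_chain` multiplies `α` by an explicit factor and turns a pair relative to `(a, a * c)`
into one relative to `(a, a / (c * q))`. To prove it, one inserts the definition of `β` and
interchanges the sums; the inner sum then has the closed form `chain_kernel_sum`. The choice `c = a
/ (k * q)` ends at `(a, k)`. Rewriting the symbols of length `n - j` and `n + j` as terminating
parameters such as `q ^ (-n)` and `k * q ^ n` gives `transformation_of_pair`, with a sum over `α` on
the left and `chainPrefactor` times a sum over `β` on the right.

The pairs come from closed forms for `∑ j, wpKer a b q n j * α j`, each proved by creative
telescoping: sum and closed form satisfy the same first-order recurrence in `n`. `saalschutz_pair`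
gives `Transformation_7phi6_9phi8`, `even_pair` gives `Transformation_16W15_7phi6`, and the two
Bressoud pairs, taken in base `q ^ 2`, give the transformations named after them. The other three
use a pair backwards: up to diagonal factors the kernel for `(a, a * b)` is inverse to the kernel
for `(a * b, a)`, so `α` and `β` exchange roles (`wp_inversion`, `transformation_of_inverse_pair`).
Fed with `chain_pair`, `sqrt_pair` and `even_pair`, this gives the transformations with right sides
`_4φ_3`, `_5φ_4` and `_6φ_5`.

These arguments divide by quantities that are not denominators of the identities. They are therefore
carried out for multiplicatively independent `a, k, q`, where every such quantity is nonzero. At an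
admissible point both sides are continuous functions of the square roots of `a, k, q`, and
independent triples accumulate there (`frequently_mulIndep`), so the identities extend. -/

theorem qPoch_zero (b q : ℂ) : qPoch b q 0 = 1 := by simp [qPoch]

theorem qPoch_succ (b q : ℂ) (n : ℕ) : qPoch b q (n + 1) = qPoch b q n * (1 - b * q ^ n) := by
  simp [qPoch, Finset.prod_range_succ]

theorem qPoch_add (b q : ℂ) (m n : ℕ) :
    qPoch b q (m + n) = qPoch b q m * qPoch (b * q ^ m) q n := by
  simp only [qPoch, Finset.prod_range_add]
  congr 1
  exact Finset.prod_congr rfl fun i _ => by rw [pow_add]; ring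

theorem qPoch_succ' (b q : ℂ) (n : ℕ) :
    qPoch b q (n + 1) = (1 - b) * qPoch (b * q) q n := by
  rw [add_comm, qPoch_add, qPoch_succ, qPoch_zero]; simp

/-! ### The well-poised Bailey kernel and creative telescoping -/

/-- The Bailey-type kernel `(b)_{n-j} (ab)_{n+j} / ((q)_{n-j} (aq)_{n+j})`, i.e. the kernel of
well-poised Bailey pairs relative to `(a, k)` with `k = a * b`. -/
def wpKer (a b q : ℂ) (n j : ℕ) : ℂ :=
  qPoch b q (n - j) * qPoch (a * b) q (n + j) / (qPoch q q (n - j) * qPoch (a * q) q (n + j))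

/-- Creative telescoping for sums against the kernel `wpKer`. -/
theorem wpKer_sum_rec {a b q u v : ℂ} {A g : ℕ → ℂ} (n : ℕ) (hq0 : q ≠ 0)
    (hq : ∀ m, qPoch q q m ≠ 0) (haq : ∀ m, qPoch (a * q) q m ≠ 0) (hbq : q - b ≠ 0)
    (g0 : g 0 = 0)
    (h : ∀ j, (u * (q ^ j - b * q ^ n) * (1 - a * b * q ^ n * q ^ j)
        - v * (q ^ j - q * q ^ n) * (1 - a * q * q ^ n * q ^ j)) * A j
      = (1 - a * b * q ^ n * q ^ j) * (q ^ j - q * q ^ n) * g (j + 1)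
        - (q ^ j - b * q ^ n) * (1 - a * q * q ^ n * q ^ j) * g j) :
    u * ∑ j ∈ range (n + 2), wpKer a b q (n + 1) j * A j
      = v * ∑ j ∈ range (n + 1), wpKer a b q n j * A j := by
  -- The kernel part of `G` lies between levels `n` and `n + 1`, so it differs from both kernels,
  -- and from its own shift in `j`, by linear factors only.
  set G : ℕ → ℂ := fun j => qPoch b q (n + 1 - j) * qPoch (a * b) q (n + j) /
    (qPoch q q (n + 1 - j) * qPoch (a * q) q (n + j)) * g j with hG
  have step : ∀ j ∈ range (n + 1),
      u * (wpKer a b q (n + 1) j * A j) - v * (wpKer a b q n j * A j) = G (j + 1) - G j := by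
    intro j hj
    obtain ⟨l, rfl⟩ : ∃ l, n = j + l := ⟨n - j, by have := Finset.mem_range.1 hj; omega⟩
    have e1 : j + l + 1 - j = l + 1 := by omega
    have e2 : j + l - j = l := by omega
    have e3 : j + l + 1 - (j + 1) = l := by omega
    have e4 : j + l + 1 + j = j + l + j + 1 := by omega
    have e5 : j + l + (j + 1) = j + l + j + 1 := by omega
    simp only [hG, wpKer, e1, e2, e3, e4, e5, qPoch_succ]
    have h1 := hq (l + 1)
    have h2 := haq (j + l + j + 1)
    rw [qPoch_succ] at h1 h2
    have h3 := left_ne_zero_of_mul h1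
    have h4 := left_ne_zero_of_mul h2
    have h5 := right_ne_zero_of_mul h1
    have h6 := right_ne_zero_of_mul h2
    have hy : q ^ j ≠ 0 := pow_ne_zero _ hq0
    have hh : u * (1 - b * q ^ l) * (1 - a * b * q ^ (j + l + j)) * A j
        - v * (1 - q * q ^ l) * (1 - a * q * q ^ (j + l + j)) * A j
        = (1 - a * b * q ^ (j + l + j)) * (1 - q * q ^ l) * g (j + 1)
        - (1 - b * q ^ l) * (1 - a * q * q ^ (j + l + j)) * g j := by
      -- With `l = n - j`, the factor `q ^ j` turns `1 - b * q ^ l` into `q ^ j - b * q ^ n`. In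
      -- this form hypothesis `h` is free of subtraction in exponents and makes sense for every `j`.
      apply mul_left_cancel₀ hy
      have := h j
      simp only [pow_add] at this ⊢
      linear_combination this
    generalize 1 - q * q ^ l = s at *
    generalize 1 - a * q * q ^ (j + l + j) = t at *
    generalize qPoch (a * b) q (j + l + j) = R at *
    field_simp
    linear_combination (qPoch b q l * R) * hh
  -- At `j = n + 1` the level-`n` kernel contributes no term. Accordingly `q ^ j - q * q ^ n`
  -- vanishes in `h`, and the rest can be divided by `q ^ n * (q - b)`; this is the role of `hbq`.
  have last : u * (wpKer a b q (n + 1) (n + 1) * A (n + 1)) = - G (n + 1) := by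
    have hh := h (n + 1)
    have h2 := haq (n + (n + 1) + 1)
    rw [qPoch_succ] at h2
    have h4 := left_ne_zero_of_mul h2
    have h6 := right_ne_zero_of_mul h2
    have e4 : n + 1 + (n + 1) = n + (n + 1) + 1 := by omega
    have hy : q ^ n ≠ 0 := pow_ne_zero _ hq0
    simp only [hG, wpKer, Nat.sub_self, e4, qPoch_succ _ _ (n + (n + 1)), qPoch_zero]
    have hh : u * (1 - a * b * q ^ (n + (n + 1))) * A (n + 1)
        = - (1 - a * q * q ^ (n + (n + 1))) * g (n + 1) := by
      apply mul_left_cancel₀ (mul_ne_zero hy hbq)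
      simp only [pow_add, pow_one] at hh ⊢
      linear_combination hh
    generalize 1 - a * q * q ^ (n + (n + 1)) = t at *
    generalize qPoch (a * b) q (n + (n + 1)) = R at *
    field_simp
    linear_combination R * hh
  have tel := Finset.sum_range_sub G (n + 1)
  have hG0 : G 0 = 0 := by simp [hG, g0]
  rw [hG0, sub_zero, ← Finset.sum_congr rfl step, Finset.sum_sub_distrib, ← Finset.mul_sum,
    ← Finset.mul_sum] at tel
  rw [Finset.sum_range_succ, mul_add, last]
  linear_combination tel

/-- Two sequences with the same initial value and the same first-order recurrence agree when the
leading coefficient never vanishes. For each pair below, `hB` is read off the closed form and `hS`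
comes from `wpKer_sum_rec` with an explicit certificate. -/
theorem wpKer_sum_of_ratio {a b q : ℂ} {A B : ℕ → ℂ} (u v : ℕ → ℂ)
    (hu : ∀ n, u n ≠ 0) (hB0 : wpKer a b q 0 0 * A 0 = B 0)
    (hB : ∀ n, u n * B (n + 1) = v n * B n)
    (hS : ∀ n, u n * ∑ j ∈ range (n + 2), wpKer a b q (n + 1) j * A j
      = v n * ∑ j ∈ range (n + 1), wpKer a b q n j * A j) (n : ℕ) :
    ∑ j ∈ range (n + 1), wpKer a b q n j * A j = B n := by
  induction n with
  | zero => simpa using hB0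
  | succ n ih =>
    apply mul_left_cancel₀ (hu n)
    rw [hS, hB, ih]

theorem wpKer_zero (a b q : ℂ) : wpKer a b q 0 0 = 1 := by simp [wpKer, qPoch_zero]

/-! ### Closed-form well-poised Bailey pairs -/

/-- After reversal of the kernel the sum is, up to a factor depending on `n`, a terminating balanced
`_3φ_2` with upper parameters `a b q^n, q^{-n}, q/b²` and lower parameters `q^{1-n}/b, a q^{n+1}`.
The value is thus an instance of the q-Pfaff–Saalschütz sum. -/
theorem saalschutz_pair {a b q : ℂ} (hq0 : q ≠ 0) (hb0 : b ≠ 0)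
    (hq : ∀ m : ℕ, 1 - q * q ^ m ≠ 0) (haq : ∀ m : ℕ, 1 - (a * q) * q ^ m ≠ 0)
    (hbq : q - b ≠ 0) (hk : ∀ m : ℕ, 1 - (a * b ^ 2) * q ^ m ≠ 0) (n : ℕ) :
    ∑ j ∈ range (n + 1), wpKer a b q n j * (qPoch (q / b ^ 2) q j / qPoch q q j * b ^ j)
      = qPoch (a * b) q n * qPoch (q / b) q n * qPoch (a * b ^ 2) q (2 * n)
        / (qPoch q q n * qPoch (a * b ^ 2) q n * qPoch (a * q) q (2 * n)) := by
  have P : ∀ {x : ℂ}, (∀ m : ℕ, 1 - x * q ^ m ≠ 0) → ∀ m, qPoch x q m ≠ 0 := fun h m =>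
    Finset.prod_ne_zero_iff.2 fun i _ => h i
  refine wpKer_sum_of_ratio
    (A := fun j => qPoch (q / b ^ 2) q j / qPoch q q j * b ^ j)
    (B := fun n => qPoch (a * b) q n * qPoch (q / b) q n * qPoch (a * b ^ 2) q (2 * n)
        / (qPoch q q n * qPoch (a * b ^ 2) q n * qPoch (a * q) q (2 * n)))
    (fun n => (1 - q * q ^ n) * (1 - a * b ^ 2 * q ^ n) * (1 - a * q * q ^ (2 * n)) *
      (1 - a * q * q ^ (2 * n + 1)))
    (fun n => (1 - a * b * q ^ n) * (1 - q / b * q ^ n) * (1 - a * b ^ 2 * q ^ (2 * n)) *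
      (1 - a * b ^ 2 * q ^ (2 * n + 1))) ?_ ?_ ?_ ?_ n
  · intro n
    exact mul_ne_zero (mul_ne_zero (mul_ne_zero (hq _) (hk _)) (haq _)) (haq _)
  · simp [wpKer_zero, qPoch_zero]
  · intro n
    have h1 := hq n; have h2 := hk n; have h3 := haq (2 * n); have h4 := haq (2 * n + 1)
    have e : 2 * (n + 1) = 2 * n + 1 + 1 := by ring
    have := P hq n; have := P hk n; have := P haq (2 * n)
    simp only [e, qPoch_succ]
    generalize 1 - q * q ^ n = t1 at *
    generalize 1 - a * b ^ 2 * q ^ n = t2 at *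
    generalize 1 - a * q * q ^ (2 * n) = t3 at *
    generalize 1 - a * q * q ^ (2 * n + 1) = t4 at *
    generalize 1 - a * b ^ 2 * q ^ (2 * n) = t5 at *
    generalize 1 - a * b ^ 2 * q ^ (2 * n + 1) = t6 at *
    field_simp
  · intro n
    -- The certificate `g` is the summand times a rational function of `q ^ n` and `q ^ j`. Its
    -- factor `1 - q ^ j` gives `g 0 = 0` and, after the shift, cancels the last factor of `(q;
    -- q)_{j+1}`. The later certificates have the same shape.
    refine wpKer_sum_rec (g := fun j => qPoch (q / b ^ 2) q j / qPoch q q j * b ^ j *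
      (1 - q ^ j) * ((1 - a * b * q * (q ^ n) ^ 2) *
        (-(q * q ^ n) * (1 - a * b ^ 2 * q ^ n) * (1 - a * q * (q ^ n) ^ 2) -
         a * b * q ^ n * (1 + a * b * q * (q ^ n) ^ 2 - q * q ^ n - q * q ^ n / b) *
          (q ^ j - q * q ^ n))) / q ^ j) n hq0 (P hq) (P haq) hbq (by simp) ?_
    intro j
    have hy : q ^ j ≠ 0 := pow_ne_zero _ hq0
    have h1 := hq j; have := P hq j
    simp only [qPoch_succ, pow_succ, pow_mul']
    generalize q ^ n = x at *
    generalize qPoch (q / b ^ 2) q j = p1 at *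
    generalize qPoch q q j = p2 at *
    generalize b ^ j = p3 at *
    generalize q ^ j = y at *
    have h1' : 1 - y * q ≠ 0 := by rwa [mul_comm]
    field_simp
    ring

theorem qPoch_ne_of_forall {q x : ℂ} (h : ∀ m : ℕ, 1 - x * q ^ m ≠ 0) (m : ℕ) :
    qPoch x q m ≠ 0 :=
  Finset.prod_ne_zero_iff.2 fun i _ => h i

/-- Polynomial part of a telescoping certificate. -/
def sqrtPairCert (r b q x y : ℂ) : ℂ :=
  -q * x + b * q * x + r * b * q * x ^ 2 - r * b * q ^ 2 * x ^ 2 + r ^ 2 * b * q * x ^ 2 - r ^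
  2 * b ^ 3 * q ^ 2 * x ^ 2 - r ^ 3 * b ^ 2 * q ^ 2 * x ^ 4 + r ^ 3 * b ^ 2 * q ^ 3 * x ^ 4 -
  r ^ 4 * b ^ 2 * q ^ 2 * x ^ 4 + r ^ 4 * b ^ 2 * q ^ 3 * x ^ 5 - r ^ 4 * b ^ 3 * q ^ 3 * x ^
  5 + r ^ 4 * b ^ 4 * q ^ 3 * x ^ 4 - r * x * y + r * b * q * x * y + r ^ 2 * q * x ^ 2 * y -
  r ^ 2 * b * x * y + r ^ 2 * b ^ 2 * q * x * y - r ^ 2 * b ^ 2 * q * x ^ 2 * y + r ^ 3 * b *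
  q * x ^ 2 * y - r ^ 3 * b ^ 3 * q * x ^ 2 * y - r ^ 4 * b * q ^ 2 * x ^ 4 * y + r ^ 4 * b ^
  3 * q ^ 2 * x ^ 4 * y - r ^ 5 * b ^ 2 * q ^ 2 * x ^ 4 * y + r ^ 5 * b ^ 2 * q ^ 2 * x ^ 5 *
  y - r ^ 5 * b ^ 3 * q ^ 3 * x ^ 5 * y + r ^ 5 * b ^ 4 * q ^ 2 * x ^ 4 * y + r ^ 6 * b ^ 3 *
  q ^ 2 * x ^ 5 * y - r ^ 6 * b ^ 4 * q ^ 3 * x ^ 5 * y + r ^ 3 * x ^ 2 * y ^ 2 - r ^ 3 * b *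
  x * y ^ 2 + r ^ 3 * b ^ 2 * x * y ^ 2 - r ^ 3 * b ^ 2 * q * x ^ 2 * y ^ 2 + r ^ 4 * b ^ 2 *
  x ^ 2 * y ^ 2 - r ^ 4 * b ^ 2 * q * x ^ 2 * y ^ 2 - r ^ 5 * b * q * x ^ 4 * y ^ 2 + r ^ 5 *
  b ^ 3 * q ^ 2 * x ^ 4 * y ^ 2 - r ^ 6 * b ^ 3 * q * x ^ 4 * y ^ 2 + r ^ 6 * b ^ 3 * q ^ 2 *
  x ^ 4 * y ^ 2 + r ^ 7 * b ^ 3 * q ^ 2 * x ^ 5 * y ^ 2 - r ^ 7 * b ^ 4 * q ^ 2 * x ^ 5 * y ^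
  2

/-- Here `r` is a square root of the base parameter. The weight contains only the half `(1 + r q^j)
/ (1 + r)` of the very-well-poised factor `(1 - r² q^{2j}) / (1 - r²)`, which is why the root itself
enters the closed form. -/
theorem sqrt_pair {r b q : ℂ} (hq0 : q ≠ 0) (hb0 : b ≠ 0) (hb1 : 1 - b ≠ 0)
    (hq : ∀ m : ℕ, 1 - q * q ^ m ≠ 0) (haq : ∀ m : ℕ, 1 - (r ^ 2 * q) * q ^ m ≠ 0)
    (hbq : q - b ≠ 0) (hk : ∀ m : ℕ, 1 - (r ^ 2 * b ^ 2 * q) * q ^ m ≠ 0)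
    (hr : ∀ m : ℕ, 1 + r * q ^ m ≠ 0) (hr' : ∀ m : ℕ, 1 - r * q ^ m ≠ 0)
    (hrb : 1 + b * r ≠ 0) (n : ℕ) :
    ∑ j ∈ range (n + 1), wpKer (r ^ 2) b q n j *
        ((1 + r * q ^ j) / (1 + r) * (qPoch (1 / b ^ 2) q j / qPoch q q j) * b ^ j)
      = qPoch (r ^ 2 * b) q n * qPoch (1 / b) q n * qPoch (r ^ 2 * b ^ 2) q (2 * n)
        / (qPoch q q n * qPoch (r ^ 2 * b ^ 2 * q) q n * qPoch (r ^ 2 * q) q (2 * n)) *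
        ((1 + r * q ^ n) * (1 + b * r * q ^ n) / ((1 + r) * (1 + b * r))) := by
  refine wpKer_sum_of_ratio
    (A := fun j => (1 + r * q ^ j) / (1 + r) * (qPoch (1 / b ^ 2) q j / qPoch q q j) * b ^ j)
    (B := fun n => qPoch (r ^ 2 * b) q n * qPoch (1 / b) q n * qPoch (r ^ 2 * b ^ 2) q (2 * n)
        / (qPoch q q n * qPoch (r ^ 2 * b ^ 2 * q) q n * qPoch (r ^ 2 * q) q (2 * n)) *
        ((1 + r * q ^ n) * (1 + b * r * q ^ n) / ((1 + r) * (1 + b * r))))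
    -- The common factor `1 - b` in both coefficients changes nothing in the recurrence but clears a
    -- denominator of the certificate: `sqrtPairCert` is not divisible by it. The factors `1 + r * q
    -- ^ (n + 1)` and `1 + b * r * q ^ n` have been cancelled from the ratio of consecutive closed
    -- forms by means of `f1` and `f2` below.
    (fun n => (1 - b) * (1 - q * q ^ n) * (1 - r ^ 2 * b ^ 2 * q * q ^ n) *
      (1 - r ^ 2 * q * q ^ (2 * n)) * (1 - r * q ^ (n + 1)) * (1 + r * q ^ n))
    (fun n => (1 - b) * (1 - r ^ 2 * b * q ^ n) * (1 - 1 / b * q ^ n) * (1 - b * r * q ^ n) *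
      (1 - r ^ 2 * b ^ 2 * q ^ (2 * n + 1)) * (1 + b * r * q ^ (n + 1))) ?_ ?_ ?_ ?_ n
  · intro n
    exact mul_ne_zero (mul_ne_zero (mul_ne_zero (mul_ne_zero (mul_ne_zero hb1 (hq _)) (hk _))
      (haq _)) (hr' _)) (hr _)
  · have := hr 0
    simp only [pow_zero, mul_one] at this
    simp [wpKer_zero, qPoch_zero, this, hrb]
  · intro n
    have h1 := hq n; have h2 := hk n; have h3 := haq (2 * n); have h4 := haq (2 * n + 1)
    have h0 := hr 0
    simp only [pow_zero, mul_one] at h0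
    have e : 2 * (n + 1) = 2 * n + 1 + 1 := by ring
    have := qPoch_ne_of_forall hq n; have := qPoch_ne_of_forall hk n
    have := qPoch_ne_of_forall haq (2 * n)
    have f1 : 1 - r ^ 2 * q * q ^ (2 * n + 1) = (1 - r * q ^ (n + 1)) * (1 + r * q ^ (n + 1)) := by
      ring
    have f2 : 1 - r ^ 2 * b ^ 2 * q ^ (2 * n) = (1 - b * r * q ^ n) * (1 + b * r * q ^ n) := by
      ring
    rw [f1] at h4
    have h5 := left_ne_zero_of_mul h4
    have h6 := right_ne_zero_of_mul h4
    simp only [e, qPoch_succ, f1, f2]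
    generalize 1 - q * q ^ n = t1 at *
    generalize 1 - r ^ 2 * b ^ 2 * q * q ^ n = t2 at *
    generalize 1 - r ^ 2 * q * q ^ (2 * n) = t3 at *
    generalize 1 - r * q ^ (n + 1) = t4 at *
    generalize 1 + r * q ^ (n + 1) = t5 at *
    generalize 1 - r ^ 2 * b ^ 2 * q ^ (2 * n + 1) = t6 at *
    generalize 1 + b * r * q ^ (n + 1) = t7 at *
    generalize 1 + b * r * q ^ n = t8 at *
    generalize 1 - b * r * q ^ n = t9 at *
    generalize 1 + b * r = t10 at *
    generalize 1 + r = t11 at *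
    generalize 1 - b = t12 at *
    generalize 1 - 1 / b * q ^ n = t13 at *
    generalize 1 - r ^ 2 * b * q ^ n = t14 at *
    generalize qPoch q q n = s1 at *
    generalize qPoch (r ^ 2 * b ^ 2 * q) q n = s2 at *
    generalize qPoch (r ^ 2 * q) q (2 * n) = s3 at *
    generalize qPoch (r ^ 2 * b) q n = s4 at *
    generalize qPoch (1 / b) q n = s5 at *
    generalize qPoch (r ^ 2 * b ^ 2) q (2 * n) = s6 at *
    rw [div_mul_div_comm, div_mul_div_comm, mul_div_assoc', mul_div_assoc', div_eq_div_iff]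
    · ring
    · simp_all
    · simp_all
  · intro n
    refine wpKer_sum_rec (g := fun j => qPoch (1 / b ^ 2) q j / qPoch q q j * b ^ j *
      (1 - q ^ j) * sqrtPairCert r b q (q ^ n) (q ^ j) / (q ^ j * (1 + r))) n hq0
      (qPoch_ne_of_forall hq) (qPoch_ne_of_forall haq) hbq (by simp) ?_
    intro j
    have hy : q ^ j ≠ 0 := pow_ne_zero _ hq0
    have h1 := hq j; have := qPoch_ne_of_forall hq j
    have h0 := hr 0
    simp only [pow_zero, mul_one] at h0
    simp only [qPoch_succ, pow_succ, pow_mul', pow_zero, one_mul]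
    generalize q ^ n = x at *
    generalize qPoch (1 / b ^ 2) q j = p1 at *
    generalize qPoch q q j = p2 at *
    generalize b ^ j = p3 at *
    generalize q ^ j = y at *
    have h1' : 1 - y * q ≠ 0 := by rwa [mul_comm]
    -- Both values of the certificate polynomial stay opaque while denominators are cleared; only
    -- the final `ring` expands them.
    obtain ⟨c1, hc1⟩ : ∃ c, c = sqrtPairCert r b q x y := ⟨_, rfl⟩
    obtain ⟨c2, hc2⟩ : ∃ c, c = sqrtPairCert r b q x (y * q) := ⟨_, rfl⟩
    rw [← hc1, ← hc2]
    field_simp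
    rw [hc1, hc2, sqrtPairCert, sqrtPairCert]
    ring

/-- Polynomial part of a telescoping certificate. -/
def chainPairCert (a b q x y : ℂ) : ℂ :=
  -q ^ 2 * x + b * q ^ 2 * x + a * b * q ^ 2 * x ^ 2 - a * b ^ 3 * q ^ 4 * x ^ 2 - a ^ 2 * b ^
  2 * q ^ 3 * x ^ 4 + a ^ 2 * b ^ 2 * q ^ 4 * x ^ 5 - a ^ 2 * b ^ 3 * q ^ 4 * x ^ 5 + a ^ 2 *
  b ^ 4 * q ^ 5 * x ^ 4 + a * q ^ 2 * x ^ 2 * y - a * b * q * x * y - a * b * q * x ^ 2 * y +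
  a * b * q ^ 3 * x ^ 2 * y - a * b ^ 2 * q ^ 2 * x ^ 2 * y + a * b ^ 2 * q ^ 3 * x * y - a ^
  2 * b * q ^ 3 * x ^ 4 * y + a ^ 2 * b ^ 2 * q ^ 2 * x ^ 4 * y - a ^ 2 * b ^ 2 * q ^ 4 * x ^
  4 * y + a ^ 2 * b ^ 3 * q ^ 3 * x ^ 4 * y + a ^ 3 * b ^ 3 * q ^ 3 * x ^ 5 * y - a ^ 3 * b ^
  4 * q ^ 5 * x ^ 5 * y + a * x * y ^ 2 - a * b * q ^ 2 * x * y ^ 2 - a ^ 2 * b * q ^ 2 * x ^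
  2 * y ^ 2 + a ^ 2 * b ^ 2 * q * x ^ 2 * y ^ 2 - a ^ 2 * b ^ 2 * q ^ 3 * x ^ 2 * y ^ 2 + a ^
  2 * b ^ 3 * q ^ 2 * x ^ 2 * y ^ 2 - a ^ 3 * b ^ 2 * q ^ 2 * x ^ 5 * y ^ 2 + a ^ 3 * b ^ 2 *
  q ^ 3 * x ^ 4 * y ^ 2 - a ^ 3 * b ^ 3 * q ^ 2 * x ^ 4 * y ^ 2 + a ^ 3 * b ^ 3 * q ^ 4 * x ^
  4 * y ^ 2 + a ^ 3 * b ^ 3 * q ^ 4 * x ^ 5 * y ^ 2 - a ^ 3 * b ^ 4 * q ^ 3 * x ^ 4 * y ^ 2 -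
  a ^ 2 * x ^ 2 * y ^ 3 + a ^ 2 * b * q * x * y ^ 3 - a ^ 2 * b ^ 2 * q * x * y ^ 3 + a ^ 2 *
  b ^ 2 * q ^ 2 * x ^ 2 * y ^ 3 + a ^ 3 * b * q * x ^ 4 * y ^ 3 - a ^ 3 * b ^ 3 * q ^ 3 * x ^
  4 * y ^ 3 - a ^ 4 * b ^ 3 * q ^ 3 * x ^ 5 * y ^ 3 + a ^ 4 * b ^ 4 * q ^ 3 * x ^ 5 * y ^ 3

/-- In this pair the full very-well-poised factor is present, but `(a; q)_j` is absent from the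
summand. The closed form carries `(a; q)_{2n}` in its denominator, so the hypothesis concerns all `1
- a * q ^ m`, including `m = 0`. -/
theorem chain_pair {a b q : ℂ} (hq0 : q ≠ 0) (hb0 : b ≠ 0) (hb1 : 1 - b ≠ 0)
    (hq : ∀ m : ℕ, 1 - q * q ^ m ≠ 0) (ha : ∀ m : ℕ, 1 - a * q ^ m ≠ 0)
    (hbq : q - b ≠ 0) (hk : ∀ m : ℕ, 1 - (a * b ^ 2 * q ^ 2) * q ^ m ≠ 0) (n : ℕ) :
    ∑ j ∈ range (n + 1), wpKer a b q n j *
        ((1 - a * q ^ (2 * j)) / (1 - a) * (qPoch (1 / (b ^ 2 * q)) q j / qPoch q q j) * b ^ j)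
      = qPoch (a * b) q n * qPoch (1 / (b * q)) q n * qPoch (a * b ^ 2 * q) q (2 * n)
        / (qPoch q q n * qPoch (a * b ^ 2 * q ^ 2) q n * qPoch a q (2 * n)) := by
  have haq : ∀ m : ℕ, 1 - a * q * q ^ m ≠ 0 := fun m => by
    have := ha (m + 1)
    rwa [pow_succ', ← mul_assoc] at this
  refine wpKer_sum_of_ratio
    (A := fun j => (1 - a * q ^ (2 * j)) / (1 - a) *
      (qPoch (1 / (b ^ 2 * q)) q j / qPoch q q j) * b ^ j)
    (B := fun n => qPoch (a * b) q n * qPoch (1 / (b * q)) q n * qPoch (a * b ^ 2 * q) q (2 * n)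
        / (qPoch q q n * qPoch (a * b ^ 2 * q ^ 2) q n * qPoch a q (2 * n)))
    (fun n => (1 - b) * (1 - q * q ^ n) * (1 - a * b ^ 2 * q ^ 2 * q ^ n) *
      (1 - a * q ^ (2 * n)) * (1 - a * q ^ (2 * n + 1)))
    (fun n => (1 - b) * (1 - a * b * q ^ n) * (1 - 1 / (b * q) * q ^ n) *
      (1 - a * b ^ 2 * q * q ^ (2 * n)) * (1 - a * b ^ 2 * q * q ^ (2 * n + 1))) ?_ ?_ ?_ ?_ n
  · intro n
    exact mul_ne_zero (mul_ne_zero (mul_ne_zero (mul_ne_zero hb1 (hq _)) (hk _)) (ha _)) (ha _)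
  · have := ha 0
    simp only [pow_zero, mul_one] at this
    simp [wpKer_zero, qPoch_zero, this]
  · intro n
    have h1 := hq n; have h2 := hk n; have h3 := ha (2 * n); have h4 := ha (2 * n + 1)
    have e : 2 * (n + 1) = 2 * n + 1 + 1 := by ring
    have := qPoch_ne_of_forall hq n; have := qPoch_ne_of_forall hk n
    have := qPoch_ne_of_forall ha (2 * n)
    simp only [e, qPoch_succ]
    generalize 1 - q * q ^ n = t1 at *
    generalize 1 - a * b ^ 2 * q ^ 2 * q ^ n = t2 at *
    generalize 1 - a * q ^ (2 * n) = t3 at *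
    generalize 1 - a * q ^ (2 * n + 1) = t4 at *
    generalize 1 - a * b ^ 2 * q * q ^ (2 * n) = t6 at *
    generalize 1 - a * b ^ 2 * q * q ^ (2 * n + 1) = t7 at *
    generalize 1 - 1 / (b * q) * q ^ n = t8 at *
    generalize 1 - a * b * q ^ n = t9 at *
    generalize 1 - b = t12 at *
    field_simp
  · intro n
    refine wpKer_sum_rec (g := fun j => qPoch (1 / (b ^ 2 * q)) q j / qPoch q q j * b ^ j *
      (1 - q ^ j) * chainPairCert a b q (q ^ n) (q ^ j) / (q * q ^ j * (1 - a))) n hq0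
      (qPoch_ne_of_forall hq) (qPoch_ne_of_forall haq) hbq (by simp) ?_
    intro j
    have hy : q ^ j ≠ 0 := pow_ne_zero _ hq0
    have h1 := hq j; have := qPoch_ne_of_forall hq j
    have h0 := ha 0
    simp only [pow_zero, mul_one] at h0
    simp only [qPoch_succ, pow_succ, pow_mul', pow_zero, one_mul]
    generalize q ^ n = x at *
    generalize qPoch _ q j = p1 at *
    generalize qPoch q q j = p2 at *
    generalize b ^ j = p3 at *
    generalize q ^ j = y at *
    have h1' : 1 - y * q ≠ 0 := by rwa [mul_comm]
    obtain ⟨c1, hc1⟩ : ∃ c, c = chainPairCert a b q x y := ⟨_, rfl⟩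
    obtain ⟨c2, hc2⟩ : ∃ c, c = chainPairCert a b q x (y * q) := ⟨_, rfl⟩
    rw [← hc1, ← hc2]
    field_simp
    rw [hc1, hc2, chainPairCert, chainPairCert]
    ring

theorem sum_range_even {f : ℕ → ℂ} (hf : ∀ i, f (2 * i + 1) = 0) (n : ℕ) :
    ∑ j ∈ range (n + 1), f j = ∑ i ∈ range (n / 2 + 1), f (2 * i) := by
  induction n with
  | zero => simp
  | succ n ih =>
    rw [Finset.sum_range_succ, ih]
    obtain ⟨m, rfl | rfl⟩ : ∃ m, n = 2 * m ∨ n = 2 * m + 1 := ⟨n / 2, by omega⟩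
    · rw [hf, show (2 * m + 1) / 2 = 2 * m / 2 by omega, add_zero]
    · rw [show (2 * m + 1 + 1) / 2 = (2 * m + 1) / 2 + 1 by omega,
        Finset.sum_range_succ _ ((2 * m + 1) / 2 + 1)]
      congr 2
      omega

/-- The sequence `α` is supported on even indices, where it is very-well-poised in base `q ^ 2`.
Extending it by zero to odd indices makes the sum an ordinary kernel sum, to which the same
telescoping applies. -/
theorem even_pair {a b q : ℂ} (hq0 : q ≠ 0) (hb0 : b ≠ 0) (hb1 : 1 - b ≠ 0)
    (hq : ∀ m : ℕ, 1 - q * q ^ m ≠ 0) (ha : ∀ m : ℕ, 1 - a * q ^ m ≠ 0)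
    (hbq : q - b ≠ 0) (hk : ∀ m : ℕ, 1 - (a * b ^ 2 * q) * q ^ m ≠ 0) (n : ℕ) :
    ∑ i ∈ range (n / 2 + 1), wpKer a b q n (2 * i) *
        ((1 - a * q ^ (4 * i)) / (1 - a) * (qPoch a (q ^ 2) i * qPoch (1 / b ^ 2) (q ^ 2) i /
          (qPoch (q ^ 2) (q ^ 2) i * qPoch (a * b ^ 2 * q ^ 2) (q ^ 2) i)) * b ^ (2 * i))
      = qPoch (a * b) q n * qPoch (1 / b) q n * qPoch (a * b ^ 2 * q) (q ^ 2) n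
        / (qPoch q q n * qPoch (a * b ^ 2 * q) q n * qPoch (a * q) (q ^ 2) n) * (-b) ^ n := by
  have haq : ∀ m : ℕ, 1 - a * q * q ^ m ≠ 0 := fun m => by
    have := ha (m + 1)
    rwa [pow_succ', ← mul_assoc] at this
  have hq2 : ∀ m : ℕ, 1 - q ^ 2 * (q ^ 2) ^ m ≠ 0 := fun m => by
    have := hq (2 * m + 1)
    rwa [show q * q ^ (2 * m + 1) = q ^ 2 * (q ^ 2) ^ m by ring] at this
  have haq2 : ∀ m : ℕ, 1 - a * q * (q ^ 2) ^ m ≠ 0 := fun m => by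
    have := haq (2 * m)
    rwa [show a * q * q ^ (2 * m) = a * q * (q ^ 2) ^ m by ring] at this
  have hk2 : ∀ m : ℕ, 1 - (a * b ^ 2 * q ^ 2) * (q ^ 2) ^ m ≠ 0 := fun m => by
    have := hk (2 * m + 1)
    rwa [show a * b ^ 2 * q * q ^ (2 * m + 1) = a * b ^ 2 * q ^ 2 * (q ^ 2) ^ m by ring] at this
  have h0 := ha 0
  simp only [pow_zero, mul_one] at h0
  set p : ℕ → ℂ := fun i => qPoch a (q ^ 2) i * qPoch (1 / b ^ 2) (q ^ 2) i /
    (qPoch (q ^ 2) (q ^ 2) i * qPoch (a * b ^ 2 * q ^ 2) (q ^ 2) i) * b ^ (2 * i) with hp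
  have hps : ∀ i, p (i + 1) * ((1 - q ^ 2 * (q ^ i) ^ 2) * (1 - a * b ^ 2 * q ^ 2 * (q ^ i) ^ 2))
      = p i * ((1 - a * (q ^ i) ^ 2) * (b ^ 2 - (q ^ i) ^ 2)) := by
    intro i
    have h1 := hq2 i; have h2 := hk2 i
    have := qPoch_ne_of_forall hq2 i; have := qPoch_ne_of_forall hk2 i
    have e : b ^ (2 * (i + 1)) = b ^ (2 * i) * b ^ 2 := by ring
    simp only [hp, qPoch_succ, e]
    rw [pow_right_comm q 2 i] at h1 h2 ⊢
    generalize qPoch a (q ^ 2) i = s1 at *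
    generalize qPoch (1 / b ^ 2) (q ^ 2) i = s2 at *
    generalize qPoch (q ^ 2) (q ^ 2) i = s3 at *
    generalize qPoch (a * b ^ 2 * q ^ 2) (q ^ 2) i = s4 at *
    generalize b ^ (2 * i) = s5 at *
    generalize 1 - q ^ 2 * (q ^ i) ^ 2 = s6 at *
    generalize 1 - a * b ^ 2 * q ^ 2 * (q ^ i) ^ 2 = s7 at *
    field_simp
  set A : ℕ → ℂ := fun j => if j % 2 = 0 then
    (1 - a * q ^ (2 * j)) / (1 - a) * p (j / 2) else 0 with hA
  have hA0 : ∀ i, A (2 * i) = (1 - a * (q ^ i) ^ 4) / (1 - a) * p i := fun i => by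
    have e : q ^ (2 * (2 * i)) = (q ^ i) ^ 4 := by ring
    simp [hA, e]
  have hA1 : ∀ i, A (2 * i + 1) = 0 := fun i => by
    simp [hA]
  have hsum : ∀ n, ∑ i ∈ range (n / 2 + 1), wpKer a b q n (2 * i) *
        ((1 - a * q ^ (4 * i)) / (1 - a) * (qPoch a (q ^ 2) i * qPoch (1 / b ^ 2) (q ^ 2) i /
          (qPoch (q ^ 2) (q ^ 2) i * qPoch (a * b ^ 2 * q ^ 2) (q ^ 2) i)) * b ^ (2 * i))
      = ∑ j ∈ range (n + 1), wpKer a b q n j * A j := by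
    intro n
    rw [sum_range_even (f := fun j => wpKer a b q n j * A j) (fun i => by simp only [hA1, mul_zero])]
    refine Finset.sum_congr rfl fun i _ => ?_
    rw [hA0, hp]
    ring
  rw [hsum]
  refine wpKer_sum_of_ratio (A := A)
    (B := fun n => qPoch (a * b) q n * qPoch (1 / b) q n * qPoch (a * b ^ 2 * q) (q ^ 2) n
        / (qPoch q q n * qPoch (a * b ^ 2 * q) q n * qPoch (a * q) (q ^ 2) n) * (-b) ^ n)
    (fun n => (1 - b) * (1 - q * q ^ n) * (1 - a * b ^ 2 * q * q ^ n) *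
      (1 - a * q * (q ^ 2) ^ n))
    (fun n => (1 - b) * (-b) * (1 - a * b * q ^ n) * (1 - 1 / b * q ^ n) *
      (1 - a * b ^ 2 * q * (q ^ 2) ^ n)) ?_ ?_ ?_ ?_ n
  · intro n
    exact mul_ne_zero (mul_ne_zero (mul_ne_zero hb1 (hq _)) (hk _)) (haq2 _)
  · simp [wpKer_zero, qPoch_zero, hA, hp, h0]
  · intro n
    have h1 := hq n; have h2 := hk n; have h3 := haq2 n
    have := qPoch_ne_of_forall hq n; have := qPoch_ne_of_forall hk n
    have := qPoch_ne_of_forall haq2 n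
    simp only [qPoch_succ, pow_succ (-b)]
    generalize 1 - q * q ^ n = t1 at *
    generalize 1 - a * b ^ 2 * q * q ^ n = t2 at *
    generalize 1 - a * q * (q ^ 2) ^ n = t3 at *
    generalize 1 - a * b ^ 2 * q * (q ^ 2) ^ n = t6 at *
    generalize 1 - 1 / b * q ^ n = t8 at *
    generalize 1 - a * b * q ^ n = t9 at *
    generalize 1 - b = t12 at *
    generalize (-b) ^ n = t13 at *
    field_simp
  · intro n
    -- The antidifference does not vanish at odd indices: there the telescoping equation is
    -- homogeneous and merely links `g (2 * i + 1)` to `g (2 * i + 2)`, so each parity has its own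
    -- formula. The exponent `j - 1` is used only for odd `j`, where no truncation occurs.
    set g : ℕ → ℂ := fun j => if j % 2 = 0 then
      -p (j / 2) * (1 - q ^ j) * (1 - a * b ^ 2 * q ^ j) * (1 - a * b * q * (q ^ n) ^ 2) *
        (q ^ j - b * q * q ^ n) * (1 - a * q ^ n * q ^ j) / (q ^ j * (1 - a))
      else -p (j / 2) * (1 - a * b * q * (q ^ n) ^ 2) * (1 - a * b * q ^ n * q ^ j) *
        (q ^ (j - 1) - q ^ n) * (1 - a * q ^ (j - 1)) * (b ^ 2 - q ^ (j - 1)) /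
          (q ^ (j - 1) * (1 - a)) with hg
    have hg0 : ∀ i, g (2 * i) = -p i * (1 - (q ^ i) ^ 2) * (1 - a * b ^ 2 * (q ^ i) ^ 2) *
        (1 - a * b * q * (q ^ n) ^ 2) * ((q ^ i) ^ 2 - b * q * q ^ n) *
        (1 - a * q ^ n * (q ^ i) ^ 2) / ((q ^ i) ^ 2 * (1 - a)) := fun i => by
      have e : q ^ (2 * i) = (q ^ i) ^ 2 := by ring
      simp [hg, e]
    have hg1 : ∀ i, g (2 * i + 1) = -p i * (1 - a * b * q * (q ^ n) ^ 2) *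
        (1 - a * b * q ^ n * (q * (q ^ i) ^ 2)) * ((q ^ i) ^ 2 - q ^ n) *
        (1 - a * (q ^ i) ^ 2) * (b ^ 2 - (q ^ i) ^ 2) / ((q ^ i) ^ 2 * (1 - a)) := fun i => by
      have e : q ^ (2 * i) = (q ^ i) ^ 2 := by ring
      have e1 : q ^ (2 * i + 1) = q * (q ^ i) ^ 2 := by ring
      have e2 : (2 * i + 1) / 2 = i := by omega
      simp [hg, e, e1, e2]
    -- The formula at `2 * (i + 1)` involves `p (i + 1)`; its factors `1 - q^{2i+2}` and `1 - a b²
    -- q^{2i+2}` are exactly those that `hps` trades for `p i`.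
    have hg2 : ∀ i, g (2 * i + 1 + 1) = -p i * ((1 - a * (q ^ i) ^ 2) * (b ^ 2 - (q ^ i) ^ 2)) *
        (1 - a * b * q * (q ^ n) ^ 2) * (q ^ 2 * (q ^ i) ^ 2 - b * q * q ^ n) *
        (1 - a * q ^ n * (q ^ 2 * (q ^ i) ^ 2)) / (q ^ 2 * (q ^ i) ^ 2 * (1 - a)) := fun i => by
      have e1 : (q ^ (i + 1)) ^ 2 = q ^ 2 * (q ^ i) ^ 2 := by ring
      rw [show 2 * i + 1 + 1 = 2 * (i + 1) by ring, hg0, e1, neg_mul (p i), ← hps]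
      ring
    refine wpKer_sum_rec (g := g) n hq0
      (qPoch_ne_of_forall hq) (qPoch_ne_of_forall haq) hbq (by simp [hg]) ?_
    intro j
    obtain ⟨i, rfl | rfl⟩ : ∃ i, j = 2 * i ∨ j = 2 * i + 1 := ⟨j / 2, by omega⟩
    · have hy : q ^ i ≠ 0 := pow_ne_zero _ hq0
      have e : q ^ (2 * i) = (q ^ i) ^ 2 := by ring
      rw [hg0, hg1, hA0, e, ← pow_mul, mul_comm 2 n, pow_mul]
      generalize q ^ n = x at *
      generalize p i = P at *
      generalize q ^ i = y at *
      field_simp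
      ring
    · have hy : q ^ i ≠ 0 := pow_ne_zero _ hq0
      have e : q ^ (2 * i + 1) = q * (q ^ i) ^ 2 := by ring
      rw [hg2, hg1, hA1, e]
      generalize q ^ n = x at *
      generalize p i = P at *
      generalize q ^ i = y at *
      field_simp
      ring

/-- Polynomial part of a telescoping certificate. -/
def bressoudICert (a b q x y : ℂ) : ℂ :=
  -q ^ 3 * x ^ 2 - a * b ^ 2 * q ^ 2 * x ^ 2 + a ^ 2 * b ^ 2 * q ^ 5 * x ^ 6 + a ^ 3 * b ^ 4 *
  q ^ 4 * x ^ 6 - q * y - a * q ^ 2 * x ^ 2 * y - a * b ^ 2 * q ^ 2 * x ^ 2 * y + a ^ 3 * b ^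
  2 * q ^ 4 * x ^ 6 * y + a ^ 3 * b ^ 4 * q ^ 4 * x ^ 6 * y + a ^ 4 * b ^ 4 * q ^ 5 * x ^ 8 *
  y - a * q ^ 2 * x ^ 2 * y ^ 2 - a ^ 2 * b ^ 2 * q * x ^ 2 * y ^ 2 + a ^ 3 * b ^ 2 * q ^ 4 *
  x ^ 6 * y ^ 2 + a ^ 4 * b ^ 4 * q ^ 3 * x ^ 6 * y ^ 2

/-- The kernel runs in base `q ^ 2` with parameters `a ^ 2, b ^ 2`, while the summand runs in base
`q`. Telescoping still works because the kernel contributes only polynomials in `(q ^ n) ^ 2` and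
`(q ^ j) ^ 2`, so the certificate is again rational in `q ^ n` and `q ^ j`. -/
theorem bressoudI_pair {a b q : ℂ} (hq0 : q ≠ 0) (hb0 : b ≠ 0)
    (hq : ∀ m : ℕ, 1 - q * q ^ m ≠ 0) (hq2 : ∀ m : ℕ, 1 - q ^ 2 * (q ^ 2) ^ m ≠ 0)
    (haq : ∀ m : ℕ, 1 - a ^ 2 * q ^ 2 * (q ^ 2) ^ m ≠ 0) (ha : 1 - a ≠ 0)
    (hbq : q ^ 2 - b ^ 2 ≠ 0) (hlo : ∀ m : ℕ, 1 - a * b ^ 2 * q ^ m ≠ 0)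
    (hm : ∀ m : ℕ, 1 - -(a * q) * q ^ m ≠ 0)
    (hbot : ∀ m : ℕ, 1 - a ^ 2 * b ^ 4 * (q ^ 2) ^ m ≠ 0) (n : ℕ) :
    ∑ j ∈ range (n + 1), wpKer (a ^ 2) (b ^ 2) (q ^ 2) n j *
        ((1 - a * q ^ (2 * j)) / (1 - a) * (qPoch a q j * qPoch (q / b ^ 2) q j /
          (qPoch q q j * qPoch (a * b ^ 2) q j)) * (b ^ 2 / q) ^ j)
      = qPoch (a ^ 2 * b ^ 2) (q ^ 2) n * qPoch (-(a * b ^ 2)) q (2 * n) *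
          qPoch (q ^ 2 / b ^ 2) (q ^ 2) n
        / (qPoch (q ^ 2) (q ^ 2) n * qPoch (-(a * q)) q (2 * n) *
          qPoch (a ^ 2 * b ^ 4) (q ^ 2) n) * (b ^ 2 / q) ^ n := by
  refine wpKer_sum_of_ratio
    (A := fun j => (1 - a * q ^ (2 * j)) / (1 - a) * (qPoch a q j * qPoch (q / b ^ 2) q j /
          (qPoch q q j * qPoch (a * b ^ 2) q j)) * (b ^ 2 / q) ^ j)
    (B := fun n => qPoch (a ^ 2 * b ^ 2) (q ^ 2) n * qPoch (-(a * b ^ 2)) q (2 * n) *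
          qPoch (q ^ 2 / b ^ 2) (q ^ 2) n
        / (qPoch (q ^ 2) (q ^ 2) n * qPoch (-(a * q)) q (2 * n) *
          qPoch (a ^ 2 * b ^ 4) (q ^ 2) n) * (b ^ 2 / q) ^ n)
    (fun n => q * (1 - q ^ 2 * (q ^ 2) ^ n) * (1 - a ^ 2 * b ^ 4 * (q ^ 2) ^ n) *
      (1 - -(a * q) * q ^ (2 * n)) * (1 - -(a * q) * q ^ (2 * n + 1)))
    (fun n => b ^ 2 * (1 - a ^ 2 * b ^ 2 * (q ^ 2) ^ n) *
      (1 - q ^ 2 / b ^ 2 * (q ^ 2) ^ n) *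
      (1 - -(a * b ^ 2) * q ^ (2 * n)) * (1 - -(a * b ^ 2) * q ^ (2 * n + 1))) ?_ ?_ ?_ ?_ n
  · intro n
    exact mul_ne_zero (mul_ne_zero (mul_ne_zero (mul_ne_zero hq0 (hq2 _)) (hbot _)) (hm _)) (hm _)
  · simp [wpKer_zero, qPoch_zero, ha]
  · intro n
    have h1 := hq2 n; have h2 := hbot n; have h3 := hm (2 * n); have h4 := hm (2 * n + 1)
    have e : 2 * (n + 1) = 2 * n + 1 + 1 := by ring
    have := qPoch_ne_of_forall hq2 n; have := qPoch_ne_of_forall hbot n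
    have := qPoch_ne_of_forall hm (2 * n)
    simp only [e, qPoch_succ, pow_succ (b ^ 2 / q)]
    generalize 1 - q ^ 2 * (q ^ 2) ^ n = t1 at *
    generalize 1 - a ^ 2 * b ^ 4 * (q ^ 2) ^ n = t2 at *
    generalize 1 - -(a * q) * q ^ (2 * n) = t3 at *
    generalize 1 - -(a * q) * q ^ (2 * n + 1) = t4 at *
    generalize 1 - -(a * b ^ 2) * q ^ (2 * n) = t5 at *
    generalize 1 - -(a * b ^ 2) * q ^ (2 * n + 1) = t6 at *
    generalize 1 - q ^ 2 / b ^ 2 * (q ^ 2) ^ n = t7 at *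
    generalize 1 - a ^ 2 * b ^ 2 * (q ^ 2) ^ n = t8 at *
    generalize (b ^ 2 / q) ^ n = t9 at *
    generalize qPoch (a ^ 2 * b ^ 2) (q ^ 2) n = s1 at *
    generalize qPoch (-(a * b ^ 2)) q (2 * n) = s2 at *
    generalize qPoch (q ^ 2 / b ^ 2) (q ^ 2) n = s3 at *
    generalize qPoch (q ^ 2) (q ^ 2) n = s4 at *
    generalize qPoch (-(a * q)) q (2 * n) = s5 at *
    generalize qPoch (a ^ 2 * b ^ 4) (q ^ 2) n = s6 at *
    field_simp
  · intro n
    -- The factor `q - a b² q^j` is `q (1 - a b² q^{j-1})`: after the shift it cancels the last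
    -- factor of `(a b²; q)_{j+1}`, as `1 - q ^ j` does for `(q; q)_{j+1}`.
    refine wpKer_sum_rec (g := fun j => qPoch a q j * qPoch (q / b ^ 2) q j /
        (qPoch q q j * qPoch (a * b ^ 2) q j) * (b ^ 2 / q) ^ j *
      (1 - q ^ j) * (q - a * b ^ 2 * q ^ j) * bressoudICert a b q (q ^ n) (q ^ j) / (q * q ^ j * (1 - a))) n
      (pow_ne_zero 2 hq0) (qPoch_ne_of_forall hq2) (qPoch_ne_of_forall haq) hbq (by simp) ?_
    intro j
    have hy : q ^ j ≠ 0 := pow_ne_zero _ hq0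
    have h1 := hq j; have h2 := hlo j
    have := qPoch_ne_of_forall hq j; have := qPoch_ne_of_forall hlo j
    have e1 : (q ^ 2) ^ j = (q ^ j) ^ 2 := pow_right_comm q 2 j
    have e2 : (q ^ 2) ^ n = (q ^ n) ^ 2 := pow_right_comm q 2 n
    have e3 : q ^ (2 * j) = (q ^ j) ^ 2 := pow_mul' q 2 j
    have e5 : q ^ (2 * n) = (q ^ n) ^ 2 := pow_mul' q 2 n
    have e6 : q ^ (2 * n + 1) = (q ^ n) ^ 2 * q := by rw [pow_succ, e5]
    simp only [qPoch_succ, e1, e2, e3, e5, e6, pow_succ (b ^ 2 / q), pow_succ q j]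
    generalize q ^ n = x at *
    generalize qPoch a q j = p1 at *
    generalize qPoch (q / b ^ 2) q j = p2 at *
    generalize qPoch q q j = p3 at *
    generalize qPoch (a * b ^ 2) q j = p4 at *
    generalize (b ^ 2 / q) ^ j = p5 at *
    generalize q ^ j = y at *
    obtain ⟨c1, hc1⟩ : ∃ c, c = bressoudICert a b q x y := ⟨_, rfl⟩
    obtain ⟨c2, hc2⟩ : ∃ c, c = bressoudICert a b q x (y * q) := ⟨_, rfl⟩
    rw [← hc1, ← hc2]
    have h1' : 1 - y * q ≠ 0 := by rwa [mul_comm]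
    field_simp
    rw [hc1, hc2, bressoudICert, bressoudICert]
    ring

set_option maxHeartbeats 1000000 in
/-- Polynomial part of a telescoping certificate. -/
def bressoudIICert (a b q x y : ℂ) : ℂ :=
  -q ^ 2 * x ^ 2 + b ^ 2 * q ^ 3 * x ^ 2 - a * b ^ 2 * q ^ 2 * x ^ 2 + a * b ^ 4 * q ^ 3 * x ^
  2 + a ^ 2 * b ^ 2 * q ^ 4 * x ^ 6 - a ^ 2 * b ^ 4 * q ^ 5 * x ^ 6 + a ^ 3 * b ^ 4 * q ^ 4 *
  x ^ 6 - a ^ 3 * b ^ 6 * q ^ 5 * x ^ 6 - q * y + b ^ 2 * q * y - a * q * x ^ 2 * y + a * b ^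
  2 * q * x ^ 2 * y - a * b ^ 2 * q ^ 3 * x ^ 2 * y + a * b ^ 4 * q ^ 3 * x ^ 2 * y + a ^ 3 *
  b ^ 2 * q ^ 3 * x ^ 6 * y - a ^ 3 * b ^ 4 * q ^ 3 * x ^ 6 * y + a ^ 3 * b ^ 4 * q ^ 5 * x ^
  6 * y - a ^ 3 * b ^ 6 * q ^ 5 * x ^ 6 * y + a ^ 4 * b ^ 4 * q ^ 5 * x ^ 8 * y - a ^ 4 * b ^
  6 * q ^ 5 * x ^ 8 * y + y ^ 2 - q * y ^ 2 - a * q * x ^ 2 * y ^ 2 - a * q ^ 2 * x ^ 2 * y ^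
  2 + a * b ^ 2 * y ^ 2 - a * b ^ 2 * q * y ^ 2 + a * b ^ 2 * q * x ^ 2 * y ^ 2 + a * b ^ 2 *
  q ^ 2 * x ^ 2 * y ^ 2 - a ^ 2 * b ^ 2 * q * x ^ 2 * y ^ 2 - a ^ 2 * b ^ 2 * q ^ 2 * x ^ 2 *
  y ^ 2 + a ^ 2 * b ^ 4 * q * x ^ 2 * y ^ 2 + a ^ 2 * b ^ 4 * q ^ 2 * x ^ 2 * y ^ 2 + a ^ 3 *
  b ^ 2 * q ^ 3 * x ^ 6 * y ^ 2 + a ^ 3 * b ^ 2 * q ^ 4 * x ^ 6 * y ^ 2 - a ^ 3 * b ^ 4 * q ^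
  3 * x ^ 6 * y ^ 2 - a ^ 3 * b ^ 4 * q ^ 4 * x ^ 6 * y ^ 2 + a ^ 4 * b ^ 4 * q ^ 3 * x ^ 6 *
  y ^ 2 + a ^ 4 * b ^ 4 * q ^ 4 * x ^ 6 * y ^ 2 - a ^ 4 * b ^ 4 * q ^ 4 * x ^ 8 * y ^ 2 + a ^
  4 * b ^ 4 * q ^ 5 * x ^ 8 * y ^ 2 - a ^ 4 * b ^ 6 * q ^ 3 * x ^ 6 * y ^ 2 - a ^ 4 * b ^ 6 *
  q ^ 4 * x ^ 6 * y ^ 2 - a ^ 5 * b ^ 6 * q ^ 4 * x ^ 8 * y ^ 2 + a ^ 5 * b ^ 6 * q ^ 5 * x ^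
  8 * y ^ 2 - a * y ^ 3 + a * b ^ 2 * y ^ 3 - a ^ 2 * x ^ 2 * y ^ 3 + a ^ 2 * b ^ 2 * x ^ 2 *
  y ^ 3 - a ^ 2 * b ^ 2 * q ^ 2 * x ^ 2 * y ^ 3 + a ^ 2 * b ^ 4 * q ^ 2 * x ^ 2 * y ^ 3 + a ^
  4 * b ^ 2 * q ^ 2 * x ^ 6 * y ^ 3 - a ^ 4 * b ^ 4 * q ^ 2 * x ^ 6 * y ^ 3 + a ^ 4 * b ^ 4 *
  q ^ 4 * x ^ 6 * y ^ 3 - a ^ 4 * b ^ 6 * q ^ 4 * x ^ 6 * y ^ 3 + a ^ 5 * b ^ 4 * q ^ 4 * x ^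
  8 * y ^ 3 - a ^ 5 * b ^ 6 * q ^ 4 * x ^ 8 * y ^ 3 - a ^ 2 * x ^ 2 * y ^ 4 + a ^ 2 * b ^ 2 *
  q * x ^ 2 * y ^ 4 - a ^ 3 * b ^ 2 * x ^ 2 * y ^ 4 + a ^ 3 * b ^ 4 * q * x ^ 2 * y ^ 4 + a ^
  4 * b ^ 2 * q ^ 2 * x ^ 6 * y ^ 4 - a ^ 4 * b ^ 4 * q ^ 3 * x ^ 6 * y ^ 4 + a ^ 5 * b ^ 4 *
  q ^ 2 * x ^ 6 * y ^ 4 - a ^ 5 * b ^ 6 * q ^ 3 * x ^ 6 * y ^ 4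

set_option maxHeartbeats 2000000 in
-- The telescoping equation of `bressoudII_pair` at `x = q ^ n`, `y = q ^ j`, with the summand
-- divided out and all denominators cleared. Isolating it leaves a single pure polynomial identity
-- for the largest certificate.
theorem bressoudII_poly (a b q x y : ℂ) :
    ((1 - b ^ 2) * q * (1 - q ^ 2 * x ^ 2) * (1 - a ^ 2 * b ^ 4 * q ^ 2 * x ^ 2) *
        (1 + a * x ^ 2) * (1 + a * q * x ^ 2) * (y ^ 2 - b ^ 2 * x ^ 2) *
        (1 - a ^ 2 * b ^ 2 * x ^ 2 * y ^ 2) -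
      (1 - b ^ 2) * (b ^ 2 - x ^ 2) * (1 - a ^ 2 * b ^ 2 * x ^ 2) *
        (1 + a * b ^ 2 * q * x ^ 2) * (1 + a * b ^ 2 * q ^ 2 * x ^ 2) *
        (y ^ 2 - q ^ 2 * x ^ 2) * (1 - a ^ 2 * q ^ 2 * x ^ 2 * y ^ 2)) *
      (1 - a ^ 2 * y ^ 4) * (y * q ^ 2) =
    (1 - a ^ 2 * b ^ 2 * x ^ 2 * y ^ 2) * (y ^ 2 - q ^ 2 * x ^ 2) *
      ((1 - a * y) * (b ^ 2 - y)) * bressoudIICert a b q x (y * q) -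
    q ^ 2 * ((y ^ 2 - b ^ 2 * x ^ 2) * (1 - a ^ 2 * q ^ 2 * x ^ 2 * y ^ 2)) *
      ((1 - y) * (1 - a * b ^ 2 * y)) * bressoudIICert a b q x y := by
  rw [bressoudIICert, bressoudIICert]
  ring

/-- Returns from the polynomial identity to the rational one. `w / w0` is the very-well-poised
factor and `P` the rest of the summand. `M` and `D1` are the numerator of the ratio of consecutive
`P` and the denominator factors placed in the certificate; `c1, c2` are the certificate values at
`y` and `y * q`. -/
theorem telescoping_assemble {U w w0 P X M c2 Z D1 c1 y q : ℂ} (hy : y ≠ 0) (hq : q ≠ 0)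
    (h0 : w0 ≠ 0) (hI : U * w * (y * q ^ 2) = X * M * c2 - q ^ 2 * Z * D1 * c1) :
    U * (w / w0 * P) = X * (P * M / q * c2 / (y * q * w0)) - Z * (P * D1 * c1 / (y * w0)) := by
  field_simp
  linear_combination P * hI

theorem bressoudII_pair {a b q : ℂ} (hq0 : q ≠ 0) (hb0 : b ≠ 0) (hb1 : 1 - b ^ 2 ≠ 0)
    (hq : ∀ m : ℕ, 1 - q * q ^ m ≠ 0) (hq2 : ∀ m : ℕ, 1 - q ^ 2 * (q ^ 2) ^ m ≠ 0)
    (haq : ∀ m : ℕ, 1 - a ^ 2 * q ^ 2 * (q ^ 2) ^ m ≠ 0) (ha : 1 - a ^ 2 ≠ 0)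
    (hbq : q ^ 2 - b ^ 2 ≠ 0) (hlo : ∀ m : ℕ, 1 - a * b ^ 2 * q * q ^ m ≠ 0)
    (hm : ∀ m : ℕ, 1 - -(a) * q ^ m ≠ 0)
    (hbot : ∀ m : ℕ, 1 - a ^ 2 * b ^ 4 * q ^ 2 * (q ^ 2) ^ m ≠ 0) (n : ℕ) :
    ∑ j ∈ range (n + 1), wpKer (a ^ 2) (b ^ 2) (q ^ 2) n j *
        ((1 - a ^ 2 * q ^ (4 * j)) / (1 - a ^ 2) * (qPoch a q j * qPoch (1 / b ^ 2) q j /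
          (qPoch q q j * qPoch (a * b ^ 2 * q) q j)) * (b ^ 2 / q) ^ j)
      = qPoch (a ^ 2 * b ^ 2) (q ^ 2) n * qPoch (-(a * b ^ 2 * q)) q (2 * n) *
          qPoch (1 / b ^ 2) (q ^ 2) n
        / (qPoch (q ^ 2) (q ^ 2) n * qPoch (-(a)) q (2 * n) *
          qPoch (a ^ 2 * b ^ 4 * q ^ 2) (q ^ 2) n) * (b ^ 2 / q) ^ n := by
  refine wpKer_sum_of_ratio
    (A := fun j => (1 - a ^ 2 * q ^ (4 * j)) / (1 - a ^ 2) * (qPoch a q j * qPoch (1 / b ^ 2) q j /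
          (qPoch q q j * qPoch (a * b ^ 2 * q) q j)) * (b ^ 2 / q) ^ j)
    (B := fun n => qPoch (a ^ 2 * b ^ 2) (q ^ 2) n * qPoch (-(a * b ^ 2 * q)) q (2 * n) *
          qPoch (1 / b ^ 2) (q ^ 2) n
        / (qPoch (q ^ 2) (q ^ 2) n * qPoch (-(a)) q (2 * n) *
          qPoch (a ^ 2 * b ^ 4 * q ^ 2) (q ^ 2) n) * (b ^ 2 / q) ^ n)
    (fun n => (1 - b ^ 2) * q * (1 - q ^ 2 * (q ^ 2) ^ n) * (1 - a ^ 2 * b ^ 4 * q ^ 2 * (q ^ 2) ^ n) *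
      (1 - -(a) * q ^ (2 * n)) * (1 - -(a) * q ^ (2 * n + 1)))
    (fun n => (1 - b ^ 2) * b ^ 2 * (1 - a ^ 2 * b ^ 2 * (q ^ 2) ^ n) *
      (1 - 1 / b ^ 2 * (q ^ 2) ^ n) *
      (1 - -(a * b ^ 2 * q) * q ^ (2 * n)) * (1 - -(a * b ^ 2 * q) * q ^ (2 * n + 1))) ?_ ?_ ?_ ?_ n
  · intro n
    exact mul_ne_zero (mul_ne_zero (mul_ne_zero (mul_ne_zero (mul_ne_zero hb1 hq0) (hq2 _)) (hbot _)) (hm _)) (hm _)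
  · simp [wpKer_zero, qPoch_zero, ha]
  · intro n
    have h1 := hq2 n; have h2 := hbot n; have h3 := hm (2 * n); have h4 := hm (2 * n + 1)
    have e : 2 * (n + 1) = 2 * n + 1 + 1 := by ring
    have := qPoch_ne_of_forall hq2 n; have := qPoch_ne_of_forall hbot n
    have := qPoch_ne_of_forall hm (2 * n)
    simp only [e, qPoch_succ, pow_succ (b ^ 2 / q)]
    generalize 1 - q ^ 2 * (q ^ 2) ^ n = t1 at *
    generalize 1 - a ^ 2 * b ^ 4 * q ^ 2 * (q ^ 2) ^ n = t2 at *
    generalize 1 - -(a) * q ^ (2 * n) = t3 at *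
    generalize 1 - -(a) * q ^ (2 * n + 1) = t4 at *
    generalize 1 - -(a * b ^ 2 * q) * q ^ (2 * n) = t5 at *
    generalize 1 - -(a * b ^ 2 * q) * q ^ (2 * n + 1) = t6 at *
    generalize 1 - 1 / b ^ 2 * (q ^ 2) ^ n = t7 at *
    generalize 1 - a ^ 2 * b ^ 2 * (q ^ 2) ^ n = t8 at *
    generalize 1 - b ^ 2 = t12 at *
    generalize (b ^ 2 / q) ^ n = t9 at *
    generalize qPoch (a ^ 2 * b ^ 2) (q ^ 2) n = s1 at *
    generalize qPoch (-(a * b ^ 2 * q)) q (2 * n) = s2 at *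
    generalize qPoch (1 / b ^ 2) (q ^ 2) n = s3 at *
    generalize qPoch (q ^ 2) (q ^ 2) n = s4 at *
    generalize qPoch (-(a)) q (2 * n) = s5 at *
    generalize qPoch (a ^ 2 * b ^ 4 * q ^ 2) (q ^ 2) n = s6 at *
    field_simp
  · intro n
    set p : ℕ → ℂ := fun j => qPoch a q j * qPoch (1 / b ^ 2) q j /
        (qPoch q q j * qPoch (a * b ^ 2 * q) q j) * (b ^ 2 / q) ^ j with hp
    have hps : ∀ j, p (j + 1) * ((1 - q * q ^ j) * (1 - a * b ^ 2 * q * q ^ j)) =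
        p j * ((1 - a * q ^ j) * (b ^ 2 - q ^ j)) / q := by
      intro j
      have h1 := hq j; have h2 := hlo j
      have := qPoch_ne_of_forall hq j; have := qPoch_ne_of_forall hlo j
      simp only [hp, qPoch_succ, pow_succ (b ^ 2 / q)]
      generalize qPoch a q j = p1 at *
      generalize qPoch (1 / b ^ 2) q j = p2 at *
      generalize qPoch q q j = p3 at *
      generalize qPoch (a * b ^ 2 * q) q j = p4 at *
      generalize (b ^ 2 / q) ^ j = p5 at *
      generalize 1 - q * q ^ j = p6 at *
      generalize 1 - a * b ^ 2 * q * q ^ j = p7 at *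
      field_simp
    refine wpKer_sum_rec (g := fun j => p j *
      ((1 - q ^ j) * (1 - a * b ^ 2 * q ^ j)) * bressoudIICert a b q (q ^ n) (q ^ j) /
        (q ^ j * (1 - a ^ 2))) n
      (pow_ne_zero 2 hq0) (qPoch_ne_of_forall hq2) (qPoch_ne_of_forall haq) hbq (by simp) ?_
    intro j
    have hy : q ^ j ≠ 0 := pow_ne_zero _ hq0
    have e1 : (q ^ 2) ^ j = (q ^ j) ^ 2 := pow_right_comm q 2 j
    have e2 : (q ^ 2) ^ n = (q ^ n) ^ 2 := pow_right_comm q 2 n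
    have e4 : q ^ (4 * j) = (q ^ j) ^ 4 := pow_mul' q 4 j
    have e5 : q ^ (2 * n) = (q ^ n) ^ 2 := pow_mul' q 2 n
    have e6 : q ^ (2 * n + 1) = (q ^ n) ^ 2 * q := by rw [pow_succ, e5]
    have hg : p (j + 1) * ((1 - q ^ (j + 1)) * (1 - a * b ^ 2 * q ^ (j + 1))) =
        p j * ((1 - a * q ^ j) * (b ^ 2 - q ^ j)) / q := by
      rw [← hps, pow_succ']
      ring
    rw [hg, mul_assoc (_ / _) (_ / _) _]
    change _ * (_ * p j) = _
    have hv : b ^ 2 * (1 - a ^ 2 * b ^ 2 * (q ^ n) ^ 2) * (1 - 1 / b ^ 2 * (q ^ n) ^ 2) =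
        (b ^ 2 - (q ^ n) ^ 2) * (1 - a ^ 2 * b ^ 2 * (q ^ n) ^ 2) := by
      field_simp
    have hI := bressoudII_poly a b q (q ^ n) (q ^ j)
    rw [e1, e2, e4, e5, e6, pow_succ q j]
    refine telescoping_assemble hy hq0 ha (Eq.trans ?_ hI)
    linear_combination (-(1 - b ^ 2) * (1 + a * b ^ 2 * q * (q ^ n) ^ 2) *
      (1 + a * b ^ 2 * q ^ 2 * (q ^ n) ^ 2) * ((q ^ j) ^ 2 - q ^ 2 * (q ^ n) ^ 2) *
      (1 - a ^ 2 * q ^ 2 * (q ^ n) ^ 2 * (q ^ j) ^ 2) * (1 - a ^ 2 * (q ^ j) ^ 4) *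
      (q ^ j * q ^ 2)) * hv

/-! ### The chain step and the inversion of the kernel -/

/-- The analogue of `wpKer_sum_rec` for a weight that depends on `n` only through `n - j`; this is
the weight with which `β` enters the chain. -/
theorem conv_sum_rec {Y q u v : ℂ} {C g : ℕ → ℂ} (n : ℕ) (hq0 : q ≠ 0)
    (hq : ∀ m, qPoch q q m ≠ 0) (hYq : q - Y ≠ 0) (g0 : g 0 = 0)
    (h : ∀ j, (u * (q ^ j - Y * q ^ n) - v * (q ^ j - q * q ^ n)) * C j
      = (q ^ j - q * q ^ n) * g (j + 1) - (q ^ j - Y * q ^ n) * g j) :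
    u * ∑ j ∈ range (n + 2), qPoch Y q (n + 1 - j) / qPoch q q (n + 1 - j) * C j
      = v * ∑ j ∈ range (n + 1), qPoch Y q (n - j) / qPoch q q (n - j) * C j := by
  set G : ℕ → ℂ := fun j => qPoch Y q (n + 1 - j) / qPoch q q (n + 1 - j) * g j with hG
  have step : ∀ j ∈ range (n + 1),
      u * (qPoch Y q (n + 1 - j) / qPoch q q (n + 1 - j) * C j) -
        v * (qPoch Y q (n - j) / qPoch q q (n - j) * C j) = G (j + 1) - G j := by
    intro j hj
    obtain ⟨l, rfl⟩ : ∃ l, n = j + l := ⟨n - j, by have := Finset.mem_range.1 hj; omega⟩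
    have e1 : j + l + 1 - j = l + 1 := by omega
    have e2 : j + l - j = l := by omega
    have e3 : j + l + 1 - (j + 1) = l := by omega
    simp only [hG, e1, e2, e3, qPoch_succ]
    have h1 := hq (l + 1)
    rw [qPoch_succ] at h1
    have h3 := left_ne_zero_of_mul h1
    have h5 := right_ne_zero_of_mul h1
    have hy : q ^ j ≠ 0 := pow_ne_zero _ hq0
    have hh : u * (1 - Y * q ^ l) * C j - v * (1 - q * q ^ l) * C j
        = (1 - q * q ^ l) * g (j + 1) - (1 - Y * q ^ l) * g j := by
      apply mul_left_cancel₀ hy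
      have := h j
      simp only [pow_add] at this ⊢
      linear_combination this
    generalize 1 - q * q ^ l = s at *
    field_simp
    linear_combination qPoch Y q l * hh
  have last : u * (qPoch Y q (n + 1 - (n + 1)) / qPoch q q (n + 1 - (n + 1)) * C (n + 1)) =
      - G (n + 1) := by
    have hh := h (n + 1)
    have hy : q ^ n ≠ 0 := pow_ne_zero _ hq0
    simp only [hG, Nat.sub_self, qPoch_zero, div_one, one_mul]
    apply mul_left_cancel₀ (mul_ne_zero hy hYq)
    rw [pow_succ] at hh
    linear_combination hh
  have tel := Finset.sum_range_sub G (n + 1)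
  have hG0 : G 0 = 0 := by simp [hG, g0]
  rw [hG0, sub_zero, ← Finset.sum_congr rfl step, Finset.sum_sub_distrib, ← Finset.mul_sum,
    ← Finset.mul_sum] at tel
  rw [Finset.sum_range_succ, mul_add, last]
  linear_combination tel

/-- Polynomial part of a telescoping certificate. -/
def chainCert (a b q x y : ℂ) : ℂ :=
  -(b * q ^ 2 * x) + b ^ 2 * q ^ 2 * x + a * q * x ^ 3 - a * b * x ^ 2 * y +
    a * b * q ^ 2 * x ^ 2 * y - a * b * q ^ 3 * x ^ 3 + a * b ^ 2 * x * y ^ 2 -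
    a * b ^ 2 * q * x ^ 2 * y + a * b ^ 2 * q ^ 3 * x ^ 2 * y - a * b ^ 3 * q ^ 2 * x * y ^ 2 -
    a ^ 2 * b * q * x ^ 3 * y ^ 2 + a ^ 2 * b ^ 2 * q * x ^ 3 * y ^ 2

/-- Up to the prefactor, this is the coefficient of `α 0` in the transformed `β`. The coefficient of
`α i` is the same sum with `a` replaced by `a * q ^ (2 * i)`, so this one evaluation proves the
chain. -/
theorem chain_kernel_sum {a b q : ℂ} (hq0 : q ≠ 0) (hb0 : b ≠ 0) (hb1 : 1 - b ≠ 0)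
    (hq : ∀ m : ℕ, 1 - q * q ^ m ≠ 0) (haq : ∀ m : ℕ, 1 - a * q * q ^ m ≠ 0)
    (hab : 1 - a * b ≠ 0) (hYq : q - 1 / (b ^ 2 * q) ≠ 0)
    (hk : ∀ m : ℕ, 1 - a / (b * q) * q ^ m ≠ 0) (n : ℕ) :
    ∑ j ∈ range (n + 1), qPoch (1 / (b ^ 2 * q)) q (n - j) / qPoch q q (n - j) *
        ((1 - a * b * q ^ (2 * j)) / (1 - a * b) * (qPoch (a * b) q j * qPoch b q j /
          (qPoch q q j * qPoch (a * q) q j)) * (1 / (b ^ 2 * q)) ^ j)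
      = (1 - a / (b * q) * q ^ (2 * n)) / (1 - a / (b * q)) *
        (qPoch (a / (b * q)) q n * qPoch (1 / (b * q)) q n /
          (qPoch q q n * qPoch (a * q) q n)) := by
  have hk0 : 1 - a / (b * q) ≠ 0 := by simpa using hk 0
  induction n with
  | zero => simp [qPoch_zero, hab, hk0]
  | succ n ih =>
    -- The closed form contains `1 - a / (b * q) * q ^ (2 * n)`, whose value at `n + 1` does not
    -- cancel against that at `n`; hence both occur in the recurrence. As in `sqrt_pair`, `1 - b`
    -- only clears a denominator of the certificate.
    have hu : (1 - b) * (1 - a / (b * q) * q ^ (2 * n)) * (1 - q * q ^ n) * (1 - a * q * q ^ n) ≠ 0 :=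
      mul_ne_zero (mul_ne_zero (mul_ne_zero hb1 (hk _)) (hq _)) (haq _)
    apply mul_left_cancel₀ hu
    have key := conv_sum_rec
      (u := (1 - b) * (1 - a / (b * q) * q ^ (2 * n)) * (1 - q * q ^ n) * (1 - a * q * q ^ n))
      (v := (1 - b) * (1 - a / (b * q) * q ^ (2 * n + 2)) * (1 - a / (b * q) * q ^ n) *
        (1 - 1 / (b * q) * q ^ n))
      (C := fun j => (1 - a * b * q ^ (2 * j)) / (1 - a * b) * (qPoch (a * b) q j * qPoch b q j /
          (qPoch q q j * qPoch (a * q) q j)) * (1 / (b ^ 2 * q)) ^ j)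
      (g := fun j => (qPoch (a * b) q j * qPoch b q j /
          (qPoch q q j * qPoch (a * q) q j)) * (1 / (b ^ 2 * q)) ^ j *
          ((1 - q ^ j) * (1 - a * q ^ j) * chainCert a b q (q ^ n) (q ^ j) /
            (b * q * q ^ j * (1 - a * b)))) n hq0 (qPoch_ne_of_forall hq) hYq (by simp) ?_
    · rw [key, ih]
      have h1 := hq n; have h2 := haq n; have h3 := hk (2 * n)
      have := qPoch_ne_of_forall hq n; have := qPoch_ne_of_forall haq n
      simp only [qPoch_succ, mul_add, mul_one]
      generalize 1 - q * q ^ n = t1 at *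
      generalize 1 - a * q * q ^ n = t2 at *
      generalize 1 - a / (b * q) * q ^ (2 * n) = t3 at *
      generalize 1 - a / (b * q) * q ^ (2 * n + 2) = t4 at *
      generalize 1 - a / (b * q) * q ^ n = t5 at *
      generalize 1 - 1 / (b * q) * q ^ n = t6 at *
      generalize 1 - a / (b * q) = t7 at *
      generalize qPoch (a / (b * q)) q n = s1 at *
      generalize qPoch (1 / (b * q)) q n = s2 at *
      field_simp
    · intro j
      have hy : q ^ j ≠ 0 := pow_ne_zero _ hq0
      have h1 := hq j; have h2 := haq j
      have := qPoch_ne_of_forall hq j; have := qPoch_ne_of_forall haq j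
      have e3 : q ^ (2 * j) = (q ^ j) ^ 2 := pow_mul' q 2 j
      have e5 : q ^ (2 * n) = (q ^ n) ^ 2 := pow_mul' q 2 n
      have e6 : q ^ (2 * n + 2) = (q ^ n) ^ 2 * q ^ 2 := by rw [pow_add, e5]
      simp only [qPoch_succ, e3, e5, e6, pow_succ q j, pow_succ (1 / (b ^ 2 * q)) j]
      generalize q ^ n = x at *
      generalize qPoch (a * b) q j = p1 at *
      generalize qPoch b q j = p2 at *
      generalize qPoch q q j = p3 at *
      generalize qPoch (a * q) q j = p4 at *
      generalize (1 / (b ^ 2 * q)) ^ j = p5 at *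
      generalize q ^ j = y at *
      obtain ⟨c1, hc1⟩ : ∃ c, c = chainCert a b q x y := ⟨_, rfl⟩
      obtain ⟨c2, hc2⟩ : ∃ c, c = chainCert a b q x (y * q) := ⟨_, rfl⟩
      rw [← hc1, ← hc2]
      have h1' : 1 - y * q ≠ 0 := by rwa [mul_comm]
      have h2' : 1 - a * (y * q) ≠ 0 := by rwa [mul_comm y q, ← mul_assoc]
      have h2'' : 1 - a * q * y ≠ 0 := h2
      generalize hw : 1 - a * b = w at *
      field_simp
      rw [hc1, hc2, chainCert, chainCert]
      ring

/-- Up to a constant this is a terminating very-well-poised `_6φ_5` at level `N = n + 1`, and its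
product formula contains `(q^{1-N}; q)_N`, which vanishes since `N ≥ 1`. -/
theorem wp_orthogonality_zero {a b q : ℂ} (hq0 : q ≠ 0) (hb0 : b ≠ 0) (hb1 : 1 - b ≠ 0)
    (hq : ∀ m : ℕ, 1 - q * q ^ m ≠ 0) (haq : ∀ m : ℕ, 1 - a * q * q ^ m ≠ 0)
    (hk : ∀ m : ℕ, 1 - a * b * q ^ m ≠ 0) (hbq : q - b ≠ 0) (n : ℕ) :
    ∑ j ∈ range (n + 1 + 1), wpKer a b q (n + 1) j * ((1 - a * q ^ (2 * j)) *
      (qPoch (1 / b) q j * qPoch a q j / (qPoch q q j * qPoch (a * b * q) q j)) * b ^ j) = 0 := by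
  have hkq : ∀ m : ℕ, 1 - a * b * q * q ^ m ≠ 0 := fun m => by
    have := hk (m + 1)
    rwa [pow_succ', ← mul_assoc] at this
  have hv : (b - 1) * (1 - q ^ (n + 1)) * (1 - a * b * q ^ (n + 1)) ≠ 0 := by
    refine mul_ne_zero (mul_ne_zero ?_ ?_) (hk _)
    · intro h; exact hb1 (by linear_combination -h)
    · rw [pow_succ']; exact hq n
  set p : ℕ → ℂ := fun j =>
    (qPoch (1 / b) q j * qPoch a q j / (qPoch q q j * qPoch (a * b * q) q j)) * b ^ j with hp
  have hps : ∀ j, p (j + 1) * ((1 - q * q ^ j) * (1 - a * b * q * q ^ j)) =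
      p j * ((b - q ^ j) * (1 - a * q ^ j)) := by
    intro j
    have h1 := hq j; have h2 := hkq j
    have := qPoch_ne_of_forall hq j; have := qPoch_ne_of_forall hkq j
    simp only [hp, qPoch_succ, pow_succ b]
    generalize qPoch (1 / b) q j = p1 at *
    generalize qPoch a q j = p2 at *
    generalize qPoch q q j = p3 at *
    generalize qPoch (a * b * q) q j = p4 at *
    generalize b ^ j = p5 at *
    generalize 1 - q * q ^ j = p6 at *
    generalize 1 - a * b * q * q ^ j = p7 at *
    field_simp
  -- With `u = 0` the recurrence degenerates: the summand at the fixed level `n + 1` is itself a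
  -- difference in `j`, so `v` times the sum is zero, and `hv` removes `v`.
  have key := wpKer_sum_rec (a := a) (b := b) (u := 0)
    (v := (b - 1) * (1 - q ^ (n + 1)) * (1 - a * b * q ^ (n + 1)))
    (A := fun j => (1 - a * q ^ (2 * j)) * p j)
    (g := fun j => -(p j * ((1 - q ^ j) * (1 - a * b * q ^ j)) *
      ((q ^ j - q * q ^ (n + 1)) * (1 - a * q ^ (n + 1) * q ^ j)) / q ^ j)) (n + 1) hq0
      (qPoch_ne_of_forall hq) (qPoch_ne_of_forall haq) hbq (by simp) ?_
  · rw [zero_mul] at key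
    simp only [mul_assoc _ _ (b ^ _)]
    exact (mul_eq_zero.1 key.symm).resolve_left hv
  · intro j
    have hy : q ^ j ≠ 0 := pow_ne_zero _ hq0
    have e3 : q ^ (2 * j) = (q ^ j) ^ 2 := pow_mul' q 2 j
    have hps' : p (j + 1) * ((1 - q ^ (j + 1)) * (1 - a * b * q ^ (j + 1))) =
      p j * ((b - q ^ j) * (1 - a * q ^ j)) := by
      rw [← hps, pow_succ']
      ring
    simp only [hps', e3]
    rw [pow_succ' q j]
    generalize q ^ (n + 1) = x at *
    generalize p j = P at *
    generalize q ^ j = y at *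
    field_simp
    ring

theorem sum_triangle (f : ℕ → ℕ → ℂ) (n : ℕ) :
    ∑ j ∈ range (n + 1), ∑ i ∈ range (j + 1), f j i
      = ∑ i ∈ range (n + 1), ∑ m ∈ range (n - i + 1), f (i + m) i := by
  rw [Finset.sum_comm' (t' := range (n + 1)) (s' := fun i => Finset.Ico i (n + 1))]
  · refine Finset.sum_congr rfl fun i hi => ?_
    rw [Finset.sum_Ico_eq_sum_range]
    have := Finset.mem_range.1 hi
    rw [show n + 1 - i = n - i + 1 by omega]
  · intro x y
    simp only [Finset.mem_range, Finset.mem_Ico]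
    omega

/-- Splitting off the first `2 * i` factors of each symbol of length `2 * i + m` reduces the sum to
`chain_kernel_sum` with `a * q ^ (2 * i)` in place of `a`. The factors split off supply the
multiplier of `α i` in the new pair. -/
theorem chain_coefficient {a c q : ℂ} (hq0 : q ≠ 0) (hc0 : c ≠ 0) (hc1 : 1 - c ≠ 0)
    (hq : ∀ m : ℕ, 1 - q * q ^ m ≠ 0) (haq : ∀ m : ℕ, 1 - a * q * q ^ m ≠ 0)
    (hac : ∀ m : ℕ, 1 - a * c * q ^ m ≠ 0) (hYq : q - 1 / (c ^ 2 * q) ≠ 0)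
    (hk : ∀ m : ℕ, 1 - a * (1 / (c * q)) * q ^ m ≠ 0) (i N : ℕ) :
    ∑ m ∈ range (N + 1), (1 - a * c * q ^ (2 * (i + m))) / (1 - a * c) *
        (qPoch (1 / (c ^ 2 * q)) q (N - m) / qPoch q q (N - m)) * (1 / (c ^ 2 * q)) ^ (i + m) *
        wpKer a c q (i + m) i
      = (1 - a * (1 / (c * q)) * q ^ (2 * (i + N))) / (1 - a * (1 / (c * q))) *
        (wpKer a (1 / (c * q)) q (i + N) i * (qPoch (a * c * q) q (2 * i) /
          qPoch (a / c) q (2 * i) * (1 / (c ^ 2 * q)) ^ i)) := by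
  have hac0 : 1 - a * c ≠ 0 := by simpa using hac 0
  have hk0 : 1 - a * (1 / (c * q)) ≠ 0 := by simpa using hk 0
  have hki : 1 - a * (1 / (c * q)) * q ^ (2 * i) ≠ 0 := hk _
  have hT := chain_kernel_sum (a := a * q ^ (2 * i)) (b := c) hq0 hc0 hc1 hq
    (fun m => by
      rw [show a * q ^ (2 * i) * q * q ^ m = a * q * q ^ (2 * i + m) by ring]
      exact haq _)
    (by
      rw [show a * q ^ (2 * i) * c = a * c * q ^ (2 * i) by ring]
      exact hac _) hYq
    (fun m => by
      rw [show a * q ^ (2 * i) / (c * q) * q ^ m = a * (1 / (c * q)) * q ^ (2 * i + m) by ring]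
      exact hk _) N
  have haci : 1 - a * c * q ^ (2 * i) ≠ 0 := hac _
  have haq2 := qPoch_ne_of_forall haq (2 * i)
  have hL : ∀ m ∈ range (N + 1), (1 - a * c * q ^ (2 * (i + m))) / (1 - a * c) *
        (qPoch (1 / (c ^ 2 * q)) q (N - m) / qPoch q q (N - m)) * (1 / (c ^ 2 * q)) ^ (i + m) *
        wpKer a c q (i + m) i =
      ((1 / (c ^ 2 * q)) ^ i * qPoch (a * c) q (2 * i) * (1 - a * c * q ^ (2 * i)) /
        (qPoch (a * q) q (2 * i) * (1 - a * c))) *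
      (qPoch (1 / (c ^ 2 * q)) q (N - m) / qPoch q q (N - m) *
        ((1 - a * q ^ (2 * i) * c * q ^ (2 * m)) / (1 - a * q ^ (2 * i) * c) *
          (qPoch (a * q ^ (2 * i) * c) q m * qPoch c q m /
          (qPoch q q m * qPoch (a * q ^ (2 * i) * q) q m)) * (1 / (c ^ 2 * q)) ^ m)) := by
    intro m _
    have haqm := qPoch_ne_of_forall haq (2 * i + m)
    rw [wpKer, show i + m - i = m by omega, show i + m + i = 2 * i + m by ring]
    rw [qPoch_add] at haqm ⊢
    rw [qPoch_add]
    have e1 : a * q ^ (2 * i) * c = a * c * q ^ (2 * i) := by ring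
    have e2 : a * q ^ (2 * i) * q = a * q * q ^ (2 * i) := by ring
    have e3 : a * c * q ^ (2 * (i + m)) = a * c * q ^ (2 * i) * q ^ (2 * m) := by ring
    rw [e1, e2, e3, pow_add]
    generalize qPoch (a * c * q ^ (2 * i)) q m = s1 at *
    generalize qPoch (a * q * q ^ (2 * i)) q m = s2 at *
    generalize qPoch (a * c) q (2 * i) = s3 at *
    generalize qPoch (a * q) q (2 * i) = s4 at *
    generalize 1 - a * c * q ^ (2 * i) * q ^ (2 * m) = t1 at *
    generalize 1 - a * c * q ^ (2 * i) = t2 at *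
    generalize 1 - a * c = t3 at *
    generalize (1 / (c ^ 2 * q)) ^ i = s5 at *
    generalize (1 / (c ^ 2 * q)) ^ m = s6 at *
    generalize qPoch (1 / (c ^ 2 * q)) q (N - m) = s7 at *
    have := qPoch_ne_of_forall hq (N - m); have := qPoch_ne_of_forall hq m
    have h4 := right_ne_zero_of_mul haqm
    field_simp
  rw [Finset.sum_congr rfl hL, ← Finset.mul_sum, hT, wpKer, show i + N - i = N by omega,
    show i + N + i = 2 * i + N by ring, qPoch_add, qPoch_add]
  have haqm := qPoch_ne_of_forall haq (2 * i + N)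
  rw [qPoch_add] at haqm
  have h4 := right_ne_zero_of_mul haqm
  -- Here and in `e2` the linear factors left by the shifted sum move the base points from `a * c`
  -- to `a * c * q` and from `a / (c * q)` to `a / c`. This is the origin of the quotient `(a c q;
  -- q)_{2i} / (a / c; q)_{2i}`.
  have e1 : qPoch (a * c) q (2 * i) * (1 - a * c * q ^ (2 * i)) =
      (1 - a * c) * qPoch (a * c * q) q (2 * i) := by
    rw [← qPoch_succ, qPoch_succ']
  have e2 : qPoch (a * (1 / (c * q))) q (2 * i) * (1 - a * (1 / (c * q)) * q ^ (2 * i)) =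
      (1 - a * (1 / (c * q))) * qPoch (a / c) q (2 * i) := by
    rw [← qPoch_succ, qPoch_succ', show a * (1 / (c * q)) * q = a / c by field_simp]
  have e3 : a * q ^ (2 * i) / (c * q) = a * (1 / (c * q)) * q ^ (2 * i) := by ring
  have e4 : a * q ^ (2 * i) * q = a * q * q ^ (2 * i) := by ring
  have e5 : a * (1 / (c * q)) * q ^ (2 * i) * q ^ (2 * N) =
      a * (1 / (c * q)) * q ^ (2 * (i + N)) := by ring
  have hkp := qPoch_ne_of_forall hk (2 * i)
  have hacp : qPoch (a / c) q (2 * i) ≠ 0 := by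
    intro h
    rw [h, mul_zero] at e2
    exact mul_ne_zero hkp hki e2
  rw [mul_assoc _ (qPoch (a * c) q (2 * i)), e1, e3, e4, e5]
  have e2' : qPoch (a * (1 / (c * q))) q (2 * i) = (1 - a * (1 / (c * q))) *
      qPoch (a / c) q (2 * i) / (1 - a * (1 / (c * q)) * q ^ (2 * i)) :=
    (eq_div_iff hki).2 e2
  rw [e2']
  have := qPoch_ne_of_forall hq N
  generalize qPoch (a * (1 / (c * q)) * q ^ (2 * i)) q N = s1 at *
  generalize qPoch (a * q * q ^ (2 * i)) q N = s2 at *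
  generalize qPoch (a / c) q (2 * i) = s3 at *
  generalize qPoch (a * c * q) q (2 * i) = s4 at *
  generalize qPoch (a * q) q (2 * i) = s5 at *
  generalize qPoch (1 / (c * q)) q N = s6 at *
  generalize 1 - a * (1 / (c * q)) * q ^ (2 * i) = t1 at *
  generalize 1 - a * (1 / (c * q)) * q ^ (2 * (i + N)) = t2 at *
  generalize 1 - a * (1 / (c * q)) = t3 at *
  generalize 1 - a * c = t4 at *
  generalize (1 / (c ^ 2 * q)) ^ i = s7 at *
  field_simp

/-- The chain: a well-poised Bailey pair `(α, β)` relative to `(a, a c)` is turned into one relative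
to `(a, a / (c q))`. -/
theorem wp_chain {a c q : ℂ} (hq0 : q ≠ 0) (hc0 : c ≠ 0) (hc1 : 1 - c ≠ 0)
    (hq : ∀ m : ℕ, 1 - q * q ^ m ≠ 0) (haq : ∀ m : ℕ, 1 - a * q * q ^ m ≠ 0)
    (hac : ∀ m : ℕ, 1 - a * c * q ^ m ≠ 0) (hYq : q - 1 / (c ^ 2 * q) ≠ 0)
    (hk : ∀ m : ℕ, 1 - a * (1 / (c * q)) * q ^ m ≠ 0) (α β : ℕ → ℂ)
    (hβ : ∀ n, ∑ i ∈ range (n + 1), wpKer a c q n i * α i = β n) (n : ℕ) :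
    ∑ j ∈ range (n + 1), wpKer a (1 / (c * q)) q n j * (qPoch (a * c * q) q (2 * j) /
          qPoch (a / c) q (2 * j) * (1 / (c ^ 2 * q)) ^ j * α j)
      = (1 - a * (1 / (c * q))) / (1 - a * (1 / (c * q)) * q ^ (2 * n)) *
        ∑ j ∈ range (n + 1), (1 - a * c * q ^ (2 * j)) / (1 - a * c) *
          (qPoch (1 / (c ^ 2 * q)) q (n - j) / qPoch q q (n - j)) * (1 / (c ^ 2 * q)) ^ j * β j := by
  have hk0 : 1 - a * (1 / (c * q)) ≠ 0 := by simpa using hk 0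
  have hkn := hk (2 * n)
  -- After the interchange of summations the two sides are compared coefficient by coefficient in `α
  -- i`.
  simp only [← hβ, Finset.mul_sum (range (_ + 1)) (fun i => wpKer a c q _ i * α i)]
  rw [sum_triangle (fun j i => (1 - a * c * q ^ (2 * j)) / (1 - a * c) *
    (qPoch (1 / (c ^ 2 * q)) q (n - j) / qPoch q q (n - j)) * (1 / (c ^ 2 * q)) ^ j *
      (wpKer a c q j i * α i)), Finset.mul_sum]
  refine Finset.sum_congr rfl fun i hi => ?_
  obtain ⟨N, rfl⟩ : ∃ N, n = i + N := ⟨n - i, by have := Finset.mem_range.1 hi; omega⟩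
  have key := chain_coefficient hq0 hc0 hc1 hq haq hac hYq hk i N
  have e : ∀ m, i + N - (i + m) = N - m := fun m => by omega
  simp only [e, show i + N - i = N by omega, ← mul_assoc (_ * (1 / (c ^ 2 * q)) ^ _)]
  rw [← Finset.sum_mul, key]
  generalize 1 - a * (1 / (c * q)) * q ^ (2 * (i + N)) = t2 at *
  generalize 1 - a * (1 / (c * q)) = t3 at *
  generalize wpKer a (1 / (c * q)) q (i + N) i = t4 at *
  generalize qPoch (a * c * q) q (2 * i) / qPoch (a / c) q (2 * i) = t5 at *
  field_simp

/-- This is the `(i + N, i)` entry of the product of the two kernels with a diagonal matrix between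
them. Splitting off the first `2 * i` factors turns it into the sum of `wp_orthogonality_zero` with
`a * q ^ (2 * i)`, so only the diagonal `N = 0` survives. -/
theorem wp_orthogonality {a b q : ℂ} (hq0 : q ≠ 0) (hb0 : b ≠ 0) (hb1 : 1 - b ≠ 0)
    (hq : ∀ m : ℕ, 1 - q * q ^ m ≠ 0) (ha : ∀ m : ℕ, 1 - a * q ^ m ≠ 0)
    (hk : ∀ m : ℕ, 1 - a * b * q ^ m ≠ 0) (hbq : q - b ≠ 0) (i N : ℕ) :
    ∑ m ∈ range (N + 1), wpKer a b q (i + N) (i + m) * ((1 - a * q ^ (2 * (i + m))) / (1 - a) *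
      b ^ (i + m) * wpKer (a * b) (1 / b) q (i + m) i) =
    if N = 0 then b ^ i * (1 - a * b) / (1 - a * b * q ^ (2 * i)) else 0 := by
  have haq : ∀ m : ℕ, 1 - a * q * q ^ m ≠ 0 := fun m => by
    have := ha (m + 1)
    rwa [pow_succ', ← mul_assoc] at this
  have hkq : ∀ m : ℕ, 1 - a * b * q * q ^ m ≠ 0 := fun m => by
    have := hk (m + 1)
    rwa [pow_succ', ← mul_assoc] at this
  have ha0 : 1 - a ≠ 0 := by simpa using ha 0
  have hab : a * b * (1 / b) = a := by field_simp
  have hL : ∀ m ∈ range (N + 1), wpKer a b q (i + N) (i + m) *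
        ((1 - a * q ^ (2 * (i + m))) / (1 - a) * b ^ (i + m) *
          wpKer (a * b) (1 / b) q (i + m) i) =
      (b ^ i * qPoch (a * b) q (2 * i) * qPoch a q (2 * i) /
        (qPoch (a * q) q (2 * i) * qPoch (a * b * q) q (2 * i) * (1 - a))) *
      (wpKer (a * q ^ (2 * i)) b q N m * ((1 - a * q ^ (2 * i) * q ^ (2 * m)) *
      (qPoch (1 / b) q m * qPoch (a * q ^ (2 * i)) q m /
        (qPoch q q m * qPoch (a * q ^ (2 * i) * b * q) q m)) * b ^ m)) := by
    intro m hm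
    have haqm := qPoch_ne_of_forall haq (2 * i + (N + m))
    have hkqm := qPoch_ne_of_forall hkq (2 * i + m)
    rw [wpKer, wpKer, wpKer, hab, show i + m - i = m by omega, show i + m + i = 2 * i + m by ring,
      show i + N - (i + m) = N - m by omega, show i + N + (i + m) = 2 * i + (N + m) by ring]
    rw [qPoch_add] at haqm hkqm
    rw [qPoch_add _ _ (2 * i) m, qPoch_add _ _ (2 * i) m, qPoch_add _ _ (2 * i) (N + m),
      qPoch_add _ _ (2 * i) (N + m)]
    have e1 : a * q ^ (2 * i) * b = a * b * q ^ (2 * i) := by ring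
    have e2 : a * q ^ (2 * i) * q = a * q * q ^ (2 * i) := by ring
    have e4 : a * b * q ^ (2 * i) * q = a * b * q * q ^ (2 * i) := by ring
    have e3 : a * q ^ (2 * (i + m)) = a * q ^ (2 * i) * q ^ (2 * m) := by ring
    rw [e1, e2, e3, e4, pow_add]
    generalize qPoch (a * b * q ^ (2 * i)) q (N + m) = s1 at *
    generalize qPoch (a * q * q ^ (2 * i)) q (N + m) = s2 at *
    generalize qPoch (a * b * q * q ^ (2 * i)) q m = s3 at *
    generalize qPoch (a * q ^ (2 * i)) q m = s4 at *
    generalize 1 - a * q ^ (2 * i) * q ^ (2 * m) = t1 at *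
    generalize 1 - a = t2 at *
    have h1 := right_ne_zero_of_mul haqm
    have h2 := right_ne_zero_of_mul hkqm
    have h3 := left_ne_zero_of_mul haqm
    have h4 := left_ne_zero_of_mul hkqm
    have := qPoch_ne_of_forall hq (N - m); have := qPoch_ne_of_forall hq m
    generalize qPoch (a * b) q (2 * i) = s5 at *
    generalize qPoch (a * b * q) q (2 * i) = s6 at *
    generalize qPoch (a * q) q (2 * i) = s7 at *
    generalize qPoch (1 / b) q m = s8 at *
    field_simp
  rw [Finset.sum_congr rfl hL, ← Finset.mul_sum]
  cases N with
  | zero =>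
    have e1 : qPoch (a * b) q (2 * i) * (1 - a * b * q ^ (2 * i)) =
        (1 - a * b) * qPoch (a * b * q) q (2 * i) := by
      rw [← qPoch_succ, qPoch_succ']
    have e2 : qPoch a q (2 * i) * (1 - a * q ^ (2 * i)) =
        (1 - a) * qPoch (a * q) q (2 * i) := by
      rw [← qPoch_succ, qPoch_succ']
    have h3 := qPoch_ne_of_forall haq (2 * i)
    have h4 := qPoch_ne_of_forall hkq (2 * i)
    have h5 := hk (2 * i)
    simp only [zero_add, Finset.sum_range_one, wpKer_zero, qPoch_zero, mul_zero, pow_zero, mul_one,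
      one_mul, div_one, if_true]
    rw [div_mul_eq_mul_div, div_eq_div_iff (mul_ne_zero (mul_ne_zero h3 h4) ha0) h5]
    linear_combination (b ^ i * qPoch (a * b) q (2 * i) * (1 - a * b * q ^ (2 * i))) * e2 +
      b ^ i * (1 - a) * qPoch (a * q) q (2 * i) * e1
  | succ N =>
    rw [wp_orthogonality_zero hq0 hb0 hb1 hq _ _ hbq, mul_zero, if_neg (Nat.succ_ne_zero N)]
    · intro m
      rw [show a * q ^ (2 * i) * q * q ^ m = a * q * q ^ (2 * i + m) by ring]
      exact haq _
    · intro m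
      rw [show a * q ^ (2 * i) * b * q ^ m = a * b * q ^ (2 * i + m) by ring]
      exact hk _

/-- Inversion of the kernel `wpKer`. -/
theorem wp_inversion {a b q : ℂ} (hq0 : q ≠ 0) (hb0 : b ≠ 0) (hb1 : 1 - b ≠ 0)
    (hq : ∀ m : ℕ, 1 - q * q ^ m ≠ 0) (ha : ∀ m : ℕ, 1 - a * q ^ m ≠ 0)
    (hk : ∀ m : ℕ, 1 - a * b * q ^ m ≠ 0) (hbq : q - b ≠ 0) (α β : ℕ → ℂ)
    (hα : ∀ n, α n = (1 - a * q ^ (2 * n)) / (1 - a) * b ^ n *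
      ∑ i ∈ range (n + 1), wpKer (a * b) (1 / b) q n i *
        ((1 - a * b * q ^ (2 * i)) / (1 - a * b) * (1 / b) ^ i * β i)) (n : ℕ) :
    ∑ j ∈ range (n + 1), wpKer a b q n j * α j = β n := by
  have hk0 : 1 - a * b ≠ 0 := by simpa using hk 0
  simp only [hα, Finset.mul_sum (range (_ + 1)) (fun i => wpKer (a * b) (1 / b) q _ i * _)]
  simp only [Finset.mul_sum]
  rw [sum_triangle (fun j i => wpKer a b q n j * ((1 - a * q ^ (2 * j)) / (1 - a) * b ^ j *
    (wpKer (a * b) (1 / b) q j i * ((1 - a * b * q ^ (2 * i)) / (1 - a * b) * (1 / b) ^ i * β i))))]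
  have hterm : ∀ i ∈ range (n + 1), ∑ m ∈ range (n - i + 1), wpKer a b q n (i + m) *
      ((1 - a * q ^ (2 * (i + m))) / (1 - a) * b ^ (i + m) * (wpKer (a * b) (1 / b) q (i + m) i *
        ((1 - a * b * q ^ (2 * i)) / (1 - a * b) * (1 / b) ^ i * β i))) =
      if i = n then β n else 0 := by
    intro i hi
    obtain ⟨N, rfl⟩ : ∃ N, n = i + N := ⟨n - i, by have := Finset.mem_range.1 hi; omega⟩
    have key := wp_orthogonality hq0 hb0 hb1 hq ha hk hbq i N
    rw [show i + N - i = N by omega]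
    have : ∀ m ∈ range (N + 1), wpKer a b q (i + N) (i + m) *
      ((1 - a * q ^ (2 * (i + m))) / (1 - a) * b ^ (i + m) * (wpKer (a * b) (1 / b) q (i + m) i *
        ((1 - a * b * q ^ (2 * i)) / (1 - a * b) * (1 / b) ^ i * β i))) =
      wpKer a b q (i + N) (i + m) * ((1 - a * q ^ (2 * (i + m))) / (1 - a) *
      b ^ (i + m) * wpKer (a * b) (1 / b) q (i + m) i) *
        ((1 - a * b * q ^ (2 * i)) / (1 - a * b) * (1 / b) ^ i * β i) := fun m _ => by ring
    rw [Finset.sum_congr rfl this, ← Finset.sum_mul, key]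
    have h5 := hk (2 * i)
    rcases N with _ | N
    · rw [if_pos rfl, if_pos (by omega), add_zero]
      generalize 1 - a * b * q ^ (2 * i) = t at *
      generalize 1 - a * b = s at *
      rw [one_div, inv_pow]
      have := pow_ne_zero i hb0
      field_simp
    · rw [if_neg (Nat.succ_ne_zero N), if_neg (by omega), zero_mul]
  rw [Finset.sum_congr rfl hterm]
  simp

/-! ### The chain as a transformation of terminating series -/

/-- Each factor `1 - q^{1-n+i}/x` is, up to `-q^{1-n+i}/x`, one of the last `j` factors of `(x;
q)_n`. The multiplied-out form needs no symbol to be nonzero, and the product on the right does not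
involve `x`, so it cancels in quotients. -/
theorem qPoch_reverse {q x : ℂ} (hq0 : q ≠ 0) (hx : x ≠ 0) {n j : ℕ} (hj : j ≤ n) :
    qPoch (q ^ (1 - (n : ℤ)) / x) q j * qPoch x q (n - j) * x ^ j =
      qPoch x q n * ∏ i ∈ range j, -(q ^ (1 - (n : ℤ) + i)) := by
  induction j with
  | zero => simp [qPoch_zero]
  | succ j ih =>
    have ih := ih (by omega)
    obtain ⟨l, rfl⟩ : ∃ l, n = j + l + 1 := ⟨n - j - 1, by omega⟩
    rw [show j + l + 1 - j = l + 1 by omega, qPoch_succ] at ih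
    rw [show j + l + 1 - (j + 1) = l by omega, Finset.prod_range_succ, ← mul_assoc, ← ih,
      qPoch_succ]
    have e : q ^ (1 - ((j + l + 1 : ℕ) : ℤ) + j) * q ^ l = 1 := by
      rw [← zpow_natCast q l, ← zpow_add₀ hq0]
      convert zpow_zero q using 2
      push_cast
      ring
    have e2 : q ^ (1 - ((j + l + 1 : ℕ) : ℤ)) * q ^ j = q ^ (1 - ((j + l + 1 : ℕ) : ℤ) + j) := by
      rw [← zpow_natCast q j, ← zpow_add₀ hq0]
    have e3 : q ^ (1 - ((j + l + 1 : ℕ) : ℤ)) / x * q ^ j * x =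
        q ^ (1 - ((j + l + 1 : ℕ) : ℤ) + j) := by
      rw [← e2]; field_simp
    have e4 : (1 - q ^ (1 - ((j + l + 1 : ℕ) : ℤ)) / x * q ^ j) * x =
        (1 - x * q ^ l) * -q ^ (1 - ((j + l + 1 : ℕ) : ℤ) + j) := by
      linear_combination -e3 - x * e
    rw [pow_succ]
    linear_combination (qPoch (q ^ (1 - ((j + l + 1 : ℕ) : ℤ)) / x) q j * qPoch x q l * x ^ j) * e4

theorem qPoch_reverse_ratio {q x y : ℂ} (hq0 : q ≠ 0) (hx : x ≠ 0) (hy : y ≠ 0) {n j : ℕ}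
    (hj : j ≤ n) (hx' : qPoch x q (n - j) ≠ 0) (hy' : qPoch y q n ≠ 0) :
    qPoch (q ^ (1 - (n : ℤ)) / x) q j / qPoch (q ^ (1 - (n : ℤ)) / y) q j =
      qPoch x q n * qPoch y q (n - j) / (qPoch x q (n - j) * qPoch y q n) * (y / x) ^ j := by
  have h1 := qPoch_reverse hq0 hx hj
  have h2 := qPoch_reverse hq0 hy hj
  have hT : ∏ i ∈ range j, -(q ^ (1 - (n : ℤ) + i)) ≠ 0 :=
    Finset.prod_ne_zero_iff.2 fun i _ => neg_ne_zero.2 (zpow_ne_zero _ hq0)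
  have h3 : qPoch (q ^ (1 - (n : ℤ)) / y) q j ≠ 0 := by
    intro h
    rw [h, zero_mul, zero_mul] at h2
    exact mul_ne_zero hy' hT h2.symm
  have hxj := pow_ne_zero j hx
  have hyj := pow_ne_zero j hy
  generalize ∏ i ∈ range j, -(q ^ (1 - (n : ℤ) + i)) = T at *
  generalize qPoch (q ^ (1 - (n : ℤ)) / y) q j = s1 at *
  generalize qPoch (q ^ (1 - (n : ℤ)) / x) q j = s2 at *
  rw [div_pow, div_mul_div_comm, div_eq_div_iff h3 (mul_ne_zero (mul_ne_zero hx' hy') hxj)]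
  apply mul_right_cancel₀ hT
  linear_combination qPoch y q n * T * h1 - qPoch x q n * T * h2

theorem qPoch_neg_pow_eq_zero {q : ℂ} (hq0 : q ≠ 0) {n j : ℕ} (hj : n < j) :
    qPoch (q ^ (-(n : ℤ))) q j = 0 := by
  refine Finset.prod_eq_zero (Finset.mem_range.2 hj) ?_
  rw [← zpow_natCast q n, ← zpow_add₀ hq0]
  simp

theorem qPoch_shift_ratio {q x : ℂ} (n j : ℕ) (h : qPoch x q n ≠ 0) :
    qPoch (x * q ^ n) q j = qPoch x q (n + j) / qPoch x q n := by
  rw [qPoch_add]; field_simp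

/-- The symbols of length `n - j` become those in `q ^ (-n)` and `a q^{1-n}/k` by reversal, and
those of length `n + j` split off a symbol of length `n`. In this form the kernel supplies the four
parameters depending on `n` in every left-hand side. -/
theorem kernel_ratio {a k q : ℂ} (hq0 : q ≠ 0) (ha0 : a ≠ 0) (hk0 : k ≠ 0)
    (hq : ∀ m : ℕ, 1 - q * q ^ m ≠ 0) (haq : ∀ m : ℕ, 1 - a * q * q ^ m ≠ 0)
    (hk : ∀ m : ℕ, 1 - k * q ^ m ≠ 0) (hka : ∀ m : ℕ, 1 - k / a * q ^ m ≠ 0) {n j : ℕ}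
    (hj : j ≤ n) :
    qPoch (k * q ^ n) q j * qPoch (q ^ (-(n : ℤ))) q j /
        (qPoch (a * q ^ (1 - (n : ℤ)) / k) q j * qPoch (a * q ^ (n + 1)) q j) =
      qPoch q q n * qPoch (a * q) q n / (qPoch (k / a) q n * qPoch k q n) *
        wpKer a (k / a) q n j * (k / (a * q)) ^ j := by
  have e1 : q ^ (-(n : ℤ)) = q ^ (1 - (n : ℤ)) / q := by
    rw [zpow_sub₀ hq0, zpow_neg, zpow_one]; field_simp
  have e2 : a * q ^ (1 - (n : ℤ)) / k = q ^ (1 - (n : ℤ)) / (k / a) := by field_simp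
  have e3 : a * q ^ (n + 1) = a * q * q ^ n := by ring
  have e4 : a * (k / a) = k := by field_simp
  have h := qPoch_reverse_ratio hq0 hq0 (div_ne_zero hk0 ha0) hj
    (qPoch_ne_of_forall hq _) (qPoch_ne_of_forall hka n)
  rw [mul_comm (qPoch (k * q ^ n) q j), mul_div_mul_comm, e1, e2, e3, h,
    qPoch_shift_ratio n j (qPoch_ne_of_forall hk n), qPoch_shift_ratio n j
      (qPoch_ne_of_forall haq n), wpKer, e4, (by field_simp : k / a / q = k / (a * q))]
  have h1 := qPoch_ne_of_forall hq (n - j); have h2 := qPoch_ne_of_forall haq (n + j)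
  have h3 := qPoch_ne_of_forall haq n; have h4 := qPoch_ne_of_forall hk n
  have h5 := qPoch_ne_of_forall hka n
  generalize (k / (a * q)) ^ j = t at *
  field_simp

theorem chainPrefactor_eq {a k q : ℂ} (n : ℕ) : chainPrefactor a k q n =
    (1 - k) / (1 - k * q ^ (2 * n)) * (qPoch (a * q) q n * qPoch (k ^ 2 * q / a ^ 2) q n /
      (qPoch k q n * qPoch (k / a) q n)) := by
  simp [chainPrefactor, qPochs]

/-- This is `wp_chain` with `c = a / (k * q)`, for which `a / (c * q) = k`. Reversal is applied on
both sides: on the right, `(k² q / a²; q)_{n-j} / (q; q)_{n-j}` produces the parameters `q^{-n}` and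
`a² q^{-n} / k²`. The factors independent of `j` collect into `chainPrefactor`. -/
theorem transformation_of_pair {a k q : ℂ} (hq0 : q ≠ 0) (ha0 : a ≠ 0) (hk0 : k ≠ 0)
    (hq : ∀ m : ℕ, 1 - q * q ^ m ≠ 0) (haq : ∀ m : ℕ, 1 - a * q * q ^ m ≠ 0)
    (hk : ∀ m : ℕ, 1 - k * q ^ m ≠ 0) (hka : ∀ m : ℕ, 1 - k / a * q ^ m ≠ 0)
    (hK : ∀ m : ℕ, 1 - a ^ 2 / (k * q) * q ^ m ≠ 0) (hc1 : 1 - a / (k * q) ≠ 0)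
    (hY : ∀ m : ℕ, 1 - k ^ 2 * q / a ^ 2 * q ^ m ≠ 0) (hYq : q - k ^ 2 * q / a ^ 2 ≠ 0)
    (α β : ℕ → ℂ)
    (hβ : ∀ n, ∑ i ∈ range (n + 1), wpKer a (a / (k * q)) q n i * α i = β n) (n : ℕ) :
    ∑ j ∈ range (n + 1), qPoch (k * q ^ n) q j * qPoch (q ^ (-(n : ℤ))) q j /
        (qPoch (a * q ^ (1 - (n : ℤ)) / k) q j * qPoch (a * q ^ (n + 1)) q j) *
        (qPoch (a ^ 2 / k) q (2 * j) / qPoch (k * q) q (2 * j) * (k * q ^ 2 / a) ^ j * α j)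
      = chainPrefactor a k q n * ∑ j ∈ range (n + 1),
          (1 - a ^ 2 / (k * q) * q ^ (2 * j)) / (1 - a ^ 2 / (k * q)) *
          (qPoch (q ^ (-(n : ℤ))) q j / qPoch (a ^ 2 * q ^ (-(n : ℤ)) / k ^ 2) q j) * q ^ j *
          β j := by
  have hc0 : a / (k * q) ≠ 0 := div_ne_zero ha0 (mul_ne_zero hk0 hq0)
  have e1 : 1 / (a / (k * q) * q) = k / a := by field_simp
  have e2 : a * (a / (k * q)) * q = a ^ 2 / k := by field_simp
  have e3 : a / (a / (k * q)) = k * q := by field_simp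
  have e4 : 1 / ((a / (k * q)) ^ 2 * q) = k ^ 2 * q / a ^ 2 := by field_simp
  have e5 : a * (a / (k * q)) = a ^ 2 / (k * q) := by ring
  have e6 : a * (k / a) = k := by field_simp
  have key := wp_chain (a := a) (c := a / (k * q)) hq0 hc0 hc1 hq haq
    (by rw [e5]; exact hK) (by rw [e4]; exact hYq) (by rw [e1, e6]; exact hk) α β hβ n
  rw [e1, e2, e3, e4, e5, e6] at key
  have hL : ∀ j ∈ range (n + 1), qPoch (k * q ^ n) q j * qPoch (q ^ (-(n : ℤ))) q j /
        (qPoch (a * q ^ (1 - (n : ℤ)) / k) q j * qPoch (a * q ^ (n + 1)) q j) *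
        (qPoch (a ^ 2 / k) q (2 * j) / qPoch (k * q) q (2 * j) * (k * q ^ 2 / a) ^ j * α j) =
      qPoch q q n * qPoch (a * q) q n / (qPoch (k / a) q n * qPoch k q n) *
        (wpKer a (k / a) q n j * (qPoch (a ^ 2 / k) q (2 * j) / qPoch (k * q) q (2 * j) *
          (k ^ 2 * q / a ^ 2) ^ j * α j)) := by
    intro j hj
    rw [kernel_ratio hq0 ha0 hk0 hq haq hk hka (by have := Finset.mem_range.1 hj; omega),
      show k ^ 2 * q / a ^ 2 = k / (a * q) * (k * q ^ 2 / a) by field_simp, mul_pow]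
    ring
  have hR : ∀ j ∈ range (n + 1), (1 - a ^ 2 / (k * q) * q ^ (2 * j)) / (1 - a ^ 2 / (k * q)) *
          (qPoch (q ^ (-(n : ℤ))) q j / qPoch (a ^ 2 * q ^ (-(n : ℤ)) / k ^ 2) q j) * q ^ j *
          β j =
      qPoch q q n / qPoch (k ^ 2 * q / a ^ 2) q n *
      ((1 - a ^ 2 / (k * q) * q ^ (2 * j)) / (1 - a ^ 2 / (k * q)) *
        (qPoch (k ^ 2 * q / a ^ 2) q (n - j) / qPoch q q (n - j)) * (k ^ 2 * q / a ^ 2) ^ j *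
          β j) := by
    intro j hj
    have f1 : q ^ (-(n : ℤ)) = q ^ (1 - (n : ℤ)) / q := by
      rw [zpow_sub₀ hq0, zpow_neg, zpow_one]; field_simp
    have f2 : a ^ 2 * (q ^ (1 - (n : ℤ)) / q) / k ^ 2 =
        q ^ (1 - (n : ℤ)) / (k ^ 2 * q / a ^ 2) := by field_simp
    rw [f1, f2, qPoch_reverse_ratio hq0 hq0
      (div_ne_zero (mul_ne_zero (pow_ne_zero 2 hk0) hq0) (pow_ne_zero 2 ha0))
      (by have := Finset.mem_range.1 hj; omega) (qPoch_ne_of_forall hq _)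
      (qPoch_ne_of_forall hY n), div_pow _ q]
    have := pow_ne_zero j hq0
    generalize (k ^ 2 * q / a ^ 2) ^ j = t
    generalize q ^ j = s at *
    field_simp
  rw [Finset.sum_congr rfl hL, ← Finset.mul_sum, key, Finset.sum_congr rfl hR, ← Finset.mul_sum,
    chainPrefactor_eq]
  have h1 := qPoch_ne_of_forall hq n
  have h5 := qPoch_ne_of_forall hka n; have h4 := qPoch_ne_of_forall hk n
  have h6 := qPoch_ne_of_forall hY n
  have h7 := hk (2 * n)
  generalize 1 - k * q ^ (2 * n) = t at *
  generalize 1 - k = t' at *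
  generalize qPoch (k ^ 2 * q / a ^ 2) q n = s1 at *
  generalize qPoch (k / a) q n = s2 at *
  rw [← mul_assoc, ← mul_assoc]
  congr 1
  field_simp

theorem basicHyp_eq_sum {as bs : List ℂ} {q z : ℂ} (N : ℕ)
    (hlen : as.length = bs.length + 1) (h : ∀ j, N < j → qPochs as q j = 0) :
    basicHyp as bs q z =
      ∑ j ∈ range (N + 1), qPochs as q j / qPochs (q :: bs) q j * z ^ j := by
  rw [basicHyp, tsum_eq_sum (s := range (N + 1))]
  · refine Finset.sum_congr rfl fun j _ => ?_
    have : 1 + (bs.length : ℤ) - (as.length : ℤ) = 0 := by rw [hlen]; push_cast; ring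
    rw [this, zpow_zero, mul_one]
  · intro j hj
    rw [h j (by simpa using hj)]
    simp

theorem qPochs_eq_zero {as : List ℂ} {q b : ℂ} {j : ℕ} (hb : b ∈ as) (h : qPoch b q j = 0) :
    qPochs as q j = 0 := by
  rw [qPochs, List.prod_eq_zero_iff, List.mem_map]
  exact ⟨b, hb, h⟩

theorem qPoch_mul_neg (x q : ℂ) (j : ℕ) :
    qPoch x q j * qPoch (-x) q j = qPoch (x ^ 2) (q ^ 2) j := by
  simp only [qPoch, ← Finset.prod_mul_distrib]
  refine Finset.prod_congr rfl fun i _ => ?_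
  rw [pow_right_comm]
  ring

theorem qPoch_two_mul (x q : ℂ) (j : ℕ) :
    qPoch x q (2 * j) = qPoch x (q ^ 2) j * qPoch (x * q) (q ^ 2) j := by
  induction j with
  | zero => simp [qPoch_zero]
  | succ j ih =>
    rw [show 2 * (j + 1) = 2 * j + 1 + 1 by ring, qPoch_succ, qPoch_succ, ih, qPoch_succ,
      qPoch_succ]
    ring

theorem qPoch_mul_base (x q : ℂ) (j : ℕ) :
    qPoch (q * x) q j * (1 - x) = qPoch x q j * (1 - x * q ^ j) := by
  rw [← qPoch_succ, qPoch_succ', mul_comm q x, mul_comm]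

/-- The source of the parameters in opposite pairs: the chain contributes symbols of length `2 * j`,
and each splits into four symbols of length `j` with the help of a square root of the base. -/
theorem qPoch_four (x p : ℂ) (j : ℕ) :
    qPoch (x ^ 2) (p ^ 2) (2 * j) = qPoch x (p ^ 2) j * qPoch (-x) (p ^ 2) j *
      (qPoch (x * p) (p ^ 2) j * qPoch (-(x * p)) (p ^ 2) j) := by
  rw [qPoch_two_mul, qPoch_mul_neg, qPoch_mul_neg]
  ring_nf

/-! ### Generic parameters -/

/-- Multiplicative independence of three complex numbers. -/
def MulIndep (x y z : ℂ) : Prop :=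
  ∀ i j m : ℤ, x ^ i * y ^ j * z ^ m = 1 → i = 0 ∧ j = 0 ∧ m = 0

/-- If `x * q ^ l = 1`, squaring gives a multiplicative relation among `a, k, q` with a nonzero
exponent at `a` or `k`. The hypothesis is on `x ^ 2` so that parameters with signs or half-integer
exponents, such as `-√(kq)`, are covered. -/
theorem MulIndep.one_sub_ne {a k q x : ℂ} (h : MulIndep a k q) (hq : q ≠ 0) (i j m : ℤ)
    (hx : x ^ 2 = a ^ i * k ^ j * q ^ m) (hij : i ≠ 0 ∨ j ≠ 0) (l : ℕ) : 1 - x * q ^ l ≠ 0 := by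
  intro h0
  have h1 : x * q ^ l = 1 := by linear_combination -h0
  have h2 := h i j (m + 2 * l) (by
    rw [zpow_add₀ hq, ← mul_assoc, ← hx, zpow_mul, zpow_natCast,
      show q ^ (2 : ℤ) = q ^ 2 from zpow_natCast q 2, pow_right_comm, ← mul_pow, h1, one_pow])
  omega

theorem MulIndep.one_sub_ne_sq {a k q x : ℂ} (h : MulIndep a k q) (hq : q ≠ 0) (i j m : ℤ)
    (hx : x ^ 2 = a ^ i * k ^ j * q ^ m) (hij : i ≠ 0 ∨ j ≠ 0) (l : ℕ) :
    1 - x * (q ^ 2) ^ l ≠ 0 := by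
  rw [← pow_mul]
  exact h.one_sub_ne hq i j m hx hij _

theorem MulIndep.base_sub_ne {a k q x : ℂ} (h : MulIndep a k q) (hq : q ≠ 0) (i j m : ℤ)
    (hx : x ^ 2 = a ^ i * k ^ j * q ^ m) (hij : i ≠ 0 ∨ j ≠ 0) : q - x ≠ 0 := by
  intro h0
  have := h.one_sub_ne (x := x / q) hq i j (m - 2)
    (by rw [div_pow, hx, zpow_sub₀ hq, show q ^ (2 : ℤ) = q ^ 2 from zpow_natCast q 2]; ring) hij 0
  rw [← sub_eq_zero.1 h0, div_self hq] at this
  simp at this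

theorem MulIndep.base_sq_sub_ne {a k q x : ℂ} (h : MulIndep a k q) (hq : q ≠ 0) (i j m : ℤ)
    (hx : x ^ 2 = a ^ i * k ^ j * q ^ m) (hij : i ≠ 0 ∨ j ≠ 0) : q ^ 2 - x ≠ 0 := by
  intro h0
  have := h.one_sub_ne (x := x / q ^ 2) hq i j (m - 4)
    (by rw [div_pow, hx, zpow_sub₀ hq, show q ^ (4 : ℤ) = q ^ 4 from zpow_natCast q 4]; ring) hij 0
  rw [← sub_eq_zero.1 h0, div_self (pow_ne_zero 2 hq)] at this
  simp at this

theorem MulIndep.base_ne {a k q : ℂ} (h : MulIndep a k q) (l : ℕ) : 1 - q * q ^ l ≠ 0 := by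
  intro h0
  have := h 0 0 ((l + 1 : ℕ) : ℤ) (by
    rw [zpow_natCast, pow_succ']
    simp only [zpow_zero, one_mul]
    linear_combination -h0)
  omega

theorem MulIndep.base_sq_ne {a k q : ℂ} (h : MulIndep a k q) (l : ℕ) :
    1 - q ^ 2 * (q ^ 2) ^ l ≠ 0 := by
  have := h.base_ne (2 * l + 1)
  rwa [show q * q ^ (2 * l + 1) = q ^ 2 * (q ^ 2) ^ l by ring] at this

theorem transformation_of_pair_of_mulIndep {a k q : ℂ} (hg : MulIndep a k q)
    (hq0 : q ≠ 0) (ha0 : a ≠ 0) (hk0 : k ≠ 0) (α β : ℕ → ℂ)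
    (hβ : ∀ n, ∑ i ∈ range (n + 1), wpKer a (a / (k * q)) q n i * α i = β n) (n : ℕ) :
    ∑ j ∈ range (n + 1), qPoch (k * q ^ n) q j * qPoch (q ^ (-(n : ℤ))) q j /
        (qPoch (a * q ^ (1 - (n : ℤ)) / k) q j * qPoch (a * q ^ (n + 1)) q j) *
        (qPoch (a ^ 2 / k) q (2 * j) / qPoch (k * q) q (2 * j) * (k * q ^ 2 / a) ^ j * α j)
      = chainPrefactor a k q n * ∑ j ∈ range (n + 1),
          (1 - a ^ 2 / (k * q) * q ^ (2 * j)) / (1 - a ^ 2 / (k * q)) *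
          (qPoch (q ^ (-(n : ℤ))) q j / qPoch (a ^ 2 * q ^ (-(n : ℤ)) / k ^ 2) q j) * q ^ j *
          β j := by
  refine transformation_of_pair hq0 ha0 hk0 hg.base_ne ?_ ?_ ?_ ?_ ?_ ?_ ?_ α β hβ n
  · exact hg.one_sub_ne hq0 2 0 2 (by field_simp) (by simp)
  · exact hg.one_sub_ne hq0 0 2 0 (by field_simp) (by simp)
  · exact hg.one_sub_ne hq0 (-2) 2 0 (by field_simp) (by simp)
  · exact hg.one_sub_ne hq0 4 (-2) (-2) (by field_simp) (by simp)
  · simpa using hg.one_sub_ne (x := a / (k * q)) hq0 2 (-2) (-2) (by field_simp) (by simp) 0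
  · exact hg.one_sub_ne hq0 (-4) 4 2 (by field_simp) (by simp)
  · exact hg.base_sub_ne hq0 (-4) 4 2 (by field_simp) (by simp)

theorem qPoch_base_ratio {x q : ℂ} (h : ∀ m : ℕ, 1 - x * q ^ m ≠ 0) (j : ℕ) :
    qPoch (q * x) q j / qPoch x q j = (1 - x * q ^ j) / (1 - x) := by
  rw [div_eq_div_iff (qPoch_ne_of_forall h j) (by simpa using h 0), qPoch_mul_base]
  ring

/-- Factor `1 - x² q^{2j}` as `(1 - x q^j)(1 + x q^j)`; each half is a quotient of symbols with
neighbouring base points, since `(qx; q)_j / (x; q)_j` telescopes. -/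
theorem very_well_poised_ratio {x q : ℂ} (h : ∀ m : ℕ, 1 - x * q ^ m ≠ 0)
    (h' : ∀ m : ℕ, 1 - -x * q ^ m ≠ 0) (j : ℕ) :
    (1 - x ^ 2 * q ^ (2 * j)) / (1 - x ^ 2) =
      qPoch (q * x) q j * qPoch (-(q * x)) q j / (qPoch x q j * qPoch (-x) q j) := by
  rw [← mul_neg, mul_div_mul_comm, qPoch_base_ratio h, qPoch_base_ratio h', div_mul_div_comm]
  congr 1 <;> ring

/-! ### The seven transformations for generic parameters -/

theorem transformation_7phi6_9phi8_generic {a k q sa sk sq : ℂ} (hg : MulIndep a k q)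
    (ha0 : a ≠ 0) (hk0 : k ≠ 0) (hq0 : q ≠ 0)
    (hsa : sa ^ 2 = a) (hsk : sk ^ 2 = k) (hsq : sq ^ 2 = q) (n : ℕ) :
    basicHyp
      [a / sk, -(a / sk), a * (sq / sk), -(a * (sq / sk)), k ^ 2 * q ^ 3 / a ^ 2,
        k * q ^ n, q ^ (-(n : ℤ))]
      [sk * sq, -(sk * sq), q * sk, -(q * sk),
        a * q ^ (1 - (n : ℤ)) / k, a * q ^ (n + 1)] q q
    = chainPrefactor a k q n *
      basicHyp
        [a * q / (sk * sq), -(a * q / (sk * sq)), a ^ 2 / (k * q),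
          sa ^ 3 / (k * q), -(sa ^ 3 / (k * q)), sa ^ 3 / (k * sq), -(sa ^ 3 / (k * sq)),
          k * q ^ 2 / a, q ^ (-(n : ℤ))]
        [a / (sk * sq), -(a / (sk * sq)), sa * sq, -(sa * sq), q * sa, -(q * sa),
          a ^ 3 / (k ^ 2 * q ^ 2), a ^ 2 * q ^ (-(n : ℤ)) / k ^ 2] q q := by
  have hsk0 : sk ≠ 0 := fun h => hk0 (by rw [← hsk, h]; ring)
  have hsq0 : sq ≠ 0 := fun h => hq0 (by rw [← hsq, h]; ring)
  have hz : ∀ j, n < j → qPoch (q ^ (-(n : ℤ))) q j = 0 := fun j => qPoch_neg_pow_eq_zero hq0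
  rw [basicHyp_eq_sum n rfl (fun j hj => qPochs_eq_zero (by simp) (hz j hj)),
    basicHyp_eq_sum n rfl (fun j hj => qPochs_eq_zero (by simp) (hz j hj))]
  have hpair := fun n => saalschutz_pair (a := a) (b := a / (k * q)) hq0 (div_ne_zero ha0 (mul_ne_zero hk0 hq0))
    hg.base_ne (hg.one_sub_ne hq0 2 0 2 (by field_simp) (by simp))
    (hg.base_sub_ne hq0 2 (-2) (-2) (by field_simp) (by simp))
    (hg.one_sub_ne hq0 6 (-4) (-4) (by field_simp) (by simp)) n
  have key := transformation_of_pair_of_mulIndep hg hq0 ha0 hk0 _ _ hpair n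
  convert key using 1
  · refine Finset.sum_congr rfl fun j _ => ?_
    have e1 : qPoch (a ^ 2 / k) q (2 * j) = qPoch (a / sk) q j * qPoch (-(a / sk)) q j *
        (qPoch (a * (sq / sk)) q j * qPoch (-(a * (sq / sk))) q j) := by
      have := qPoch_four (a / sk) sq j
      rwa [div_pow, hsk, hsq, div_mul_eq_mul_div, mul_div_assoc] at this
    have e2 : qPoch (k * q) q (2 * j) = qPoch (sk * sq) q j * qPoch (-(sk * sq)) q j *
        (qPoch (q * sk) q j * qPoch (-(q * sk)) q j) := by
      have := qPoch_four (sk * sq) sq j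
      rwa [mul_pow, hsk, hsq, mul_assoc sk, ← pow_two, hsq, mul_comm sk q] at this
    have e3 : q / (a / (k * q)) ^ 2 = k ^ 2 * q ^ 3 / a ^ 2 := by field_simp
    -- The power in the chain and the power `b ^ j` of the pair, with `b = a / (k * q)`, combine to
    -- the argument `q`.
    have e4 : (k * q ^ 2 / a) ^ j * (a / (k * q)) ^ j = q ^ j := by
      rw [← mul_pow]; congr 1; field_simp
    simp only [qPochs, List.map_cons, List.map_nil, List.prod_cons, List.prod_nil, mul_one]
    rw [e1, e2, e3, ← e4]
    ring
  · congr 1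
    refine Finset.sum_congr rfl fun j _ => ?_
    have e1 : qPoch (a * (a / (k * q)) ^ 2) q (2 * j) =
        qPoch (sa ^ 3 / (k * q)) q j * qPoch (-(sa ^ 3 / (k * q))) q j *
        (qPoch (sa ^ 3 / (k * sq)) q j * qPoch (-(sa ^ 3 / (k * sq))) q j) := by
      have := qPoch_four (sa ^ 3 / (k * q)) sq j
      rwa [hsq, show (sa ^ 3 / (k * q)) ^ 2 = a * (a / (k * q)) ^ 2 by rw [← hsa]; ring,
        show sa ^ 3 / (k * q) * sq = sa ^ 3 / (k * sq) by rw [← hsq]; field_simp] at this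
    have e2 : qPoch (a * q) q (2 * j) = qPoch (sa * sq) q j * qPoch (-(sa * sq)) q j *
        (qPoch (q * sa) q j * qPoch (-(q * sa)) q j) := by
      have := qPoch_four (sa * sq) sq j
      rwa [mul_pow, hsa, hsq, mul_assoc sa, ← pow_two, hsq, mul_comm sa q] at this
    have e3 : a ^ 2 / (k * q) = (a / (sk * sq)) ^ 2 := by rw [← hsk, ← hsq]; ring
    have e4 : q / (a / (k * q)) = k * q ^ 2 / a := by field_simp
    have e5 : a * (a / (k * q)) = a ^ 2 / (k * q) := by ring
    have e6 : a * (a / (k * q)) ^ 2 = a ^ 3 / (k ^ 2 * q ^ 2) := by ring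
    have e7 : a * q / (sk * sq) = q * (a / (sk * sq)) := by ring
    have hS : (a / (sk * sq)) ^ 2 = a ^ (2 : ℤ) * k ^ (-1 : ℤ) * q ^ (-1 : ℤ) := by
      rw [← e3]; field_simp
    rw [e1, e2, e4, e5, e6, e7, e3, very_well_poised_ratio (hg.one_sub_ne hq0 2 (-1) (-1) hS (by simp))
      (hg.one_sub_ne hq0 2 (-1) (-1) (by rw [neg_sq, hS]) (by simp))]
    simp only [qPochs, List.map_cons, List.map_nil, List.prod_cons, List.prod_nil, mul_one]
    ring

/-- For `c = a / (k * q)` the kernel in the hypothesis belongs to `(a * c, a)`, the reverse of `(a,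
a * c)`. Its inversion makes `B` the `β`-sequence of a pair relative to `(a, a * c)` and puts the
closed form `R` into `α`. A known closed-form sum thus feeds the right-hand series, and its value
the left-hand one. -/
theorem transformation_of_inverse_pair {a k q : ℂ} (hg : MulIndep a k q)
    (hq0 : q ≠ 0) (ha0 : a ≠ 0) (hk0 : k ≠ 0) (R B : ℕ → ℂ)
    (h : ∀ n, ∑ i ∈ range (n + 1), wpKer (a ^ 2 / (k * q)) (1 / (a / (k * q))) q n i *
      ((1 - a ^ 2 / (k * q) * q ^ (2 * i)) / (1 - a ^ 2 / (k * q)) * B i *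
        (1 / (a / (k * q))) ^ i) = R n) (n : ℕ) :
    ∑ j ∈ range (n + 1), qPoch (k * q ^ n) q j * qPoch (q ^ (-(n : ℤ))) q j /
        (qPoch (a * q ^ (1 - (n : ℤ)) / k) q j * qPoch (a * q ^ (n + 1)) q j) *
        (qPoch (a ^ 2 / k) q (2 * j) / qPoch (k * q) q (2 * j) * q ^ j *
          ((1 - a * q ^ (2 * j)) / (1 - a)) * R j)
      = chainPrefactor a k q n * ∑ j ∈ range (n + 1),
          (1 - a ^ 2 / (k * q) * q ^ (2 * j)) / (1 - a ^ 2 / (k * q)) *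
          (qPoch (q ^ (-(n : ℤ))) q j / qPoch (a ^ 2 * q ^ (-(n : ℤ)) / k ^ 2) q j) * q ^ j *
          B j := by
  have hc0 : a / (k * q) ≠ 0 := div_ne_zero ha0 (mul_ne_zero hk0 hq0)
  have hpair := fun n => wp_inversion (a := a) (b := a / (k * q)) hq0 hc0
    (by simpa using hg.one_sub_ne (x := a / (k * q)) hq0 2 (-2) (-2) (by field_simp) (by simp) 0)
    hg.base_ne (hg.one_sub_ne hq0 2 0 0 (by simp [zpow_ofNat]) (by simp))
    (hg.one_sub_ne hq0 4 (-2) (-2) (by field_simp) (by simp))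
    (hg.base_sub_ne hq0 2 (-2) (-2) (by field_simp) (by simp))
    (fun n => (1 - a * q ^ (2 * n)) / (1 - a) * (a / (k * q)) ^ n * R n) B (fun n => by
      rw [← h n, show a * (a / (k * q)) = a ^ 2 / (k * q) by ring]
      congr 1
      refine Finset.sum_congr rfl fun i _ => ?_
      ring) n
  rw [← transformation_of_pair_of_mulIndep hg hq0 ha0 hk0 _ _ hpair n]
  refine Finset.sum_congr rfl fun j _ => ?_
  have e : (k * q ^ 2 / a) ^ j * (a / (k * q)) ^ j = q ^ j := by
    rw [← mul_pow]; congr 1; field_simp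
  rw [← e]
  ring

theorem MulIndep.very_well_poised_ratio {a k q x y : ℂ} (hg : MulIndep a k q) (hq0 : q ≠ 0)
    (i j m : ℤ) (hx : x ^ 2 = y) (hy : y = a ^ i * k ^ j * q ^ m) (hij : i ≠ 0 ∨ j ≠ 0) (l : ℕ) :
    (1 - y * q ^ (2 * l)) / (1 - y) =
      qPoch (q * x) q l * qPoch (-(q * x)) q l / (qPoch x q l * qPoch (-x) q l) := by
  rw [← hx]
  exact _root_.very_well_poised_ratio (hg.one_sub_ne hq0 i j m (hx.trans hy) hij)
    (hg.one_sub_ne hq0 i j m (by rw [neg_sq, hx, hy]) hij) l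

theorem transformation_10phi9_4phi3_generic {a k q sa sk sq : ℂ} (hg : MulIndep a k q)
    (ha0 : a ≠ 0) (hk0 : k ≠ 0) (hq0 : q ≠ 0)
    (hsa : sa ^ 2 = a) (hsk : sk ^ 2 = k) (hsq : sq ^ 2 = q) (n : ℕ) :
    basicHyp
      [a, q * sa, -(q * sa), a * (sq / sk), -(a * (sq / sk)), q * (sk * sq), -(q * (sk * sq)),
        a / (k * q ^ 2), k * q ^ n, q ^ (-(n : ℤ))]
      [sa, -sa, sk * sq, -(sk * sq), a / (sk * sq), -(a / (sk * sq)), k * q ^ 3,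
        a * q ^ (1 - (n : ℤ)) / k, a * q ^ (n + 1)] q q
    = chainPrefactor a k q n *
      basicHyp
        [q * (a / (sk * sq)), -(q * (a / (sk * sq))), a ^ 2 / (k ^ 2 * q ^ 3), q ^ (-(n : ℤ))]
        [a / (sk * sq), -(a / (sk * sq)), a ^ 2 * q ^ (-(n : ℤ)) / k ^ 2] q q := by
  have hsk0 : sk ≠ 0 := fun h => hk0 (by rw [← hsk, h]; ring)
  have hsq0 : sq ≠ 0 := fun h => hq0 (by rw [← hsq, h]; ring)
  have hz : ∀ j, n < j → qPoch (q ^ (-(n : ℤ))) q j = 0 := fun j => qPoch_neg_pow_eq_zero hq0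
  rw [basicHyp_eq_sum n rfl (fun j hj => qPochs_eq_zero (by simp) (hz j hj)),
    basicHyp_eq_sum n rfl (fun j hj => qPochs_eq_zero (by simp) (hz j hj))]
  have hpair := fun n => chain_pair (a := a ^ 2 / (k * q)) (b := 1 / (a / (k * q))) hq0
    (by simp [ha0, hk0, hq0])
    (by simpa using hg.one_sub_ne (x := k * q / a) hq0 (-2) 2 2 (by field_simp) (by simp) 0)
    hg.base_ne (hg.one_sub_ne hq0 4 (-2) (-2) (by field_simp) (by simp))
    (hg.base_sub_ne hq0 (-2) 2 2 (by field_simp) (by simp))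
    (hg.one_sub_ne hq0 0 2 6 (by field_simp) (by simp)) n
  have key := transformation_of_inverse_pair hg hq0 ha0 hk0 _ _ hpair n
  have hS : (a / (sk * sq)) ^ 2 = a ^ 2 / (k * q) := by rw [← hsk, ← hsq]; ring
  have hT : (sk * sq) ^ 2 = k * q := by rw [← hsk, ← hsq]; ring
  have wS := hg.very_well_poised_ratio hq0 2 (-1) (-1) hS (by field_simp) (by simp)
  have wT := hg.very_well_poised_ratio hq0 0 1 1 hT (by field_simp) (by simp)
  have wA := hg.very_well_poised_ratio hq0 1 0 0 hsa (by simp) (by simp)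
  convert key using 1
  · refine Finset.sum_congr rfl fun j _ => ?_
    -- The pair has `(a²/(kq); q)_{2j}` and `(k q²; q)_{2j}` where the chain has `(a²/k; q)_{2j}`
    -- and `(kq; q)_{2j}`. The base points differ by one factor `q`, so the quotients are
    -- very-well-poised factors with roots `a/√(kq)` and `√(kq)`.
    have e1 := qPoch_base_ratio (hg.one_sub_ne (x := a ^ 2 / (k * q)) hq0 4 (-2) (-2)
      (by field_simp) (by simp)) (2 * j)
    have e2 := qPoch_base_ratio (hg.one_sub_ne (x := k * q) hq0 0 2 2
      (by field_simp) (by simp)) (2 * j)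
    rw [wS j, show q * (a ^ 2 / (k * q)) = a ^ 2 / k by field_simp] at e1
    rw [wT j, show q * (k * q) = k * q ^ 2 by ring] at e2
    have e3 : a ^ 2 / (k * q) * (1 / (a / (k * q))) ^ 2 * q = k * q ^ 2 := by field_simp
    have e4 : a ^ 2 / (k * q) * (1 / (a / (k * q))) ^ 2 * q ^ 2 = k * q ^ 3 := by field_simp
    have e5 : a ^ 2 / (k * q) * (1 / (a / (k * q))) = a := by field_simp
    have e6 : 1 / (1 / (a / (k * q)) * q) = a / (k * q ^ 2) := by field_simp
    have e7 : a * (sq / sk) = q * (a / (sk * sq)) := by rw [← hsq]; field_simp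
    simp only [qPochs, List.map_cons, List.map_nil, List.prod_cons, List.prod_nil, mul_one]
    rw [e3, e4, e5, e6, e7, wA j]
    linear_combination -(qPoch a q j * qPoch (q * sa) q j * qPoch (-(q * sa)) q j *
      qPoch (a / (k * q ^ 2)) q j * qPoch (k * q ^ n) q j * qPoch (q ^ (-(n : ℤ))) q j /
      (qPoch q q j * qPoch sa q j * qPoch (-sa) q j * qPoch (k * q ^ 3) q j *
        qPoch (a * q ^ (1 - (n : ℤ)) / k) q j * qPoch (a * q ^ (n + 1)) q j) * q ^ j) *
      congrArg₂ (· * ·) e1 e2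
  · congr 1
    refine Finset.sum_congr rfl fun j _ => ?_
    have e1 : 1 / ((1 / (a / (k * q))) ^ 2 * q) = a ^ 2 / (k ^ 2 * q ^ 3) := by field_simp
    rw [e1, wS j]
    simp only [qPochs, List.map_cons, List.map_nil, List.prod_cons, List.prod_nil, mul_one]
    ring

theorem transformation_8phi7_5phi4_generic {a k q sa sk sq : ℂ} (hg : MulIndep a k q)
    (ha0 : a ≠ 0) (hk0 : k ≠ 0) (hq0 : q ≠ 0)
    (hsa : sa ^ 2 = a) (hsk : sk ^ 2 = k) (hsq : sq ^ 2 = q) (n : ℕ) :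
    basicHyp
      [a, q * sa, -(q * sa), -(a * (sq / sk)), -(q * (sk * sq)), a / (k * q),
        k * q ^ n, q ^ (-(n : ℤ))]
      [sa, -sa, -(sk * sq), -(a / (sk * sq)), k * q ^ 2,
        a * q ^ (1 - (n : ℤ)) / k, a * q ^ (n + 1)] q q
    = chainPrefactor a k q n *
      basicHyp
        [q * (a / (sk * sq)), -(q * (a / (sk * sq))), a / (sk * sq), a ^ 2 / (k ^ 2 * q ^ 2),
          q ^ (-(n : ℤ))]
        [a / (sk * sq), -(a / (sk * sq)), a * (sq / sk),
          a ^ 2 * q ^ (-(n : ℤ)) / k ^ 2] q q := by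
  have hsk0 : sk ≠ 0 := fun h => hk0 (by rw [← hsk, h]; ring)
  have hsq0 : sq ≠ 0 := fun h => hq0 (by rw [← hsq, h]; ring)
  have hz : ∀ j, n < j → qPoch (q ^ (-(n : ℤ))) q j = 0 := fun j => qPoch_neg_pow_eq_zero hq0
  rw [basicHyp_eq_sum n rfl (fun j hj => qPochs_eq_zero (by simp) (hz j hj)),
    basicHyp_eq_sum n rfl (fun j hj => qPochs_eq_zero (by simp) (hz j hj))]
  have hS : (a / (sk * sq)) ^ 2 = a ^ 2 / (k * q) := by rw [← hsk, ← hsq]; ring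
  have hT : (sk * sq) ^ 2 = k * q := by rw [← hsk, ← hsq]; ring
  have nS := hg.one_sub_ne (x := a / (sk * sq)) hq0 2 (-1) (-1)
    (by rw [hS]; field_simp) (by simp)
  have nS' := hg.one_sub_ne (x := -(a / (sk * sq))) hq0 2 (-1) (-1)
    (by rw [neg_sq, hS]; field_simp) (by simp)
  have nT' := hg.one_sub_ne (x := -(sk * sq)) hq0 0 1 1 (by rw [neg_sq, hT]; field_simp) (by simp)
  have f1 : 1 / (a / (k * q)) * (a / (sk * sq)) = sk * sq := by
    rw [← hsk, ← hsq]; field_simp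
  have f2 : (a / (sk * sq)) ^ 2 * q = a ^ 2 / k := by rw [hS]; field_simp
  have f3 : (a / (sk * sq)) ^ 2 * (1 / (a / (k * q))) ^ 2 * q = k * q ^ 2 := by
    rw [hS]; field_simp
  have f3' : k * q * q = k * q ^ 2 := by ring
  have f4 : (a / (sk * sq)) ^ 2 * (1 / (a / (k * q))) ^ 2 = k * q := by rw [hS]; field_simp
  have f5 : (a / (sk * sq)) ^ 2 * (1 / (a / (k * q))) = a := by rw [hS]; field_simp
  have hpair := fun n => sqrt_pair (r := a / (sk * sq)) (b := 1 / (a / (k * q))) hq0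
    (by simp [ha0, hk0, hq0])
    (by simpa using hg.one_sub_ne (x := k * q / a) hq0 (-2) 2 2 (by field_simp) (by simp) 0)
    hg.base_ne
    (by rw [f2]; exact hg.one_sub_ne hq0 4 (-2) 0 (by field_simp) (by simp))
    (hg.base_sub_ne hq0 (-2) 2 2 (by field_simp) (by simp))
    (by rw [f3]; exact hg.one_sub_ne hq0 0 2 4 (by field_simp) (by simp))
    (fun m => by simpa using nS' m) nS
    (by rw [f1]; simpa using nT' 0) n
  simp only [f1, f2, f4, f5, f3'] at hpair
  have wS := hg.very_well_poised_ratio hq0 2 (-1) (-1) hS (by field_simp) (by simp)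
  have wA := hg.very_well_poised_ratio hq0 1 0 0 hsa (by simp) (by simp)
  have wS' : ∀ j, (1 + a / (sk * sq) * q ^ j) / (1 + a / (sk * sq)) = _ := fun j => by
    simpa using (qPoch_base_ratio nS' j).symm
  have wT' : ∀ j, (1 + sk * sq * q ^ j) / (1 + sk * sq) = _ := fun j => by
    simpa using (qPoch_base_ratio nT' j).symm
  -- Inversion calls for the full very-well-poised factor while `sqrt_pair` has only half of it.
  -- With `r = a/√(kq)`, the quotient `(r; q)_i / (qr; q)_i` placed in `B` removes the other half;
  -- it becomes the extra parameter pair of the `_5φ_4`.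
  have hpair' : ∀ n, ∑ i ∈ range (n + 1), wpKer (a ^ 2 / (k * q)) (1 / (a / (k * q))) q n i *
      ((1 - a ^ 2 / (k * q) * q ^ (2 * i)) / (1 - a ^ 2 / (k * q)) *
        (qPoch (a / (sk * sq)) q i / qPoch (q * (a / (sk * sq))) q i *
          (qPoch (1 / (1 / (a / (k * q))) ^ 2) q i / qPoch q q i)) *
        (1 / (a / (k * q))) ^ i) = _ := fun n => by
    refine Eq.trans ?_ (hpair n)
    rw [hS]
    refine Finset.sum_congr rfl fun j _ => ?_
    have n1 := qPoch_ne_of_forall nS j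
    have n2 := qPoch_ne_of_forall (hg.one_sub_ne (x := q * (a / (sk * sq))) hq0 2 (-1) 1
      (by rw [mul_pow, hS]; field_simp) (by simp)) j
    have e : qPoch (q * (a / (sk * sq))) q j * qPoch (-(q * (a / (sk * sq)))) q j /
        (qPoch (a / (sk * sq)) q j * qPoch (-(a / (sk * sq))) q j) *
        (qPoch (a / (sk * sq)) q j / qPoch (q * (a / (sk * sq))) q j) =
        qPoch (-(q * (a / (sk * sq)))) q j / qPoch (-(a / (sk * sq))) q j := by
      generalize qPoch (q * (a / (sk * sq))) q j = t1 at *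
      generalize qPoch (a / (sk * sq)) q j = t2 at *
      field_simp
    rw [wS, wS', ← mul_assoc _ (qPoch (a / (sk * sq)) q j / qPoch (q * (a / (sk * sq))) q j), e]
  have key := transformation_of_inverse_pair hg hq0 ha0 hk0 _ _ hpair' n
  convert key using 1
  · refine Finset.sum_congr rfl fun j _ => ?_
    have n1 := qPoch_ne_of_forall (hg.one_sub_ne (x := a ^ 2 / k) hq0 4 (-2) 0
      (by field_simp) (by simp)) (2 * j)
    have n2 := qPoch_ne_of_forall (hg.one_sub_ne (x := k * q) hq0 0 2 2
      (by field_simp) (by simp)) (2 * j)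
    have e7 : -(a * (sq / sk)) = q * -(a / (sk * sq)) := by rw [← hsq]; field_simp
    simp only [qPochs, List.map_cons, List.map_nil, List.prod_cons, List.prod_nil, mul_one]
    have hXY : qPoch (a ^ 2 / k) q (2 * j) / qPoch (k * q) q (2 * j) *
        (qPoch (k * q) q (2 * j) / qPoch (a ^ 2 / k) q (2 * j)) = 1 := by
      generalize qPoch (k * q) q (2 * j) = t1 at *
      generalize qPoch (a ^ 2 / k) q (2 * j) = t2 at *
      field_simp
    rw [wA j, one_div_one_div, mul_div_mul_comm (1 + a / (sk * sq) * q ^ j), wS', wT', e7,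
      mul_neg]
    linear_combination -(qPoch a q j * qPoch (q * sa) q j * qPoch (-(q * sa)) q j *
      qPoch (-(q * (a / (sk * sq)))) q j * qPoch (-(q * (sk * sq))) q j * qPoch (a / (k * q)) q j *
      qPoch (k * q ^ n) q j * qPoch (q ^ (-(n : ℤ))) q j /
      (qPoch q q j * qPoch sa q j * qPoch (-sa) q j * qPoch (-(sk * sq)) q j *
        qPoch (-(a / (sk * sq))) q j * qPoch (k * q ^ 2) q j *
        qPoch (a * q ^ (1 - (n : ℤ)) / k) q j * qPoch (a * q ^ (n + 1)) q j) * q ^ j) * hXY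
  · congr 1
    refine Finset.sum_congr rfl fun j _ => ?_
    have e1 : 1 / (1 / (a / (k * q))) ^ 2 = a ^ 2 / (k ^ 2 * q ^ 2) := by field_simp
    have e7 : a * (sq / sk) = q * (a / (sk * sq)) := by rw [← hsq]; field_simp
    rw [e1, wS j, e7]
    simp only [qPochs, List.map_cons, List.map_nil, List.prod_cons, List.prod_nil, mul_one]
    ring

theorem transformation_8phi7_6phi5_generic {a k q sa sk sq : ℂ} (hg : MulIndep a k q)
    (ha0 : a ≠ 0) (hk0 : k ≠ 0) (hq0 : q ≠ 0)
    (hsa : sa ^ 2 = a) (hsk : sk ^ 2 = k) (hsq : sq ^ 2 = q) (n : ℕ) :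
    basicHyp
      [a, q * sa, -(q * sa), a * (sq / sk), -(a * (sq / sk)), a / (k * q),
        k * q ^ n, q ^ (-(n : ℤ))]
      [sa, -sa, sk * sq, -(sk * sq), q ^ 2 * k,
        a * q ^ (1 - (n : ℤ)) / k, a * q ^ (n + 1)] q (-(k * q ^ 2 / a))
    = chainPrefactor a k q n *
      basicHyp
        [a * q ^ 2 / (sk * sq), -(a * q ^ 2 / (sk * sq)), a ^ 2 / (k * q),
          a ^ 2 / (k ^ 2 * q ^ 2), q ^ (-(n : ℤ)), q ^ (1 - (n : ℤ))]
        [a / (sk * sq), -(a / (sk * sq)), q ^ 3 * k, a ^ 2 * q ^ (-(n : ℤ)) / k ^ 2,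
          a ^ 2 * q ^ (1 - (n : ℤ)) / k ^ 2] (q ^ 2) (q ^ 2) := by
  have hsk0 : sk ≠ 0 := fun h => hk0 (by rw [← hsk, h]; ring)
  have hsq0 : sq ≠ 0 := fun h => hq0 (by rw [← hsq, h]; ring)
  have hz : ∀ j, n < j → qPoch (q ^ (-(n : ℤ))) q j = 0 := fun j => qPoch_neg_pow_eq_zero hq0
  have hpow : q ^ (1 - (n : ℤ)) = q ^ (-(n : ℤ)) * q := by
    rw [show (1 - (n : ℤ)) = -(n : ℤ) + 1 by ring, zpow_add_one₀ hq0]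
  have hz2 : ∀ j, n / 2 < j →
      qPoch (q ^ (-(n : ℤ))) (q ^ 2) j * qPoch (q ^ (1 - (n : ℤ))) (q ^ 2) j = 0 := fun j hj => by
    rw [hpow, ← qPoch_two_mul]
    exact hz _ (by omega)
  rw [basicHyp_eq_sum n rfl (fun j hj => qPochs_eq_zero (by simp) (hz j hj)),
    basicHyp_eq_sum (n / 2) rfl (fun j hj => by
      simp only [qPochs, List.map_cons, List.map_nil, List.prod_cons, List.prod_nil, mul_one]
      rw [hz2 j hj]; ring)]
  have hS : (a / (sk * sq)) ^ 2 = a ^ 2 / (k * q) := by rw [← hsk, ← hsq]; ring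
  have hT : (sk * sq) ^ 2 = k * q := by rw [← hsk, ← hsq]; ring
  have hpair := fun n => even_pair (a := a ^ 2 / (k * q)) (b := 1 / (a / (k * q))) hq0
    (by simp [ha0, hk0, hq0])
    (by simpa using hg.one_sub_ne (x := k * q / a) hq0 (-2) 2 2 (by field_simp) (by simp) 0)
    hg.base_ne (hg.one_sub_ne hq0 4 (-2) (-2) (by field_simp) (by simp))
    (hg.base_sub_ne hq0 (-2) 2 2 (by field_simp) (by simp))
    (hg.one_sub_ne hq0 0 2 4 (by field_simp) (by simp)) n
  have f1 : a ^ 2 / (k * q) * (1 / (a / (k * q))) ^ 2 * q ^ 2 = q ^ 3 * k := by field_simp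
  have f2 : a ^ 2 / (k * q) * (1 / (a / (k * q))) ^ 2 * q = q ^ 2 * k := by field_simp
  have f3 : a ^ 2 / (k * q) * (1 / (a / (k * q))) = a := by field_simp
  have f4 : a ^ 2 / (k * q) * q = a ^ 2 / k := by field_simp
  have f5 : 1 / (1 / (a / (k * q))) ^ 2 = a ^ 2 / (k ^ 2 * q ^ 2) := by field_simp
  have f6 : 1 / (1 / (a / (k * q))) = a / (k * q) := by field_simp
  simp only [f1, f2, f3, f4, f5, f6] at hpair
  -- `B` is extended by zero to odd indices. On the right only even `j` survive, which yields a
  -- series in base `q ^ 2` ending at `n / 2`.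
  have hpair' : ∀ n, ∑ i ∈ range (n + 1), wpKer (a ^ 2 / (k * q)) (1 / (a / (k * q))) q n i *
      ((1 - a ^ 2 / (k * q) * q ^ (2 * i)) / (1 - a ^ 2 / (k * q)) *
        (if i % 2 = 0 then qPoch (a ^ 2 / (k * q)) (q ^ 2) (i / 2) *
          qPoch (a ^ 2 / (k ^ 2 * q ^ 2)) (q ^ 2) (i / 2) /
          (qPoch (q ^ 2) (q ^ 2) (i / 2) * qPoch (q ^ 3 * k) (q ^ 2) (i / 2)) else 0) *
        (1 / (a / (k * q))) ^ i) = _ := fun n => by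
    refine Eq.trans ?_ (hpair n)
    rw [sum_range_even fun i => by simp]
    refine Finset.sum_congr rfl fun i _ => ?_
    rw [if_pos (by omega), show 2 * i / 2 = i by omega, show 2 * (2 * i) = 4 * i by ring]
  have key := transformation_of_inverse_pair hg hq0 ha0 hk0 _ _ hpair' n
  convert key using 1
  · refine Finset.sum_congr rfl fun j _ => ?_
    have wA := hg.very_well_poised_ratio hq0 1 0 0 hsa (by simp) (by simp) j
    -- The closed form cancels one half, in base `q ^ 2`, of each symbol of length `2 * j`. The
    -- remaining halves `(a² q / k; q²)_j` and `(kq; q²)_j` are products of pairs `±`.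
    have e1 : qPoch (a ^ 2 / k) q (2 * j) / qPoch (k * q) q (2 * j) *
        (qPoch (q ^ 2 * k) (q ^ 2) j / qPoch (a ^ 2 / k) (q ^ 2) j) =
        qPoch (a * (sq / sk)) q j * qPoch (-(a * (sq / sk))) q j /
          (qPoch (sk * sq) q j * qPoch (-(sk * sq)) q j) := by
      have n1 := qPoch_ne_of_forall (hg.one_sub_ne_sq (x := a ^ 2 / k) hq0 4 (-2) 0
        (by field_simp) (by simp)) j
      have n2 := qPoch_ne_of_forall (hg.one_sub_ne_sq (x := q ^ 2 * k) hq0 0 2 4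
        (by field_simp) (by simp)) j
      rw [qPoch_mul_neg, qPoch_mul_neg, hT, qPoch_two_mul, qPoch_two_mul,
        show (a * (sq / sk)) ^ 2 = a ^ 2 / k * q by rw [← hsk, ← hsq]; ring,
        show k * q * q = q ^ 2 * k by ring]
      generalize qPoch (a ^ 2 / k) (q ^ 2) j = t1 at *
      generalize qPoch (q ^ 2 * k) (q ^ 2) j = t2 at *
      field_simp
    have e2 : (-(k * q ^ 2 / a)) ^ j = q ^ j * (-(1 / (a / (k * q)))) ^ j := by
      rw [← mul_pow]; congr 1; field_simp
    simp only [qPochs, List.map_cons, List.map_nil, List.prod_cons, List.prod_nil, mul_one]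
    rw [wA, e2]
    linear_combination -(qPoch a q j * qPoch (q * sa) q j * qPoch (-(q * sa)) q j *
      qPoch (a / (k * q)) q j * qPoch (k * q ^ n) q j * qPoch (q ^ (-(n : ℤ))) q j /
      (qPoch q q j * qPoch sa q j * qPoch (-sa) q j * qPoch (q ^ 2 * k) q j *
        qPoch (a * q ^ (1 - (n : ℤ)) / k) q j * qPoch (a * q ^ (n + 1)) q j) *
      (q ^ j * (-(1 / (a / (k * q)))) ^ j)) * e1
  · congr 1
    symm
    rw [sum_range_even fun i => by simp]
    refine Finset.sum_congr rfl fun j _ => ?_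
    have nS : ∀ l : ℕ, 1 - a / (sk * sq) * (q ^ 2) ^ l ≠ 0 :=
      hg.one_sub_ne_sq hq0 2 (-1) (-1) (by rw [hS]; field_simp) (by simp)
    have nS' : ∀ l : ℕ, 1 - -(a / (sk * sq)) * (q ^ 2) ^ l ≠ 0 :=
      hg.one_sub_ne_sq hq0 2 (-1) (-1) (by rw [neg_sq, hS]; field_simp) (by simp)
    have wS := very_well_poised_ratio nS nS' j
    rw [hS, ← pow_mul, show 2 * (2 * j) = 2 * (2 * j) from rfl] at wS
    have e1 : a ^ 2 * q ^ (1 - (n : ℤ)) / k ^ 2 = a ^ 2 * q ^ (-(n : ℤ)) / k ^ 2 * q := by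
      rw [hpow]; ring
    have e2 : a * q ^ 2 / (sk * sq) = q ^ 2 * (a / (sk * sq)) := by ring
    rw [if_pos (by omega), show 2 * j / 2 = j by omega, wS, qPoch_two_mul, qPoch_two_mul, e1, e2,
      hpow, pow_mul q 2 j]
    simp only [qPochs, List.map_cons, List.map_nil, List.prod_cons, List.prod_nil, mul_one]
    ring


theorem transformation_16W15_7phi6_generic {a k q sa sk sq : ℂ} (hg : MulIndep a k q)
    (ha0 : a ≠ 0) (hk0 : k ≠ 0) (hq0 : q ≠ 0)
    (hsa : sa ^ 2 = a) (hsk : sk ^ 2 = k) (hsq : sq ^ 2 = q) (n : ℕ) :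
    veryWellPoised a sa
      [a / sk, -(a / sk), a * (sq / sk), -(a * (sq / sk)), a * q / sk, -(a * q / sk),
        a * q * (sq / sk), -(a * q * (sq / sk)), k ^ 2 * q ^ 2 / a ^ 2,
        k * q ^ n, k * q ^ (n + 1), q ^ (-(n : ℤ)), q ^ (1 - (n : ℤ))] (q ^ 2) (q ^ 2)
    = chainPrefactor a k q n *
      basicHyp
        [a * q / (sk * sq), -(a * q / (sk * sq)), a ^ 2 / (k * q),
          a / k * (sa / sq), -(a / k * (sa / sq)), k * q / a, q ^ (-(n : ℤ))]
        [a / (sk * sq), -(a / (sk * sq)), sa * sq, -(sa * sq), a ^ 3 / (k ^ 2 * q),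
          a ^ 2 * q ^ (-(n : ℤ)) / k ^ 2] q (-(a / k)) := by
  have hsk0 : sk ≠ 0 := fun h => hk0 (by rw [← hsk, h]; ring)
  have hsq0 : sq ≠ 0 := fun h => hq0 (by rw [← hsq, h]; ring)
  have hz : ∀ j, n < j → qPoch (q ^ (-(n : ℤ))) q j = 0 := fun j => qPoch_neg_pow_eq_zero hq0
  have hpow : q ^ (1 - (n : ℤ)) = q ^ (-(n : ℤ)) * q := by
    rw [show (1 - (n : ℤ)) = -(n : ℤ) + 1 by ring, zpow_add_one₀ hq0]
  have hqn : q ^ n * q ^ (-(n : ℤ)) = 1 := by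
    rw [← zpow_natCast q n, ← zpow_add₀ hq0, add_neg_cancel, zpow_zero]
  have hqn0 : q ^ (-(n : ℤ)) ≠ 0 := zpow_ne_zero _ hq0
  have hqn1 : q ^ n ≠ 0 := pow_ne_zero _ hq0
  have hqn' : q ^ n = 1 / q ^ (-(n : ℤ)) := by rw [eq_div_iff hqn0, hqn]
  have hz2 : ∀ j, n / 2 < j →
      qPoch (q ^ (-(n : ℤ))) (q ^ 2) j * qPoch (q ^ (1 - (n : ℤ))) (q ^ 2) j = 0 := fun j hj => by
    rw [hpow, ← qPoch_two_mul]
    exact hz _ (by omega)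
  rw [veryWellPoised, basicHyp_eq_sum (n / 2) rfl (fun j hj => by
      simp only [qPochs, List.map_cons, List.map_nil, List.prod_cons, List.prod_nil, mul_one]
      rw [hz2 j hj]; ring),
    basicHyp_eq_sum n rfl (fun j hj => qPochs_eq_zero (by simp) (hz j hj))]
  have hS : (a / (sk * sq)) ^ 2 = a ^ 2 / (k * q) := by rw [← hsk, ← hsq]; ring
  have hpair := fun n => even_pair (a := a) (b := a / (k * q)) hq0
    (div_ne_zero ha0 (mul_ne_zero hk0 hq0))
    (by simpa using hg.one_sub_ne (x := a / (k * q)) hq0 2 (-2) (-2) (by field_simp) (by simp) 0)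
    hg.base_ne (hg.one_sub_ne hq0 2 0 0 (by simp [zpow_ofNat]) (by simp))
    (hg.base_sub_ne hq0 2 (-2) (-2) (by field_simp) (by simp))
    (hg.one_sub_ne hq0 6 (-4) (-2) (by field_simp) (by simp)) n
  have f1 : a * (a / (k * q)) ^ 2 * q ^ 2 = a ^ 3 / k ^ 2 := by field_simp
  have f2 : a * (a / (k * q)) ^ 2 * q = a ^ 3 / (k ^ 2 * q) := by field_simp
  have f3 : a * (a / (k * q)) = a ^ 2 / (k * q) := by ring
  have f5 : 1 / (a / (k * q)) ^ 2 = k ^ 2 * q ^ 2 / a ^ 2 := by field_simp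
  have f6 : 1 / (a / (k * q)) = k * q / a := by field_simp
  simp only [f1, f2, f3, f5, f6] at hpair
  have hpair' : ∀ n, ∑ i ∈ range (n + 1), wpKer a (a / (k * q)) q n i *
      (if i % 2 = 0 then (1 - a * q ^ (2 * i)) / (1 - a) *
        (qPoch a (q ^ 2) (i / 2) * qPoch (k ^ 2 * q ^ 2 / a ^ 2) (q ^ 2) (i / 2) /
          (qPoch (q ^ 2) (q ^ 2) (i / 2) * qPoch (a ^ 3 / k ^ 2) (q ^ 2) (i / 2))) *
        (a / (k * q)) ^ i else 0) = _ := fun n => by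
    refine Eq.trans ?_ (hpair n)
    rw [sum_range_even fun i => by simp]
    refine Finset.sum_congr rfl fun i _ => ?_
    rw [if_pos (by omega), show 2 * i / 2 = i by omega, show 2 * (2 * i) = 4 * i by ring]
  have key := transformation_of_pair_of_mulIndep hg hq0 ha0 hk0 _ _ hpair' n
  convert key using 1
  · symm
    rw [sum_range_even fun i => by simp]
    refine Finset.sum_congr rfl fun j _ => ?_
    have wA := very_well_poised_ratio
      (hg.one_sub_ne_sq (x := sa) hq0 1 0 0 (by rw [hsa]; simp) (by simp))
      (hg.one_sub_ne_sq (x := -sa) hq0 1 0 0 (by rw [neg_sq, hsa]; simp) (by simp)) j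
    rw [hsa, ← pow_mul] at wA
    -- Since only even indices occur, the chain's symbols have length `4 * j` and split into eight
    -- symbols in base `q ^ 2`.
    have e1 : qPoch (a ^ 2 / k) q (2 * (2 * j)) =
        qPoch (a / sk) (q ^ 2) j * qPoch (-(a / sk)) (q ^ 2) j *
        (qPoch (a * q / sk) (q ^ 2) j * qPoch (-(a * q / sk)) (q ^ 2) j) *
        (qPoch (a * (sq / sk)) (q ^ 2) j * qPoch (-(a * (sq / sk))) (q ^ 2) j *
        (qPoch (a * q * (sq / sk)) (q ^ 2) j * qPoch (-(a * q * (sq / sk))) (q ^ 2) j)) := by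
      have h1 := qPoch_four (a / sk) q j
      have h2 := qPoch_four (a * (sq / sk)) q j
      rw [div_pow, hsk, div_mul_eq_mul_div] at h1
      rw [show (a * (sq / sk)) ^ 2 = a ^ 2 / k * q by rw [← hsk, ← hsq]; ring,
        mul_right_comm a (sq / sk) q] at h2
      rw [qPoch_two_mul, h1, h2]
    have e2 : qPoch (k * q) q (2 * (2 * j)) =
        qPoch (sk * sq) (q ^ 2) j * qPoch (-(sk * sq)) (q ^ 2) j *
        (qPoch (sk * sq * q) (q ^ 2) j * qPoch (-(sk * sq * q)) (q ^ 2) j) *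
        (qPoch (sk * q) (q ^ 2) j * qPoch (-(sk * q)) (q ^ 2) j *
        (qPoch (sk * q * q) (q ^ 2) j * qPoch (-(sk * q * q)) (q ^ 2) j)) := by
      have h1 := qPoch_four (sk * sq) q j
      have h2 := qPoch_four (sk * q) q j
      rw [mul_pow, hsk, hsq] at h1
      rw [mul_pow, hsk, show k * q ^ 2 = k * q * q by ring] at h2
      rw [qPoch_two_mul, h1, h2]
    have e3 : (k * q ^ 2 / a) ^ (2 * j) * (a / (k * q)) ^ (2 * j) = (q ^ 2) ^ j := by
      rw [← mul_pow, pow_mul]; congr 2; field_simp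
    -- The equations `d1`–`d9` identify the partners `a q² / b` of the well-poised series with the
    -- denominators produced by the chain.
    have d1 : a * q ^ 2 / (a / sk) = sk * q * q := by field_simp
    have d2 : a * q ^ 2 / (a * q / sk) = sk * q := by field_simp
    have d3 : a * q ^ 2 / (a * (sq / sk)) = sk * sq * q := by rw [← hsq]; field_simp
    have d4 : a * q ^ 2 / (a * q * (sq / sk)) = sk * sq := by rw [← hsq]; field_simp
    have d5 : a * q ^ 2 / (k ^ 2 * q ^ 2 / a ^ 2) = a ^ 3 / k ^ 2 := by field_simp
    have d6 : a * q ^ 2 / (k * q ^ (n + 1)) = a * q ^ (1 - (n : ℤ)) / k := by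
      rw [hpow, pow_succ q n, hqn']; field_simp
    have d7 : a * q ^ 2 / (k * q ^ n) = a * q ^ (1 - (n : ℤ)) / k * q := by
      rw [hpow, hqn']; field_simp
    have d8 : a * q ^ 2 / q ^ (1 - (n : ℤ)) = a * q ^ (n + 1) := by
      rw [hpow, pow_succ q n, hqn']; field_simp
    have d9 : a * q ^ 2 / q ^ (-(n : ℤ)) = a * q ^ (n + 1) * q := by
      rw [pow_succ q n, hqn']; field_simp
    rw [if_pos (by omega), show 2 * j / 2 = j by omega, e1, e2, wA,
      qPoch_two_mul (k * q ^ n), qPoch_two_mul (q ^ (-(n : ℤ))),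
      qPoch_two_mul (a * q ^ (1 - (n : ℤ)) / k), qPoch_two_mul (a * q ^ (n + 1)), ← hpow,
      ← e3, show k * q ^ n * q = k * q ^ (n + 1) by ring]
    simp only [qPochs, List.map_cons, List.map_nil, List.prod_cons, List.prod_nil, mul_one,
      div_neg, d1, d2, d3, d4, d5, d6, d7, d8, d9]
    ring
  · congr 1
    refine Finset.sum_congr rfl fun j _ => ?_
    have wS := hg.very_well_poised_ratio hq0 2 (-1) (-1) hS (by field_simp) (by simp) j
    have e1 : qPoch (a ^ 3 / (k ^ 2 * q)) (q ^ 2) j =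
        qPoch (a / k * (sa / sq)) q j * qPoch (-(a / k * (sa / sq))) q j := by
      rw [qPoch_mul_neg, show (a / k * (sa / sq)) ^ 2 = a ^ 3 / (k ^ 2 * q) by
        rw [mul_pow, div_pow sa, hsa, hsq]; ring]
    have e2 : qPoch (a * q) (q ^ 2) j = qPoch (sa * sq) q j * qPoch (-(sa * sq)) q j := by
      rw [qPoch_mul_neg, mul_pow, hsa, hsq]
    have e3 : (-(a / k)) ^ j = q ^ j * (-(a / (k * q))) ^ j := by
      rw [← mul_pow]; congr 1; field_simp
    have e4 : a * q / (sk * sq) = q * (a / (sk * sq)) := by ring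
    rw [wS, e1, e2, e3, e4]
    simp only [qPochs, List.map_cons, List.map_nil, List.prod_cons, List.prod_nil, mul_one]
    ring

theorem MulIndep.sq {a k q : ℂ} (h : MulIndep a k q) : MulIndep (a ^ 2) (k ^ 2) (q ^ 2) := by
  intro i j m hijm
  have := h (2 * i) (2 * j) (2 * m) (by
    rw [zpow_mul, zpow_mul, zpow_mul]
    exact_mod_cast hijm)
  omega

theorem transformation_bressoudI_generic {a k q sa : ℂ} (hg : MulIndep a k q)
    (ha0 : a ≠ 0) (hk0 : k ≠ 0) (hq0 : q ≠ 0) (hsa : sa ^ 2 = a) (n : ℕ) :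
    ∑ j ∈ Finset.range (n + 1),
      qPochs [q * sa, -(q * sa), a, k ^ 2 * q ^ 3 / a ^ 2] q j /
        qPochs [sa, -sa, a ^ 3 / (q ^ 2 * k ^ 2), q] q j *
      (qPochs [a ^ 2 / k, -(a ^ 2 / k), a ^ 2 * q / k, -(a ^ 2 * q / k),
          k ^ 2 * q ^ (2 * n), q ^ (-(2 * (n : ℤ)))] (q ^ 2) j * q ^ j /
        qPochs [k * q, -(k * q), k * q ^ 2, -(k * q ^ 2),
          a ^ 2 * q ^ (2 - 2 * (n : ℤ)) / k ^ 2, a ^ 2 * q ^ (2 + 2 * n)] (q ^ 2) j)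
    = chainPrefactor (a ^ 2) (k ^ 2) (q ^ 2) n *
      basicHyp
        [a ^ 2 * q ^ 2 / (k * q), -(a ^ 2 * q ^ 2 / (k * q)), a ^ 4 / (k ^ 2 * q ^ 2),
          -(a ^ 3 / (k ^ 2 * q ^ 2)), -(a ^ 3 / (k ^ 2 * q)), k ^ 2 * q ^ 4 / a ^ 2,
          q ^ (-(2 * (n : ℤ)))]
        [a ^ 2 / (k * q), -(a ^ 2 / (k * q)), -(a * q), -(a * q ^ 2), a ^ 6 / (k ^ 4 * q ^ 4),
          a ^ 4 * q ^ (-(2 * (n : ℤ))) / k ^ 4] (q ^ 2) (a ^ 2 / (k ^ 2 * q)) := by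
  have hp1 : q ^ (-(2 * (n : ℤ))) = (q ^ 2) ^ (-(n : ℤ)) := by
    rw [← zpow_natCast q 2, ← zpow_mul]; congr 1; push_cast; ring
  have hp2 : q ^ (2 - 2 * (n : ℤ)) = (q ^ 2) ^ (1 - (n : ℤ)) := by
    rw [← zpow_natCast q 2, ← zpow_mul]; congr 1; push_cast; ring
  have hp3 : q ^ (2 + 2 * n) = (q ^ 2) ^ (n + 1) := by rw [← pow_mul]; congr 1; ring
  have hp4 : q ^ (2 * n) = (q ^ 2) ^ n := pow_mul q 2 n
  rw [hp1, hp2, hp3, hp4]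
  have hz : ∀ j, n < j → qPoch ((q ^ 2) ^ (-(n : ℤ))) (q ^ 2) j = 0 := fun j =>
    qPoch_neg_pow_eq_zero (pow_ne_zero 2 hq0)
  rw [basicHyp_eq_sum n rfl (fun j hj => qPochs_eq_zero (by simp) (hz j hj))]
  have f1 : (a / (k * q)) ^ 2 = a ^ 2 / (k ^ 2 * q ^ 2) := by ring
  have f2 : a * (a / (k * q)) ^ 2 = a ^ 3 / (q ^ 2 * k ^ 2) := by ring
  have f3 : a ^ 2 * (a / (k * q)) ^ 4 = a ^ 6 / (k ^ 4 * q ^ 4) := by ring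
  have hpair := fun n => bressoudI_pair (a := a) (b := a / (k * q)) hq0
    (div_ne_zero ha0 (mul_ne_zero hk0 hq0)) hg.base_ne hg.base_sq_ne
    (hg.one_sub_ne_sq hq0 4 0 4 (by field_simp) (by simp))
    (by simpa using hg.one_sub_ne (x := a) hq0 2 0 0 (by simp [zpow_ofNat]) (by simp) 0)
    (hg.base_sq_sub_ne hq0 4 (-4) (-4) (by field_simp) (by simp))
    (hg.one_sub_ne hq0 6 (-4) (-4) (by field_simp) (by simp))
    (hg.one_sub_ne hq0 2 0 2 (by field_simp) (by simp))
    (hg.one_sub_ne_sq hq0 12 (-8) (-8) (by field_simp) (by simp)) n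
  simp only [f2, f3] at hpair
  simp only [f1] at hpair
  -- The chain is applied to `a ^ 2, k ^ 2, q ^ 2`, so its parameter `c` is `(a / (k * q)) ^ 2`, in
  -- agreement with the pair taken at `b = a / (k * q)`.
  have key := transformation_of_pair_of_mulIndep hg.sq (pow_ne_zero 2 hq0) (pow_ne_zero 2 ha0)
    (pow_ne_zero 2 hk0) _ _ hpair n
  convert key using 1
  · refine Finset.sum_congr rfl fun j _ => ?_
    have wA := hg.very_well_poised_ratio hq0 1 0 0 hsa (by simp) (by simp) j
    have e1 := qPoch_four (a ^ 2 / k) q j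
    have e2 := qPoch_four (k * q) q j
    rw [div_pow, show a ^ 2 / k * q = a ^ 2 * q / k by ring] at e1
    rw [mul_pow, show k * q * q = k * q ^ 2 by ring] at e2
    have e3 : (k ^ 2 * (q ^ 2) ^ 2 / a ^ 2) ^ j * (a ^ 2 / (k ^ 2 * q ^ 2) / q) ^ j = q ^ j := by
      rw [← mul_pow]; congr 1; field_simp
    have e4 : q / (a ^ 2 / (k ^ 2 * q ^ 2)) = k ^ 2 * q ^ 3 / a ^ 2 := by field_simp
    rw [wA, e1, e2, ← e3, e4]
    simp only [qPochs, List.map_cons, List.map_nil, List.prod_cons, List.prod_nil, mul_one]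
    ring
  · congr 1
    refine Finset.sum_congr rfl fun j _ => ?_
    have wS := very_well_poised_ratio
      (hg.one_sub_ne_sq (x := a ^ 2 / (k * q)) hq0 4 (-2) (-2) (by field_simp) (by simp))
      (hg.one_sub_ne_sq hq0 4 (-2) (-2) (by field_simp) (by simp)) j
    rw [show (a ^ 2 / (k * q)) ^ 2 = a ^ 4 / (k ^ 2 * q ^ 2) by ring] at wS
    have e1 := qPoch_two_mul (-(a ^ 3 / (q ^ 2 * k ^ 2))) q j
    have e2 := qPoch_two_mul (-(a * q)) q j
    rw [show -(a ^ 3 / (q ^ 2 * k ^ 2)) * q = -(a ^ 3 / (k ^ 2 * q)) by field_simp,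
      mul_comm (q ^ 2) (k ^ 2)] at e1
    rw [show -(a * q) * q = -(a * q ^ 2) by ring] at e2
    have e3 : (a ^ 2 / (k ^ 2 * q)) ^ j = (q ^ 2) ^ j * (a ^ 2 / (k ^ 2 * q ^ 2) / q) ^ j := by
      rw [← mul_pow]; congr 1; field_simp
    have e4 : q ^ 2 / (a ^ 2 / (k ^ 2 * q ^ 2)) = k ^ 2 * q ^ 4 / a ^ 2 := by field_simp
    have e5 : a ^ 2 * q ^ 2 / (k * q) = q ^ 2 * (a ^ 2 / (k * q)) := by ring
    have e6 : (a ^ 2) ^ 2 / (k ^ 2 * q ^ 2) = a ^ 4 / (k ^ 2 * q ^ 2) := by ring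
    have e7 : a ^ 2 * (a ^ 2 / (k ^ 2 * q ^ 2)) = a ^ 4 / (k ^ 2 * q ^ 2) := by ring
    have e8 : (a ^ 2) ^ 2 * (q ^ 2) ^ (-(n : ℤ)) / (k ^ 2) ^ 2 =
      a ^ 4 * (q ^ 2) ^ (-(n : ℤ)) / k ^ 4 := by ring
    rw [e6, wS, e3, e4, e5, e7, e8, mul_comm (q ^ 2) (k ^ 2), e1, e2]
    simp only [qPochs, List.map_cons, List.map_nil, List.prod_cons, List.prod_nil, mul_one]
    ring

theorem transformation_bressoudII_generic {a k q : ℂ} (hg : MulIndep a k q)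
    (ha0 : a ≠ 0) (hk0 : k ≠ 0) (hq0 : q ≠ 0) (n : ℕ) :
    ∑ j ∈ Finset.range (n + 1),
      qPochs [a, k ^ 2 * q ^ 2 / a ^ 2] q j / qPochs [a ^ 3 / (q * k ^ 2), q] q j *
      (qPochs [a * q ^ 2, -(a * q ^ 2), a ^ 2 / k, -(a ^ 2 / k), a ^ 2 * q / k,
          -(a ^ 2 * q / k), k ^ 2 * q ^ (2 * n), q ^ (-(2 * (n : ℤ)))] (q ^ 2) j * q ^ j /
        qPochs [a, -a, k * q, -(k * q), k * q ^ 2, -(k * q ^ 2),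
          a ^ 2 * q ^ (2 - 2 * (n : ℤ)) / k ^ 2, a ^ 2 * q ^ (2 + 2 * n)] (q ^ 2) j)
    = chainPrefactor (a ^ 2) (k ^ 2) (q ^ 2) n *
      basicHyp
        [a ^ 2 * q / k, -(a ^ 2 * q / k), a ^ 4 / (k ^ 2 * q ^ 2),
          -(a ^ 3 / (k ^ 2 * q)), -(a ^ 3 / k ^ 2), k ^ 2 * q ^ 2 / a ^ 2,
          q ^ (-(2 * (n : ℤ)))]
        [a ^ 2 / (k * q), -(a ^ 2 / (k * q)), -a, -(a * q), a ^ 6 / (k ^ 4 * q ^ 2),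
          a ^ 4 * q ^ (-(2 * (n : ℤ))) / k ^ 4] (q ^ 2) (a ^ 2 / (k ^ 2 * q)) := by
  have hp1 : q ^ (-(2 * (n : ℤ))) = (q ^ 2) ^ (-(n : ℤ)) := by
    rw [← zpow_natCast q 2, ← zpow_mul]; congr 1; push_cast; ring
  have hp2 : q ^ (2 - 2 * (n : ℤ)) = (q ^ 2) ^ (1 - (n : ℤ)) := by
    rw [← zpow_natCast q 2, ← zpow_mul]; congr 1; push_cast; ring
  have hp3 : q ^ (2 + 2 * n) = (q ^ 2) ^ (n + 1) := by rw [← pow_mul]; congr 1; ring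
  have hp4 : q ^ (2 * n) = (q ^ 2) ^ n := pow_mul q 2 n
  rw [hp1, hp2, hp3, hp4]
  have hz : ∀ j, n < j → qPoch ((q ^ 2) ^ (-(n : ℤ))) (q ^ 2) j = 0 := fun j =>
    qPoch_neg_pow_eq_zero (pow_ne_zero 2 hq0)
  rw [basicHyp_eq_sum n rfl (fun j hj => qPochs_eq_zero (by simp) (hz j hj))]
  have f1 : (a / (k * q)) ^ 2 = a ^ 2 / (k ^ 2 * q ^ 2) := by ring
  have f2 : a * (a / (k * q)) ^ 2 * q = a ^ 3 / (q * k ^ 2) := by field_simp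
  have f3 : a ^ 2 * (a / (k * q)) ^ 4 * q ^ 2 = a ^ 6 / (k ^ 4 * q ^ 2) := by field_simp
  have hpair := fun n => bressoudII_pair (a := a) (b := a / (k * q)) hq0
    (div_ne_zero ha0 (mul_ne_zero hk0 hq0))
    (by
      simpa using hg.one_sub_ne (x := (a / (k * q)) ^ 2) hq0 4 (-4) (-4)
        (by field_simp) (by simp) 0) hg.base_ne hg.base_sq_ne
    (hg.one_sub_ne_sq hq0 4 0 4 (by field_simp) (by simp))
    (by simpa using hg.one_sub_ne (x := a ^ 2) hq0 4 0 0 (by field_simp) (by simp) 0)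
    (hg.base_sq_sub_ne hq0 4 (-4) (-4) (by field_simp) (by simp))
    (hg.one_sub_ne hq0 6 (-4) (-2) (by field_simp) (by simp))
    (hg.one_sub_ne hq0 2 0 0 (by field_simp) (by simp))
    (hg.one_sub_ne_sq hq0 12 (-8) (-4) (by field_simp) (by simp)) n
  simp only [f2, f3] at hpair
  simp only [f1] at hpair
  have key := transformation_of_pair_of_mulIndep hg.sq (pow_ne_zero 2 hq0) (pow_ne_zero 2 ha0)
    (pow_ne_zero 2 hk0) _ _ hpair n
  convert key using 1
  · refine Finset.sum_congr rfl fun j _ => ?_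
    have wA := very_well_poised_ratio
      (hg.one_sub_ne_sq (x := a) hq0 2 0 0 (by field_simp) (by simp))
      (hg.one_sub_ne_sq hq0 2 0 0 (by field_simp) (by simp)) j
    rw [← pow_mul q, show 2 * (2 * j) = 4 * j by ring, mul_comm (q ^ 2) a] at wA
    have e1 := qPoch_four (a ^ 2 / k) q j
    have e2 := qPoch_four (k * q) q j
    rw [div_pow, show a ^ 2 / k * q = a ^ 2 * q / k by ring] at e1
    rw [mul_pow, show k * q * q = k * q ^ 2 by ring] at e2
    have e3 : (k ^ 2 * (q ^ 2) ^ 2 / a ^ 2) ^ j * (a ^ 2 / (k ^ 2 * q ^ 2) / q) ^ j = q ^ j := by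
      rw [← mul_pow]; congr 1; field_simp
    have e4 : 1 / (a ^ 2 / (k ^ 2 * q ^ 2)) = k ^ 2 * q ^ 2 / a ^ 2 := by field_simp
    rw [wA, e1, e2, ← e3, e4]
    simp only [qPochs, List.map_cons, List.map_nil, List.prod_cons, List.prod_nil, mul_one]
    ring
  · congr 1
    refine Finset.sum_congr rfl fun j _ => ?_
    have wS := very_well_poised_ratio
      (hg.one_sub_ne_sq (x := a ^ 2 / (k * q)) hq0 4 (-2) (-2) (by field_simp) (by simp))
      (hg.one_sub_ne_sq hq0 4 (-2) (-2) (by field_simp) (by simp)) j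
    rw [show (a ^ 2 / (k * q)) ^ 2 = a ^ 4 / (k ^ 2 * q ^ 2) by ring,
      show q ^ 2 * (a ^ 2 / (k * q)) = a ^ 2 * q / k by field_simp] at wS
    have e1 := qPoch_two_mul (-(a ^ 3 / (q * k ^ 2))) q j
    have e2 := qPoch_two_mul (-a) q j
    rw [show -(a ^ 3 / (q * k ^ 2)) * q = -(a ^ 3 / k ^ 2) by field_simp,
      mul_comm q (k ^ 2)] at e1
    rw [neg_mul a q] at e2
    have e3 : (a ^ 2 / (k ^ 2 * q)) ^ j = (q ^ 2) ^ j * (a ^ 2 / (k ^ 2 * q ^ 2) / q) ^ j := by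
      rw [← mul_pow]; congr 1; field_simp
    have e4 : 1 / (a ^ 2 / (k ^ 2 * q ^ 2)) = k ^ 2 * q ^ 2 / a ^ 2 := by field_simp
    have e6 : (a ^ 2) ^ 2 / (k ^ 2 * q ^ 2) = a ^ 4 / (k ^ 2 * q ^ 2) := by ring
    have e7 : a ^ 2 * (a ^ 2 / (k ^ 2 * q ^ 2)) = a ^ 4 / (k ^ 2 * q ^ 2) := by ring
    have e8 : (a ^ 2) ^ 2 * (q ^ 2) ^ (-(n : ℤ)) / (k ^ 2) ^ 2 =
      a ^ 4 * (q ^ 2) ^ (-(n : ℤ)) / k ^ 4 := by ring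
    rw [e6, wS, e3, e4, e7, e8, mul_comm q (k ^ 2), e1, e2]
    simp only [qPochs, List.map_cons, List.map_nil, List.prod_cons, List.prod_nil, mul_one]
    ring

/-! ### Density of generic parameters -/

/-- The value `c` has only countably many logarithms, and the polynomial `i z + j z² + m z³`, being
nonconstant, takes each of them at finitely many points. -/
theorem countable_exp_polynomial_eq (c : ℂ) {i j m : ℂ} (h : i ≠ 0 ∨ j ≠ 0 ∨ m ≠ 0) :
    {z : ℂ | Complex.exp (i * z + j * z ^ 2 + m * z ^ 3) = c}.Countable := by
  have hsub : {z : ℂ | Complex.exp (i * z + j * z ^ 2 + m * z ^ 3) = c} ⊆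
      ⋃ w ∈ Complex.exp ⁻¹' {c}, {z : ℂ | Polynomial.IsRoot (Polynomial.C i * Polynomial.X +
        Polynomial.C j * Polynomial.X ^ 2 + Polynomial.C m * Polynomial.X ^ 3 -
          Polynomial.C w) z} := by
    intro z hz
    refine Set.mem_iUnion₂.2 ⟨i * z + j * z ^ 2 + m * z ^ 3, hz, ?_⟩
    simp
  refine Set.Countable.mono hsub (Set.Countable.biUnion ?_ fun w _ => Set.Finite.countable ?_)
  · exact Complex.countable_preimage_exp.2 (Set.countable_singleton c)
  · refine Polynomial.finite_setOfPred_isRoot fun h0 => ?_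
    have h1 := congrArg (Polynomial.coeff · 1) h0
    have h2 := congrArg (Polynomial.coeff · 2) h0
    have h3 := congrArg (Polynomial.coeff · 3) h0
    simp [Polynomial.coeff_C, Polynomial.coeff_X_pow] at h1 h2 h3
    simp_all

open Filter Topology in
/-- Multiplicatively independent triples of squares accumulate at every point with nonzero
coordinates. -/
theorem frequently_mulIndep {x y w : ℂ} (hx : x ≠ 0) (hy : y ≠ 0) (hw : w ≠ 0) :
    ∃ᶠ p : ℂ × ℂ × ℂ in 𝓝 (x, y, w), p.1 ≠ 0 ∧ p.2.1 ≠ 0 ∧ p.2.2 ≠ 0 ∧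
      MulIndep (p.1 ^ 2) (p.2.1 ^ 2) (p.2.2 ^ 2) := by
  -- Along this curve through `(x, y, w)` the exponents `z, z², z³` are linearly independent, so a
  -- fixed nontrivial monomial relation holds for only countably many `z`. There are countably many
  -- relations, and the complement of a countable set is dense in `ℂ`.
  have hlim : Tendsto (fun z : ℂ => (x * Complex.exp z, y * Complex.exp (z ^ 2),
      w * Complex.exp (z ^ 3))) (𝓝 0) (𝓝 (x, y, w)) := by
    have : ContinuousAt (fun z : ℂ => (x * Complex.exp z, y * Complex.exp (z ^ 2),
      w * Complex.exp (z ^ 3))) 0 := by fun_prop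
    simpa [ContinuousAt] using this
  refine hlim.frequently ?_
  have hB : {z : ℂ | ¬ MulIndep ((x * Complex.exp z) ^ 2) ((y * Complex.exp (z ^ 2)) ^ 2)
      ((w * Complex.exp (z ^ 3)) ^ 2)}.Countable := by
    have hsub : {z : ℂ | ¬ MulIndep ((x * Complex.exp z) ^ 2) ((y * Complex.exp (z ^ 2)) ^ 2)
        ((w * Complex.exp (z ^ 3)) ^ 2)} ⊆ ⋃ e ∈ {e : ℤ × ℤ × ℤ | e ≠ 0},
        {z : ℂ | Complex.exp ((2 * e.1) * z + (2 * e.2.1) * z ^ 2 + (2 * e.2.2) * z ^ 3) =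
          ((x ^ 2) ^ e.1 * (y ^ 2) ^ e.2.1 * (w ^ 2) ^ e.2.2)⁻¹} := by
      intro z hz
      simp only [MulIndep, Set.mem_ofPred_eq, not_forall] at hz
      obtain ⟨i, j, m, h1, h2⟩ := hz
      refine Set.mem_iUnion₂.2 ⟨(i, j, m), fun h => h2 (by simpa using h), ?_⟩
      refine eq_inv_of_mul_eq_one_left ?_
      rw [← h1]
      simp only [mul_pow, mul_zpow, ← Complex.exp_nat_mul, ← Complex.exp_int_mul, Complex.exp_add]
      rw [show (i : ℂ) * ((2 : ℕ) * z) = 2 * i * z by push_cast; ring,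
        show (j : ℂ) * ((2 : ℕ) * z ^ 2) = 2 * j * z ^ 2 by push_cast; ring,
        show (m : ℂ) * ((2 : ℕ) * z ^ 3) = 2 * m * z ^ 3 by push_cast; ring]
      ring
    refine Set.Countable.mono hsub (Set.Countable.biUnion (Set.to_countable _) fun e he =>
      countable_exp_polynomial_eq _ ?_)
    by_contra! h
    apply he
    obtain ⟨e1, e2, e3⟩ := e
    simpa using h
  have hd := mem_closure_iff_frequently.1 (hB.dense_compl ℂ (0 : ℂ))
  refine hd.mono fun z hz => ⟨?_, ?_, ?_, not_not.1 hz⟩ <;>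
    simp [hx, hy, hw, Complex.exp_ne_zero]

open Filter Topology in
-- Identity theorem by density: limits along independent triples determine both sides. The
-- coordinates are the square roots, in which all entries of the identities are single-valued.
theorem eq_of_forall_mulIndep {F G : ℂ → ℂ → ℂ → ℂ} {x y w : ℂ}
    (h : ∀ x y w, x ≠ 0 → y ≠ 0 → w ≠ 0 → MulIndep (x ^ 2) (y ^ 2) (w ^ 2) → F x y w = G x y w)
    (hx : x ≠ 0) (hy : y ≠ 0) (hw : w ≠ 0)
    (hF : ContinuousAt (fun p : ℂ × ℂ × ℂ => F p.1 p.2.1 p.2.2) (x, y, w))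
    (hG : ContinuousAt (fun p : ℂ × ℂ × ℂ => G p.1 p.2.1 p.2.2) (x, y, w)) :
    F x y w = G x y w :=
  tendsto_nhds_unique_of_frequently_eq hF hG ((frequently_mulIndep hx hy hw).mono
    fun _ hp => h _ _ _ hp.1 hp.2.1 hp.2.2.1 hp.2.2.2)

/-! ### Continuity of both sides -/

section Continuity

variable {X : Type*} [TopologicalSpace X] {x : X}

@[fun_prop]
theorem ContinuousAt.qPoch {b q : X → ℂ} (hb : ContinuousAt b x) (hq : ContinuousAt q x) (n : ℕ) :
    ContinuousAt (fun x => qPoch (b x) (q x) n) x := by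
  unfold _root_.qPoch
  exact tendsto_finsetProd _ fun i _ => ContinuousAt.sub continuousAt_const (hb.mul (hq.pow i))

/-- The series terminates at the same `N` throughout a neighbourhood, so continuity is that of a
finite sum; only the denominators with `j ≤ N` at the point itself have to be nonzero. -/
theorem continuousAt_basicHyp {as bs : X → List ℂ} {q z : X → ℂ} (N : ℕ)
    (hlen : ∀ x, (as x).length = (bs x).length + 1)
    (hterm : ∀ᶠ x in nhds x, ∀ j, N < j → qPochs (as x) (q x) j = 0)
    (hz : ContinuousAt z x)
    (hne : ∀ j ≤ N, qPochs (q x :: bs x) (q x) j ≠ 0)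
    (has : ∀ j, ContinuousAt (fun x => qPochs (as x) (q x) j) x)
    (hbs : ∀ j, ContinuousAt (fun x => qPochs (q x :: bs x) (q x) j) x) :
    ContinuousAt (fun x => basicHyp (as x) (bs x) (q x) (z x)) x := by
  have hsum : ContinuousAt (fun x => ∑ j ∈ range (N + 1), qPochs (as x) (q x) j /
      qPochs (q x :: bs x) (q x) j * z x ^ j) x :=
    tendsto_finsetSum _ fun j hj => ((has j).div (hbs j)
      (hne j (by have := Finset.mem_range.1 hj; omega))).mul (hz.pow j)
  refine hsum.congr ?_
  filter_upwards [hterm] with y hy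
  exact (basicHyp_eq_sum N (hlen y) hy).symm

end Continuity

/-- Since `(b; q)_j` divides `(b; q)_n` for `j ≤ n`, nonvanishing at `n` alone controls every term.
-/
theorem DenomsNonzero.qPochs_ne {bs l : List ℂ} {q : ℂ} {n j : ℕ} (h : DenomsNonzero bs q n)
    (hl : ∀ b ∈ l, b ∈ q :: bs) (hj : j ≤ n) : qPochs l q j ≠ 0 := by
  rw [qPochs, Ne, List.prod_eq_zero_iff, List.mem_map]
  rintro ⟨b, hb, h0⟩
  refine h b (hl b hb) ?_
  rw [← Nat.add_sub_of_le hj, qPoch_add, h0, zero_mul]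

theorem eventually_base_ne_zero {x y w : ℂ} (hw : w ≠ 0) :
    ∀ᶠ p : ℂ × ℂ × ℂ in nhds (x, y, w), p.2.2 ^ 2 ≠ 0 := by
  have : ContinuousAt (fun p : ℂ × ℂ × ℂ => p.2.2 ^ 2) (x, y, w) := by fun_prop
  exact this.eventually_ne (pow_ne_zero 2 hw)

theorem qPoch_base_sq_eq_zero {q : ℂ} (hq : q ≠ 0) {n j : ℕ} (hj : n < j) :
    qPoch (q ^ (-(2 * (n : ℤ)))) (q ^ 2) j = 0 := by
  have : q ^ (-(2 * (n : ℤ))) = (q ^ 2) ^ (-(n : ℤ)) := by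
    rw [← zpow_natCast q 2, ← zpow_mul]; congr 1; push_cast; ring
  rw [this]
  exact qPoch_neg_pow_eq_zero (pow_ne_zero 2 hq) hj

theorem qPoch_mul_qPoch_eq_zero {q : ℂ} (hq : q ≠ 0) {n j : ℕ} (hj : n / 2 < j) :
    qPoch (q ^ (-(n : ℤ))) (q ^ 2) j * qPoch (q ^ (1 - (n : ℤ))) (q ^ 2) j = 0 := by
  rw [show (1 - (n : ℤ)) = -(n : ℤ) + 1 by ring, zpow_add_one₀ hq, ← qPoch_two_mul]
  exact qPoch_neg_pow_eq_zero hq (by omega)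

theorem continuousAt_chainPrefactor_sq {x y w : ℂ} (hx : x ≠ 0) (n : ℕ)
    (h : 1 - y ^ 2 * (w ^ 2) ^ (2 * n) ≠ 0) (h' : qPochs [y ^ 2, y ^ 2 / x ^ 2] (w ^ 2) n ≠ 0) :
    ContinuousAt (fun p : ℂ × ℂ × ℂ => chainPrefactor (p.1 ^ 2) (p.2.1 ^ 2) (p.2.2 ^ 2) n)
      (x, y, w) := by
  have h₁ : ContinuousAt (fun p : ℂ × ℂ × ℂ => (1 - p.2.1 ^ 2) /
      (1 - p.2.1 ^ 2 * (p.2.2 ^ 2) ^ (2 * n))) (x, y, w) := by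
    fun_prop (disch := exact h)
  have h₂ : ContinuousAt (fun p : ℂ × ℂ × ℂ => qPochs [p.1 ^ 2 * p.2.2 ^ 2,
      (p.2.1 ^ 2) ^ 2 * p.2.2 ^ 2 / (p.1 ^ 2) ^ 2] (p.2.2 ^ 2) n) (x, y, w) := by
    simp only [qPochs, List.map_cons, List.map_nil, List.prod_cons, List.prod_nil, mul_one]
    fun_prop (disch := simp [hx])
  have h₃ : ContinuousAt (fun p : ℂ × ℂ × ℂ => qPochs [p.2.1 ^ 2, p.2.1 ^ 2 / p.1 ^ 2]
      (p.2.2 ^ 2) n) (x, y, w) := by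
    simp only [qPochs, List.map_cons, List.map_nil, List.prod_cons, List.prod_nil, mul_one]
    fun_prop (disch := simp [hx])
  exact h₁.mul (h₂.div h₃ h')

theorem continuousAt_chainPrefactor_sq_sq {x y w : ℂ} (hx : x ≠ 0) (n : ℕ)
    (h : 1 - (y ^ 2) ^ 2 * ((w ^ 2) ^ 2) ^ (2 * n) ≠ 0)
    (h' : qPochs [(y ^ 2) ^ 2, (y ^ 2) ^ 2 / (x ^ 2) ^ 2] ((w ^ 2) ^ 2) n ≠ 0) :
    ContinuousAt (fun p : ℂ × ℂ × ℂ =>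
      chainPrefactor ((p.1 ^ 2) ^ 2) ((p.2.1 ^ 2) ^ 2) ((p.2.2 ^ 2) ^ 2) n) (x, y, w) := by
  have hc : ContinuousAt (fun p : ℂ × ℂ × ℂ => (p.1 ^ 2, p.2.1 ^ 2, p.2.2 ^ 2)) (x, y, w) := by
    fun_prop
  exact ContinuousAt.comp (f := fun p : ℂ × ℂ × ℂ => (p.1 ^ 2, p.2.1 ^ 2, p.2.2 ^ 2))
    (continuousAt_chainPrefactor_sq (pow_ne_zero 2 hx) n h h') hc

/-! ### Passage to all admissible parameters -/

theorem transformation_10phi9_4phi3 {sa sk sq : ℂ} (hsa : sa ≠ 0) (hsk : sk ≠ 0) (hsq : sq ≠ 0)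
    (n : ℕ) : Transformation_10phi9_4phi3 (sa ^ 2) (sk ^ 2) (sq ^ 2) sa sk sq n := by
  intro h1 h2
  refine eq_of_forall_mulIndep (fun sa sk sq ha hk hq hg =>
    transformation_10phi9_4phi3_generic hg (pow_ne_zero 2 ha) (pow_ne_zero 2 hk)
      (pow_ne_zero 2 hq) rfl rfl rfl n) hsa hsk hsq ?_ (ContinuousAt.mul ?_ ?_)
  · refine continuousAt_basicHyp n (fun _ => rfl) ?_ (by fun_prop (disch := simp [hsk, hsq]))
      (fun j hj => h2.qPochs_ne ?_ hj) (fun j => ?_) (fun j => ?_)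
    · filter_upwards [eventually_base_ne_zero hsq] with p hp j hj
      exact qPochs_eq_zero (by simp) (qPoch_neg_pow_eq_zero hp hj)
    · simp only [List.mem_cons, List.not_mem_nil, or_false]; tauto
    · simp only [qPochs, List.map_cons, List.map_nil, List.prod_cons, List.prod_nil, mul_one]
      fun_prop (disch := simp [hsk, hsq])
    · simp only [qPochs, List.map_cons, List.map_nil, List.prod_cons, List.prod_nil, mul_one]
      fun_prop (disch := simp [hsk, hsq])
  · exact continuousAt_chainPrefactor_sq hsa n h1 (h2.qPochs_ne
      (by simp only [List.mem_cons, List.not_mem_nil, or_false]; tauto) le_rfl)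
  · refine continuousAt_basicHyp n (fun _ => rfl) ?_ (by fun_prop (disch := simp [hsk, hsq]))
      (fun j hj => h2.qPochs_ne ?_ hj) (fun j => ?_) (fun j => ?_)
    · filter_upwards [eventually_base_ne_zero hsq] with p hp j hj
      exact qPochs_eq_zero (by simp) (qPoch_neg_pow_eq_zero hp hj)
    · simp only [List.mem_cons, List.not_mem_nil, or_false]; tauto
    · simp only [qPochs, List.map_cons, List.map_nil, List.prod_cons, List.prod_nil, mul_one]
      fun_prop (disch := simp [hsk, hsq])
    · simp only [qPochs, List.map_cons, List.map_nil, List.prod_cons, List.prod_nil, mul_one]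
      fun_prop (disch := simp [hsk, hsq])

theorem transformation_8phi7_5phi4 {sa sk sq : ℂ} (hsa : sa ≠ 0) (hsk : sk ≠ 0) (hsq : sq ≠ 0)
    (n : ℕ) : Transformation_8phi7_5phi4 (sa ^ 2) (sk ^ 2) (sq ^ 2) sa sk sq n := by
  intro h1 h2
  refine eq_of_forall_mulIndep (fun sa sk sq ha hk hq hg =>
    transformation_8phi7_5phi4_generic hg (pow_ne_zero 2 ha) (pow_ne_zero 2 hk)
      (pow_ne_zero 2 hq) rfl rfl rfl n) hsa hsk hsq ?_ (ContinuousAt.mul ?_ ?_)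
  · refine continuousAt_basicHyp n (fun _ => rfl) ?_ (by fun_prop (disch := simp [hsk, hsq]))
      (fun j hj => h2.qPochs_ne ?_ hj) (fun j => ?_) (fun j => ?_)
    · filter_upwards [eventually_base_ne_zero hsq] with p hp j hj
      exact qPochs_eq_zero (by simp) (qPoch_neg_pow_eq_zero hp hj)
    · simp only [List.mem_cons, List.not_mem_nil, or_false]; tauto
    · simp only [qPochs, List.map_cons, List.map_nil, List.prod_cons, List.prod_nil, mul_one]
      fun_prop (disch := simp [hsk, hsq])
    · simp only [qPochs, List.map_cons, List.map_nil, List.prod_cons, List.prod_nil, mul_one]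
      fun_prop (disch := simp [hsk, hsq])
  · exact continuousAt_chainPrefactor_sq hsa n h1 (h2.qPochs_ne
      (by simp only [List.mem_cons, List.not_mem_nil, or_false]; tauto) le_rfl)
  · refine continuousAt_basicHyp n (fun _ => rfl) ?_ (by fun_prop (disch := simp [hsk, hsq]))
      (fun j hj => h2.qPochs_ne ?_ hj) (fun j => ?_) (fun j => ?_)
    · filter_upwards [eventually_base_ne_zero hsq] with p hp j hj
      exact qPochs_eq_zero (by simp) (qPoch_neg_pow_eq_zero hp hj)
    · simp only [List.mem_cons, List.not_mem_nil, or_false]; tauto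
    · simp only [qPochs, List.map_cons, List.map_nil, List.prod_cons, List.prod_nil, mul_one]
      fun_prop (disch := simp [hsk, hsq])
    · simp only [qPochs, List.map_cons, List.map_nil, List.prod_cons, List.prod_nil, mul_one]
      fun_prop (disch := simp [hsk, hsq])

theorem transformation_16W15_7phi6 {sa sk sq : ℂ} (hsa : sa ≠ 0) (hsk : sk ≠ 0) (hsq : sq ≠ 0)
    (n : ℕ) : Transformation_16W15_7phi6 (sa ^ 2) (sk ^ 2) (sq ^ 2) sa sk sq n := by
  intro h1 h2 h3
  refine eq_of_forall_mulIndep (fun sa sk sq ha hk hq hg =>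
    transformation_16W15_7phi6_generic hg (pow_ne_zero 2 ha) (pow_ne_zero 2 hk)
      (pow_ne_zero 2 hq) rfl rfl rfl n) hsa hsk hsq ?_ (ContinuousAt.mul ?_ ?_)
  · refine continuousAt_basicHyp (n / 2) (fun _ => rfl) ?_ (by fun_prop (disch := simp [hsa, hsk, hsq, zpow_ne_zero]))
      (fun j hj => h2.qPochs_ne ?_ hj) (fun j => ?_) (fun j => ?_)
    · filter_upwards [eventually_base_ne_zero hsq] with p hp j hj
      simp only [qPochs, List.map_cons, List.map_nil, List.prod_cons, List.prod_nil, mul_one]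
      -- In base `q ^ 2` the vanishing factor sits in the symbol of `q ^ (-n)` or of `q ^ (1 - n)`
      -- according to the parity of `n`; only the product of the two is sure to vanish beyond `n /
      -- 2`.
      rw [qPoch_mul_qPoch_eq_zero hp hj]; ring
    · simp only [List.cons_append, List.nil_append, List.map_cons, List.map_nil, List.mem_cons,
        List.not_mem_nil, or_false]; tauto
    · simp only [qPochs, List.map_cons, List.map_nil, List.prod_cons, List.prod_nil, mul_one]
      fun_prop (disch := simp [hsa, hsq])
    · simp only [qPochs, List.map_cons, List.map_nil, List.prod_cons, List.prod_nil, mul_one]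
      fun_prop (disch := simp [hsa, hsk, hsq, zpow_ne_zero])
  · exact continuousAt_chainPrefactor_sq hsa n h1 (h3.qPochs_ne
      (by simp only [List.mem_cons, List.not_mem_nil, or_false]; tauto) le_rfl)
  · refine continuousAt_basicHyp n (fun _ => rfl) ?_ (by fun_prop (disch := simp [hsk]))
      (fun j hj => h3.qPochs_ne ?_ hj) (fun j => ?_) (fun j => ?_)
    · filter_upwards [eventually_base_ne_zero hsq] with p hp j hj
      exact qPochs_eq_zero (by simp) (qPoch_neg_pow_eq_zero hp hj)
    · simp only [List.mem_cons, List.not_mem_nil, or_false]; tauto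
    · simp only [qPochs, List.map_cons, List.map_nil, List.prod_cons, List.prod_nil, mul_one]
      fun_prop (disch := simp [hsa, hsk, hsq])
    · simp only [qPochs, List.map_cons, List.map_nil, List.prod_cons, List.prod_nil, mul_one]
      fun_prop (disch := simp [hsk, hsq])

theorem transformation_bressoudI {sa sk sq : ℂ} (hsa : sa ≠ 0) (hsk : sk ≠ 0) (hsq : sq ≠ 0)
    (n : ℕ) : Transformation_BressoudI_7phi6 (sa ^ 2) (sk ^ 2) (sq ^ 2) sa n := by
  intro h1 h2 h3
  refine eq_of_forall_mulIndep (fun sa sk sq ha hk hq hg =>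
    transformation_bressoudI_generic hg (pow_ne_zero 2 ha) (pow_ne_zero 2 hk)
      (pow_ne_zero 2 hq) rfl n) hsa hsk hsq ?_ (ContinuousAt.mul ?_ ?_)
  · refine tendsto_finsetSum _ fun j hj => ContinuousAt.mul (ContinuousAt.div ?_ ?_
      (h2.qPochs_ne ?_ (by have := Finset.mem_range.1 hj; omega))) (ContinuousAt.div ?_ ?_
        (h3.qPochs_ne ?_ (by have := Finset.mem_range.1 hj; omega)))
    · simp only [qPochs, List.map_cons, List.map_nil, List.prod_cons, List.prod_nil, mul_one]
      fun_prop (disch := simp [hsa])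
    · simp only [qPochs, List.map_cons, List.map_nil, List.prod_cons, List.prod_nil, mul_one]
      fun_prop (disch := simp [hsk, hsq])
    · simp only [List.mem_cons, List.not_mem_nil, or_false]; tauto
    · simp only [qPochs, List.map_cons, List.map_nil, List.prod_cons, List.prod_nil, mul_one]
      fun_prop (disch := simp [hsk, hsq])
    · simp only [qPochs, List.map_cons, List.map_nil, List.prod_cons, List.prod_nil, mul_one]
      fun_prop (disch := simp [hsk, hsq])
    · simp only [List.mem_cons, List.not_mem_nil, or_false]; tauto
  · refine continuousAt_chainPrefactor_sq_sq hsa n ?_ (h3.qPochs_ne ?_ le_rfl)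
    · rwa [← pow_mul (sq ^ 2), show 2 * (2 * n) = 4 * n by ring]
    · simp only [List.mem_cons, List.not_mem_nil, or_false]; tauto
  · refine continuousAt_basicHyp n (fun _ => rfl) ?_ (by fun_prop (disch := simp [hsk, hsq]))
      (fun j hj => h3.qPochs_ne ?_ hj) (fun j => ?_) (fun j => ?_)
    · filter_upwards [eventually_base_ne_zero hsq] with p hp j hj
      exact qPochs_eq_zero (by simp) (qPoch_base_sq_eq_zero hp hj)
    · simp only [List.mem_cons, List.not_mem_nil, or_false]; tauto
    · simp only [qPochs, List.map_cons, List.map_nil, List.prod_cons, List.prod_nil, mul_one]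
      fun_prop (disch := simp [hsa, hsk, hsq])
    · simp only [qPochs, List.map_cons, List.map_nil, List.prod_cons, List.prod_nil, mul_one]
      fun_prop (disch := simp [hsk, hsq])

theorem transformation_bressoudII {sa sk sq : ℂ} (hsa : sa ≠ 0) (hsk : sk ≠ 0) (hsq : sq ≠ 0)
    (n : ℕ) : Transformation_BressoudII_7phi6 (sa ^ 2) (sk ^ 2) (sq ^ 2) n := by
  intro h1 h2 h3
  refine eq_of_forall_mulIndep (fun sa sk sq ha hk hq hg =>
    transformation_bressoudII_generic hg (pow_ne_zero 2 ha) (pow_ne_zero 2 hk)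
      (pow_ne_zero 2 hq) n) hsa hsk hsq ?_ (ContinuousAt.mul ?_ ?_)
  · refine tendsto_finsetSum _ fun j hj => ContinuousAt.mul (ContinuousAt.div ?_ ?_
      (h2.qPochs_ne ?_ (by have := Finset.mem_range.1 hj; omega))) (ContinuousAt.div ?_ ?_
        (h3.qPochs_ne ?_ (by have := Finset.mem_range.1 hj; omega)))
    · simp only [qPochs, List.map_cons, List.map_nil, List.prod_cons, List.prod_nil, mul_one]
      fun_prop (disch := simp [hsa])
    · simp only [qPochs, List.map_cons, List.map_nil, List.prod_cons, List.prod_nil, mul_one]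
      fun_prop (disch := simp [hsk, hsq])
    · simp only [List.mem_cons, List.not_mem_nil, or_false]; tauto
    · simp only [qPochs, List.map_cons, List.map_nil, List.prod_cons, List.prod_nil, mul_one]
      fun_prop (disch := simp [hsk, hsq])
    · simp only [qPochs, List.map_cons, List.map_nil, List.prod_cons, List.prod_nil, mul_one]
      fun_prop (disch := simp [hsk, hsq])
    · simp only [List.mem_cons, List.not_mem_nil, or_false]; tauto
  · refine continuousAt_chainPrefactor_sq_sq hsa n ?_ (h3.qPochs_ne ?_ le_rfl)
    · rwa [← pow_mul (sq ^ 2), show 2 * (2 * n) = 4 * n by ring]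
    · simp only [List.mem_cons, List.not_mem_nil, or_false]; tauto
  · refine continuousAt_basicHyp n (fun _ => rfl) ?_ (by fun_prop (disch := simp [hsk, hsq]))
      (fun j hj => h3.qPochs_ne ?_ hj) (fun j => ?_) (fun j => ?_)
    · filter_upwards [eventually_base_ne_zero hsq] with p hp j hj
      exact qPochs_eq_zero (by simp) (qPoch_base_sq_eq_zero hp hj)
    · simp only [List.mem_cons, List.not_mem_nil, or_false]; tauto
    · simp only [qPochs, List.map_cons, List.map_nil, List.prod_cons, List.prod_nil, mul_one]
      fun_prop (disch := simp [hsa, hsk, hsq])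
    · simp only [qPochs, List.map_cons, List.map_nil, List.prod_cons, List.prod_nil, mul_one]
      fun_prop (disch := simp [hsk, hsq])

theorem transformation_7phi6_9phi8 {sa sk sq : ℂ} (hsa : sa ≠ 0) (hsk : sk ≠ 0) (hsq : sq ≠ 0)
    (n : ℕ) : Transformation_7phi6_9phi8 (sa ^ 2) (sk ^ 2) (sq ^ 2) sa sk sq n := by
  intro h1 h2
  refine eq_of_forall_mulIndep (fun sa sk sq ha hk hq hg =>
    transformation_7phi6_9phi8_generic hg (pow_ne_zero 2 ha) (pow_ne_zero 2 hk)
      (pow_ne_zero 2 hq) rfl rfl rfl n) hsa hsk hsq ?_ (ContinuousAt.mul ?_ ?_)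
  · refine continuousAt_basicHyp n (fun _ => rfl) ?_ (by fun_prop (disch := simp [hsa, hsk, hsq]))
      (fun j hj => h2.qPochs_ne ?_ hj) (fun j => ?_) (fun j => ?_)
    · filter_upwards [eventually_base_ne_zero hsq] with p hp j hj
      exact qPochs_eq_zero (by simp) (qPoch_neg_pow_eq_zero hp hj)
    · simp only [List.mem_cons, List.not_mem_nil, or_false]; tauto
    · simp only [qPochs, List.map_cons, List.map_nil, List.prod_cons, List.prod_nil, mul_one]
      fun_prop (disch := simp [hsa, hsq])
    · simp only [qPochs, List.map_cons, List.map_nil, List.prod_cons, List.prod_nil, mul_one]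
      fun_prop (disch := simp [hsk, hsq])
  · exact continuousAt_chainPrefactor_sq hsa n h1 (h2.qPochs_ne
      (by simp only [List.mem_cons, List.not_mem_nil, or_false]; tauto) le_rfl)
  · refine continuousAt_basicHyp n (fun _ => rfl) ?_ (by fun_prop (disch := simp [hsa, hsk, hsq]))
      (fun j hj => h2.qPochs_ne ?_ hj) (fun j => ?_) (fun j => ?_)
    · filter_upwards [eventually_base_ne_zero hsq] with p hp j hj
      exact qPochs_eq_zero (by simp) (qPoch_neg_pow_eq_zero hp hj)
    · simp only [List.mem_cons, List.not_mem_nil, or_false]; tauto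
    · simp only [qPochs, List.map_cons, List.map_nil, List.prod_cons, List.prod_nil, mul_one]
      fun_prop (disch := simp [hsa, hsk, hsq])
    · simp only [qPochs, List.map_cons, List.map_nil, List.prod_cons, List.prod_nil, mul_one]
      fun_prop (disch := simp [hsk, hsq])

theorem transformation_8phi7_6phi5 {sa sk sq : ℂ} (hsa : sa ≠ 0) (hsk : sk ≠ 0) (hsq : sq ≠ 0)
    (n : ℕ) : Transformation_8phi7_6phi5 (sa ^ 2) (sk ^ 2) (sq ^ 2) sa sk sq n := by
  intro h1 h2 h3
  refine eq_of_forall_mulIndep (fun sa sk sq ha hk hq hg =>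
    transformation_8phi7_6phi5_generic hg (pow_ne_zero 2 ha) (pow_ne_zero 2 hk)
      (pow_ne_zero 2 hq) rfl rfl rfl n) hsa hsk hsq ?_ (ContinuousAt.mul ?_ ?_)
  · refine continuousAt_basicHyp n (fun _ => rfl) ?_ (by fun_prop (disch := simp [hsa]))
      (fun j hj => h2.qPochs_ne ?_ hj) (fun j => ?_) (fun j => ?_)
    · filter_upwards [eventually_base_ne_zero hsq] with p hp j hj
      exact qPochs_eq_zero (by simp) (qPoch_neg_pow_eq_zero hp hj)
    · simp only [List.mem_cons, List.not_mem_nil, or_false]; tauto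
    · simp only [qPochs, List.map_cons, List.map_nil, List.prod_cons, List.prod_nil, mul_one]
      fun_prop (disch := simp [hsk, hsq])
    · simp only [qPochs, List.map_cons, List.map_nil, List.prod_cons, List.prod_nil, mul_one]
      fun_prop (disch := simp [hsk, hsq])
  · exact continuousAt_chainPrefactor_sq hsa n h1 (h2.qPochs_ne
      (by simp only [List.mem_cons, List.not_mem_nil, or_false]; tauto) le_rfl)
  · refine continuousAt_basicHyp (n / 2) (fun _ => rfl) ?_ (by fun_prop (disch := simp [hsa, hsk, hsq]))
      (fun j hj => h3.qPochs_ne ?_ hj) (fun j => ?_) (fun j => ?_)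
    · filter_upwards [eventually_base_ne_zero hsq] with p hp j hj
      simp only [qPochs, List.map_cons, List.map_nil, List.prod_cons, List.prod_nil, mul_one]
      rw [qPoch_mul_qPoch_eq_zero hp hj]; ring
    · simp only [List.mem_cons, List.not_mem_nil, or_false]; tauto
    · simp only [qPochs, List.map_cons, List.map_nil, List.prod_cons, List.prod_nil, mul_one]
      fun_prop (disch := simp [hsk, hsq])
    · simp only [qPochs, List.map_cons, List.map_nil, List.prod_cons, List.prod_nil, mul_one]
      fun_prop (disch := simp [hsk, hsq])

end

theorem mainTheorem10 (a k q sa sk sq : ℂ) (ha : a ≠ 0) (hk : k ≠ 0) (hq : q ≠ 0)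
    (hsa : sa ^ 2 = a) (hsk : sk ^ 2 = k) (hsq : sq ^ 2 = q) (n : ℕ) :
    Transformation_10phi9_4phi3 a k q sa sk sq n ∧
    Transformation_8phi7_5phi4 a k q sa sk sq n ∧
    Transformation_16W15_7phi6 a k q sa sk sq n ∧
    Transformation_BressoudI_7phi6 a k q sa n ∧
    Transformation_BressoudII_7phi6 a k q n ∧
    Transformation_7phi6_9phi8 a k q sa sk sq n ∧
    Transformation_8phi7_6phi5 a k q sa sk sq n := by
  -- The chosen roots become the independent variables and `a, k, q` their squares, which is the
  -- form in which the density argument applies.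
  obtain rfl := hsa
  obtain rfl := hsk
  obtain rfl := hsq
  have ha := (pow_ne_zero_iff two_ne_zero).1 ha
  have hk := (pow_ne_zero_iff two_ne_zero).1 hk
  have hq := (pow_ne_zero_iff two_ne_zero).1 hq
  exact ⟨transformation_10phi9_4phi3 ha hk hq n, transformation_8phi7_5phi4 ha hk hq n,
    transformation_16W15_7phi6 ha hk hq n, transformation_bressoudI ha hk hq n,
    transformation_bressoudII ha hk hq n, transformation_7phi6_9phi8 ha hk hq n,
    transformation_8phi7_6phi5 ha hk hq n⟩
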